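/- Let $V$ be a smooth, strictly positive function on $[0,1]$. Consider the forced Burgers equation on $[0,1]$ $$\partial_t u+u\,\partial_x u=\partial_{xx}^2u+2\,\partial_xV,\qquad u(t,0)=u(t,1)=0,\qquad u(0,\cdot)=u_0\in L^2([0,1]),$$ where a solution is a map $u\in C([0,\infty);L^2([0,1]))$ with $u(0)=u_0$ which, for $t>0$, is a classical solution ($u,\partial_tu,\partial_xu,\partial^2_{xx}u$ continuous on $(0,\infty)\times[0,1]$). Let $$H(u)(x)=\frac{e^{-\frac12\int_0^xu(s)\,ds}}{\int_0^1e^{-\frac12\int_0^yu(s)\,ds}\,dy}$$ be the Cole–Hopf transform. Let $\mu_0\le\mu_1\le\cdots$ be the eigenvalues of $-\partial_{xx}^2+V$ on $[0,1]$ with Neumann boundary conditions (repeated according to multiplicity), $(e_n)_{n\ge0}$ a complete orthonormal set in $L^2([0,1])$ of associated eigenfunctions, normalized so that $e_0>0$ on $(0,1)$, and $c_n(v)=\int_0^1e_n(x)v(x)\,dx$. For $m\ge0$ and a multi-index $\nu=(q_0,\dots,q_m)\in\mathbb N^{m+1}$ let $$\lambda_\nu=\sum_{i=0}^m(\mu_{q_i}-\mu_0),\quad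 \varphi_\nu(u)=\prod_{i=0}^m\frac{c_{q_i}(H(u))}{c_0(H(u))},\quad a_\nu(x)=2(-1)^{m+1}\,\frac{\partial_xe_{q_0}(x)}{e_0(x)}\prod_{i=1}^m\frac{e_{q_i}(x)}{e_0(x)}.$$ Such systems $(\mu_n,e_n)$ exist. For every $u_0\in L^2([0,1])$ the Burgers equation has exactly one solution $t\mapsto\Phi^t_{\mathcal B}(u_0)$, and each $\Phi^t_{\mathcal B}$, $t\ge0$, is continuous on $L^2([0,1])$; hence the Koopman operator $\mathcal K^t_{\mathcal B}\phi=\phi\circ\Phi^t_{\mathcal B}$ is a well-defined linear operator on the space $\mathcal F$ of continuous functionals $L^2([0,1])\to\mathbb R$. For every such system $(\mu_n,e_n)$: 1. $c_0(H(u))>0$ for all $u\in L^2([0,1])$. For every $m\ge 0$ and every $\nu\in\mathbb N^{m+1}$, $\varphi_\nu$ is a nonzero element of $\mathcal F$, and for all $t\ge0$ $$\mathcal K^t_{\mathcal B}\varphi_\nu=e^{-\lambda_\nu t}\varphi_\nu,$$ that is, $e^{-\lambda_\nu t}$ is an eigenvalue of $\mathcal K^t_{\mathcal B}$ with eigenfunctional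 $\varphi_\nu$. 2. Consequently the time dependences and the coefficients in the Koopman decomposition of the Burgers flow are these eigenvalues and the values of these eigenfunctionals at the data: let $C_1$ be a constant with $\sup_{[0,1]}|f|\le C_1\|f\|_{H^1}$ for all $f\in H^1(0,1)$, let $m_0=\inf_{[0,1]}e_0$ and $h_1(t)=C_1\big(\sum_{n\ge1}(1+\mu_n)e^{-2(\mu_n-\mu_0)t}\big)^{1/2}$. If $u_0\in L^2([0,1])$, $v_0=H(u_0)$ and $t>0$ satisfy $$\frac{\|v_0-c_0(v_0)e_0\|_{L^2}}{c_0(v_0)\,m_0}\,h_1(t)<1,$$ then $\Phi^t_{\mathcal B}(u_0)$ has a continuous representative $u(t,\cdot)$ and, for all $x\in[0,1]$, $$u(t,x)=\sum_{q_0=0}^\infty\ \sum_{m=0}^\infty\ \sum_{(q_1,\dots,q_m)\in(\mathbb N\setminus\{0\})^m}e^{-\lambda_\nu t}\,\varphi_\nu(u_0)\,a_\nu(x),\qquad \nu=(q_0,\dots,q_m),$$ where each of the three successive sums converges absolutely. -/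

import Mathlib

open Set Filter Topology MeasureTheory
open scoped NNReal ContDiff

noncomputable section

namespace BurgersKoopman

/-- The real Hilbert space `L²([0,1])`. -/
abbrev L2 : Type := Lp ℝ 2 (volume.restrict (Icc (0 : ℝ) 1))

/-- The trajectory `u : [0,∞) → L²([0,1])` solves the forced Burgers equation
`∂ₜu + u ∂ₓu = ∂ₓₓu + 2 ∂ₓV`, `u(t,0) = u(t,1) = 0`, with Cauchy data `u₀ ∈ L²([0,1])`:
it is continuous in `L²` up to time `0`, starts at `u₀`, and for `t > 0` it is represented by a
function `U` that is a classical solution (`U`, `∂ₜU`, `∂ₓU`, `∂ₓₓU` are continuous on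
`(0,∞) × [0,1]`). -/
structure IsBurgersSolution (V : ℝ → ℝ) (u₀ : L2) (u : ℝ≥0 → L2) : Prop where
  continuous : Continuous u
  initial : u 0 = u₀
  classical : ∃ U Ut Ux Uxx : ℝ → ℝ → ℝ,
    (∀ t : ℝ≥0, 0 < t → ⇑(u t) =ᵐ[volume.restrict (Icc (0 : ℝ) 1)] U t) ∧
    ContinuousOn (Function.uncurry U) (Ioi 0 ×ˢ Icc 0 1) ∧
    ContinuousOn (Function.uncurry Ut) (Ioi 0 ×ˢ Icc 0 1) ∧
    ContinuousOn (Function.uncurry Ux) (Ioi 0 ×ˢ Icc 0 1) ∧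
    ContinuousOn (Function.uncurry Uxx) (Ioi 0 ×ˢ Icc 0 1) ∧
    (∀ t : ℝ, 0 < t → ∀ x ∈ Icc (0 : ℝ) 1,
      HasDerivAt (fun s => U s x) (Ut t x) t ∧
      HasDerivWithinAt (U t) (Ux t x) (Icc 0 1) x ∧
      HasDerivWithinAt (Ux t) (Uxx t x) (Icc 0 1) x) ∧
    (∀ t : ℝ, 0 < t → U t 0 = 0 ∧ U t 1 = 0) ∧
    (∀ t : ℝ, 0 < t → ∀ x ∈ Ioo (0 : ℝ) 1,
      Ut t x + U t x * Ux t x = Uxx t x + 2 * deriv V x)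

/-- `Φ` is the Burgers flow on `L²([0,1])`: for every Cauchy datum `u₀` the orbit
`t ↦ Φ t u₀` is a solution, and it is the only one. -/
def IsBurgersFlow (V : ℝ → ℝ) (Φ : ℝ≥0 → C(L2, L2)) : Prop :=
  ∀ (u₀ : L2) (u : ℝ≥0 → L2), IsBurgersSolution V u₀ u ↔ ∀ t, u t = Φ t u₀

/-- The Koopman operator `φ ↦ φ ∘ T` of a continuous map `T` of `L²([0,1])`, acting on the space
of continuous functionals on `L²([0,1])`. -/
def koopman (T : C(L2, L2)) : Module.End ℝ C(L2, ℝ) where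
  toFun φ := φ.comp T
  map_add' _ _ := rfl
  map_smul' _ _ := rfl

/-- The Cole-Hopf transform
`H(u)(x) = exp(-½ ∫₀ˣ u) / ∫₀¹ exp(-½ ∫₀ʸ u) dy`. -/
def coleHopf (u : L2) (x : ℝ) : ℝ :=
  Real.exp (-(1 / 2) * ∫ s in (0 : ℝ)..x, u s) /
    ∫ y in (0 : ℝ)..1, Real.exp (-(1 / 2) * ∫ s in (0 : ℝ)..y, u s)

/-- `μ 0 ≤ μ 1 ≤ …` are the eigenvalues (repeated according to multiplicity) of
`-∂ₓₓ + V` on `[0,1]` with Neumann boundary conditions, and `e 0, e 1, …` is a complete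
orthonormal set in `L²([0,1])` of associated eigenfunctions, with `e 0 > 0` on `(0,1)`. -/
structure IsNeumannEigensystem (V : ℝ → ℝ) (μ : ℕ → ℝ) (e : ℕ → ℝ → ℝ) : Prop where
  monotone : Monotone μ
  contDiffOn : ∀ n, ContDiffOn ℝ 2 (e n) (Icc 0 1)
  eigen : ∀ n, ∀ x ∈ Icc (0 : ℝ) 1,
    derivWithin (derivWithin (e n) (Icc 0 1)) (Icc 0 1) x - V x * e n x = -μ n * e n x
  neumann : ∀ n, derivWithin (e n) (Icc 0 1) 0 = 0 ∧ derivWithin (e n) (Icc 0 1) 1 = 0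
  orthonormal : ∀ m n, ∫ x in (0 : ℝ)..1, e m x * e n x = if m = n then 1 else 0
  complete : ∀ f : L2, (∀ n, ∫ x in (0 : ℝ)..1, e n x * f x = 0) → f = 0
  pos : ∀ x ∈ Ioo (0 : ℝ) 1, 0 < e 0 x

/-- `cₙ(v) = ∫₀¹ eₙ v`. -/
def coeff (e : ℕ → ℝ → ℝ) (n : ℕ) (v : ℝ → ℝ) : ℝ :=
  ∫ x in (0 : ℝ)..1, e n x * v x

/-- `λ_ν = ∑ᵢ (μ_{qᵢ} - μ₀)` for `ν = (q₀,…,q_m)`. -/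
def lam (μ : ℕ → ℝ) {m : ℕ} (ν : Fin (m + 1) → ℕ) : ℝ :=
  ∑ i, (μ (ν i) - μ 0)

/-- `φ_ν(u) = ∏ᵢ c_{qᵢ}(H(u)) / c₀(H(u))` for `ν = (q₀,…,q_m)`. -/
def eigenfunctional (e : ℕ → ℝ → ℝ) {m : ℕ} (ν : Fin (m + 1) → ℕ) (u : L2) : ℝ :=
  ∏ i, coeff e (ν i) (coleHopf u) / coeff e 0 (coleHopf u)

/-- The Koopman mode
`a_ν(x) = 2 (-1)^{m+1} (∂ₓe_{q₀}(x) / e₀(x)) ∏_{i=1}^m e_{qᵢ}(x) / e₀(x)`. -/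
def mode (e : ℕ → ℝ → ℝ) {m : ℕ} (ν : Fin (m + 1) → ℕ) (x : ℝ) : ℝ :=
  2 * (-1) ^ (m + 1) * (derivWithin (e (ν 0)) (Icc 0 1) x / e 0 x) *
    ∏ i : Fin m, e (ν i.succ) x / e 0 x

/-- The multi-index `(q₀, q₁, …, q_m)` with `q₀ ≥ 0` and `q₁, …, q_m ≥ 1`. -/
def index (q₀ : ℕ) {m : ℕ} (q : Fin m → ℕ+) : Fin (m + 1) → ℕ :=
  Fin.cons q₀ (fun i => (q i : ℕ))

/-- The term `e^{-λ_ν t} φ_ν(u₀) a_ν(x)` of the Koopman decomposition. -/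
def koopmanTerm (μ : ℕ → ℝ) (e : ℕ → ℝ → ℝ) (t : ℝ≥0) (u₀ : L2) (x : ℝ) {m : ℕ}
    (ν : Fin (m + 1) → ℕ) : ℝ :=
  Real.exp (-lam μ ν * t) * eigenfunctional e ν u₀ * mode e ν x

/-- `C` is a constant in the Sobolev inequality `sup |f| ≤ C ‖f‖_{H¹}` on `[0,1]`; the functions
of `H¹` are the `f(x) = a + ∫₀ˣ g` with `g ∈ L²([0,1])`. -/
def IsSobolevConstant (C : ℝ) : Prop :=
  ∀ (f : ℝ → ℝ) (a : ℝ) (g : L2), (∀ x ∈ Icc (0 : ℝ) 1, f x = a + ∫ s in (0 : ℝ)..x, g s) →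
    ∀ x ∈ Icc (0 : ℝ) 1,
      |f x| ≤ C * √((∫ y in (0 : ℝ)..1, f y ^ 2) + ∫ y in (0 : ℝ)..1, g y ^ 2)

/-- `h₁(t) = C (∑_{n ≥ 1} (1 + μₙ) e^{-2(μₙ-μ₀)t})^{1/2}`. -/
def h₁ (C : ℝ) (μ : ℕ → ℝ) (t : ℝ) : ℝ :=
  C * √(∑' n : ℕ, (1 + μ (n + 1)) * Real.exp (-2 * (μ (n + 1) - μ 0) * t))

/-- The condition `‖v₀ - c₀(v₀) e₀‖_{L²} h₁(t) / (c₀(v₀) m₀) < 1`, where `v₀ = H(u₀)` and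
`m₀ = inf_{[0,1]} e₀`. -/
def SmallnessCondition (C : ℝ) (μ : ℕ → ℝ) (e : ℕ → ℝ → ℝ) (u₀ : L2) (t : ℝ) : Prop :=
  √(∫ x in (0 : ℝ)..1, (coleHopf u₀ x - coeff e 0 (coleHopf u₀) * e 0 x) ^ 2) /
    (coeff e 0 (coleHopf u₀) * sInf (e 0 '' Icc 0 1)) * h₁ C μ t < 1

/-- The Koopman decomposition of `w` at `(t, u₀)`: `w` has a continuous representative equal,
everywhere on `[0,1]`, to the convergent iterated series
`∑_{q₀ ≥ 0} ∑_{m ≥ 0} ∑_{q₁,…,q_m ≥ 1} e^{-λ_ν t} φ_ν(u₀) a_ν(x)`, `ν = (q₀,…,q_m)`. -/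
def HasKoopmanDecomposition (μ : ℕ → ℝ) (e : ℕ → ℝ → ℝ) (t : ℝ≥0) (u₀ w : L2) : Prop :=
  ∃ U : ℝ → ℝ, ContinuousOn U (Icc 0 1) ∧
    ⇑w =ᵐ[volume.restrict (Icc (0 : ℝ) 1)] U ∧
    ∀ x ∈ Icc (0 : ℝ) 1,
      (∀ q₀ m, Summable fun q : Fin m → ℕ+ => koopmanTerm μ e t u₀ x (index q₀ q)) ∧
      (∀ q₀, Summable fun m : ℕ =>
        ∑' q : Fin m → ℕ+, koopmanTerm μ e t u₀ x (index q₀ q)) ∧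
      HasSum (fun q₀ : ℕ => ∑' m : ℕ, ∑' q : Fin m → ℕ+, koopmanTerm μ e t u₀ x (index q₀ q))
        (U x)

end BurgersKoopman

end

open BurgersKoopman

noncomputable section

namespace BurgersKoopman

/-! The Cole–Hopf substitution linearizes the equation. For any solution `u`, the function `p =
exp(-½∫₀ˣ u)` satisfies `p_t = p_xx - V p + g(t) p`, where `g` depends on time alone and comes from
integrating the Burgers equation in `x` from `0`; the Dirichlet conditions on `u` become Neumann
conditions on `p`. Hence the coefficient of `p` along `eₙ` obeys `dₙ' = (g - μₙ) dₙ`. The unknown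
`g` cancels in `dₙ/d₀`, which therefore evolves by the factor `e^{-(μₙ-μ₀)t}`, and products of such
ratios are Koopman eigenfunctionals (`exists_hasDerivAt_integral`, `expCoef_ratio`). By completeness
the ratios determine `u` (`eq_of_expCoef_ratio`), so the same computation proves uniqueness.

For existence, `H(u₀)` is propagated by `∑ e^{-μₙ t} cₙ eₙ`. This series is smooth enough for `t >
0`, stays positive by a barrier argument (`pos_of_heat_equation`), and `-2 v_x/v` solves Burgers
(`isBurgersSolution_flow`). Continuity in `L²`, in the datum and down to `t = 0`, holds because `H`
is continuous from `L²` into `H¹`, the heat semigroup is continuous on `H¹`, and `v ↦ -2v'/v` is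
continuous from positive `H¹` functions to `L²`.

The spectral theory rests on the energy form `∫ V f h + ∫ f' h'`, taken as the inner product of
`H¹`. The resolvent is then the compact embedding into `L²` composed with its adjoint. Weak
eigenvectors are classical, eigenvalues are simple by ODE uniqueness, `∑ 1/μₙ` converges because
point evaluation is bounded on `H¹`, and the ground state has no zero because cutting it at one
would give a second minimizer of the Rayleigh quotient.

For the decomposition, factor the ground mode out of `v`, so that `v = c₀ e^{-μ₀t} e₀ (1 + R)`.
Cauchy–Schwarz and the Sobolev bound on `eₙ` turn the smallness condition into `|R| < 1`; expanding
`1/(1+R)` geometrically and each power of `R` over multi-indices gives the Koopman series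
(`hasKoopmanDecomposition`). -/

/-! ### Continuous and square-integrable functions on `[0,1]`, and primitives -/

/-- The space of continuous functions on `[0,1]`. -/
abbrev C01 : Type := C(Icc (0 : ℝ) 1, ℝ)

/-- Lebesgue measure on `[0,1]`. -/
abbrev vol01 : Measure ℝ := volume.restrict (Icc (0 : ℝ) 1)

instance : IsProbabilityMeasure vol01 := ⟨by simp [vol01]⟩

/-- The extension of a continuous function on `[0,1]` by constants. -/
def ext (m : C01) (x : ℝ) : ℝ := m (projIcc 0 1 zero_le_one x)

theorem ext_of_mem (m : C01) {x : ℝ} (hx : x ∈ Icc (0 : ℝ) 1) : ext m x = m ⟨x, hx⟩ := by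
  rw [ext, projIcc_of_mem _ hx]

theorem continuous_ext (m : C01) : Continuous (ext m) :=
  m.continuous.comp continuous_projIcc

theorem abs_ext_le (m : C01) (x : ℝ) : |ext m x| ≤ ‖m‖ := m.norm_coe_le_norm _

theorem ext_add (m n : C01) (x : ℝ) : ext (m + n) x = ext m x + ext n x := rfl

theorem ext_smul (c : ℝ) (m : C01) (x : ℝ) : ext (c • m) x = c * ext m x := rfl

/-- The element of `C([0,1])` given by a function continuous on `[0,1]`. -/
def ofCont (f : ℝ → ℝ) (hf : ContinuousOn f (Icc 0 1)) : C01 :=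
  ⟨(Icc (0 : ℝ) 1).domRestrict f, hf.domRestrict⟩

theorem ofCont_apply (f : ℝ → ℝ) (hf : ContinuousOn f (Icc 0 1)) (x : Icc (0 : ℝ) 1) :
    ofCont f hf x = f x := rfl

theorem ext_ofCont {f : ℝ → ℝ} (hf : ContinuousOn f (Icc 0 1)) {x : ℝ} (hx : x ∈ Icc (0 : ℝ) 1) :
    ext (ofCont f hf) x = f x := by
  rw [ext_of_mem _ hx]; rfl

theorem integral_vol01 (f : ℝ → ℝ) : ∫ x, f x ∂vol01 = ∫ x in (0 : ℝ)..1, f x := by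
  rw [intervalIntegral.integral_of_le zero_le_one, vol01, integral_Icc_eq_integral_Ioc]

theorem ae_vol01_mem : ∀ᵐ x ∂vol01, x ∈ Icc (0 : ℝ) 1 :=
  ae_restrict_mem measurableSet_Icc

theorem integral_congr_Icc {f g : ℝ → ℝ} (h : ∀ x ∈ Icc (0 : ℝ) 1, f x = g x) :
    ∫ x in (0 : ℝ)..1, f x = ∫ x in (0 : ℝ)..1, g x :=
  intervalIntegral.integral_congr fun x hx => h x (by rwa [uIcc_of_le zero_le_one] at hx)

theorem integral_congr_vol01 {f g : ℝ → ℝ} (h : f =ᵐ[vol01] g) :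
    ∫ x in (0 : ℝ)..1, f x = ∫ x in (0 : ℝ)..1, g x := by
  rw [← integral_vol01, ← integral_vol01, integral_congr_ae h]

theorem inner_L2 (f g : L2) : inner ℝ f g = ∫ x in (0 : ℝ)..1, f x * g x := by
  rw [L2.inner_def, ← integral_vol01]
  exact integral_congr_ae (ae_of_all _ fun x => by simp [mul_comm])

theorem norm_sq_L2 (f : L2) : ‖f‖ ^ 2 = ∫ x in (0 : ℝ)..1, f x ^ 2 := by
  rw [← real_inner_self_eq_norm_sq, inner_L2]
  simp only [sq]

theorem integrable_L2 (f : L2) : Integrable f vol01 :=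
  (Lp.memLp f).integrable (by norm_num)

theorem intervalIntegrable_L2 (f : L2) : IntervalIntegrable f volume 0 1 := by
  rw [intervalIntegrable_iff_integrableOn_Icc_of_le zero_le_one]
  exact integrable_L2 f

theorem intervalIntegrable_L2' (f : L2) {x y : ℝ} (hx : x ∈ Icc (0 : ℝ) 1)
    (hy : y ∈ Icc (0 : ℝ) 1) : IntervalIntegrable f volume x y :=
  (intervalIntegrable_L2 f).mono_set (by
    rw [uIcc_of_le zero_le_one]; exact uIcc_subset_Icc hx hy)

theorem memLp_mul_ext (m : C01) (f : L2) : MemLp (fun x => ext m x * f x) 2 vol01 :=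
  (Lp.memLp f).of_le_mul (c := ‖m‖)
    ((continuous_ext m).aestronglyMeasurable.mul (Lp.aestronglyMeasurable f))
    (ae_of_all _ fun x => by
      rw [norm_mul]
      exact mul_le_mul_of_nonneg_right (abs_ext_le m x) (norm_nonneg _))

/-- Multiplication of square-integrable functions by continuous functions. -/
def mulC : C01 →L[ℝ] L2 →L[ℝ] L2 :=
  LinearMap.mkContinuous₂
    (LinearMap.mk₂ ℝ (fun m f => (memLp_mul_ext m f).toLp _)
      (fun m n f => by
        rw [← MemLp.toLp_add]
        exact MemLp.toLp_congr _ _ (ae_of_all _ fun x => by simp [ext_add, add_mul]))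
      (fun c m f => by
        rw [← MemLp.toLp_const_smul]
        exact MemLp.toLp_congr _ _ (ae_of_all _ fun x => by simp [ext_smul, mul_assoc]))
      (fun m f g => by
        rw [← MemLp.toLp_add]
        refine MemLp.toLp_congr _ _ ?_
        filter_upwards [Lp.coeFn_add f g] with x hx
        change ext m x * (f + g : L2) x = ext m x * f x + ext m x * g x
        rw [hx, Pi.add_apply, mul_add])
      (fun c m f => by
        rw [← MemLp.toLp_const_smul]
        refine MemLp.toLp_congr _ _ ?_
        filter_upwards [Lp.coeFn_smul c f] with x hx
        change ext m x * (c • f : L2) x = c * (ext m x * f x)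
        rw [hx, Pi.smul_apply, smul_eq_mul]; ring))
    1 (fun m f => by
      rw [one_mul]
      refine Lp.norm_le_mul_norm_of_ae_le_mul ?_
      filter_upwards [(memLp_mul_ext m f).coeFn_toLp] with x hx
      simp only [LinearMap.mk₂_apply, hx, norm_mul]
      exact mul_le_mul_of_nonneg_right (abs_ext_le m x) (norm_nonneg _))

theorem mulC_ae (m : C01) (f : L2) : mulC m f =ᵐ[vol01] fun x => ext m x * f x :=
  (memLp_mul_ext m f).coeFn_toLp

/-- The inclusion of `C([0,1])` in `L²([0,1])`. -/
def toL2 : C01 →L[ℝ] L2 := mulC.flip (Lp.const 2 vol01 (1 : ℝ))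

theorem toL2_ae (m : C01) : toL2 m =ᵐ[vol01] ext m := by
  filter_upwards [mulC_ae m (Lp.const 2 vol01 (1 : ℝ)), Lp.coeFn_const 2 vol01 (1 : ℝ)] with x h1 h2
  rw [toL2, ContinuousLinearMap.flip_apply, h1, h2]; simp

theorem toL2_ofCont_ae {f : ℝ → ℝ} (hf : ContinuousOn f (Icc 0 1)) :
    toL2 (ofCont f hf) =ᵐ[vol01] f := by
  filter_upwards [toL2_ae (ofCont f hf), ae_vol01_mem] with x h1 h2
  rw [h1, ext_ofCont hf h2]

theorem inner_toL2 (m : C01) (g : L2) : inner ℝ (toL2 m) g = ∫ x in (0 : ℝ)..1, ext m x * g x := by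
  rw [inner_L2]
  refine integral_congr_vol01 ?_
  filter_upwards [toL2_ae m] with x hx
  rw [hx]

theorem inner_toL2_toL2 (m n : C01) :
    inner ℝ (toL2 m) (toL2 n) = ∫ x in (0 : ℝ)..1, ext m x * ext n x := by
  rw [inner_toL2]
  refine integral_congr_vol01 ?_
  filter_upwards [toL2_ae n] with x hx
  rw [hx]

theorem toL2_injective : Function.Injective toL2 := by
  rw [injective_iff_map_eq_zero]
  intro m hm
  have h : ext m =ᵐ[vol01] fun _ => 0 := by
    filter_upwards [toL2_ae m, Lp.coeFn_zero ℝ 2 vol01] with x h1 h2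
    rw [← h1, hm, h2]; rfl
  have h' := Measure.eqOn_Icc_of_ae_eq (μ := volume) (a := (0 : ℝ)) (b := 1) (by norm_num)
    h (continuous_ext m).continuousOn continuousOn_const
  ext x
  have := h' x.2
  rwa [ext_of_mem m x.2] at this

/-- Cauchy–Schwarz against the indicator of the interval. The square-root modulus later supplies the
equicontinuity behind compactness. -/
theorem abs_integral_L2_le (g : L2) {x y : ℝ} (hx : x ∈ Icc (0 : ℝ) 1) (hy : y ∈ Icc (0 : ℝ) 1) :
    |∫ s in x..y, g s| ≤ √|y - x| * ‖g‖ := by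
  wlog hxy : x ≤ y generalizing x y
  · rw [intervalIntegral.integral_symm, abs_neg, abs_sub_comm]
    exact this hy hx (le_of_not_ge hxy)
  have hs : MeasurableSet (Ioc x y) := measurableSet_Ioc
  have hsub : Ioc x y ⊆ Icc 0 1 := fun z hz => ⟨hx.1.trans hz.1.le, hz.2.trans hy.2⟩
  have h1 := L2.inner_indicatorConstLp_one (𝕜 := ℝ) hs (measure_ne_top vol01 _) g
  have h2 : ∫ s in x..y, g s = ∫ s in Ioc x y, g s ∂vol01 := by
    rw [intervalIntegral.integral_of_le hxy, vol01, Measure.restrict_restrict hs,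
      inter_eq_left.mpr hsub]
  rw [h2, ← h1]
  refine (abs_real_inner_le_norm _ _).trans (le_of_eq ?_)
  rw [norm_indicatorConstLp (by norm_num) (by norm_num)]
  congr 1
  have : vol01.real (Ioc x y) = y - x := by
    rw [measureReal_def, vol01, Measure.restrict_apply hs, inter_eq_left.mpr hsub, Real.volume_Ioc,
      ENNReal.toReal_ofReal (by linarith)]
  rw [this, abs_of_nonneg (by linarith : 0 ≤ y - x), Real.sqrt_eq_rpow]
  simp

theorem continuousOn_integral_L2 (g : L2) :
    ContinuousOn (fun x => ∫ s in (0 : ℝ)..x, g s) (Icc 0 1) := by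
  have := intervalIntegral.continuousOn_primitive_interval' (intervalIntegrable_L2 g)
    (left_mem_uIcc)
  rwa [uIcc_of_le zero_le_one] at this

/-- The primitive vanishing at `0`. -/
def primC : L2 →L[ℝ] C01 :=
  LinearMap.mkContinuous
    { toFun := fun g => ofCont _ (continuousOn_integral_L2 g)
      map_add' := fun f g => by
        ext x
        simp only [ofCont_apply, ContinuousMap.add_apply]
        rw [← intervalIntegral.integral_add (intervalIntegrable_L2' f (by simp) x.2)
          (intervalIntegrable_L2' g (by simp) x.2)]
        refine intervalIntegral.integral_congr_ae_restrict ?_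
        refine ae_restrict_of_ae_restrict_of_subset (t := Icc 0 1) ?_ (Lp.coeFn_add f g)
        rw [uIoc_of_le x.2.1]
        exact fun z hz => ⟨hz.1.le, hz.2.trans x.2.2⟩
      map_smul' := fun c g => by
        ext x
        simp only [ofCont_apply, ContinuousMap.smul_apply, RingHom.id_apply, smul_eq_mul]
        rw [← intervalIntegral.integral_const_mul]
        refine intervalIntegral.integral_congr_ae_restrict ?_
        refine ae_restrict_of_ae_restrict_of_subset (t := Icc 0 1) ?_ (Lp.coeFn_smul c g)
        rw [uIoc_of_le x.2.1]
        exact fun z hz => ⟨hz.1.le, hz.2.trans x.2.2⟩ }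
    1 (fun g => by
      rw [one_mul, ContinuousMap.norm_le _ (norm_nonneg _)]
      intro x
      refine (abs_integral_L2_le g (by simp) x.2).trans ?_
      refine mul_le_of_le_one_left (norm_nonneg _) (Real.sqrt_le_one.mpr ?_)
      rw [sub_zero, abs_of_nonneg x.2.1]; exact x.2.2)

theorem primC_apply (g : L2) (x : Icc (0 : ℝ) 1) : primC g x = ∫ s in (0 : ℝ)..x, g s := rfl

theorem ext_primC (g : L2) {x : ℝ} (hx : x ∈ Icc (0 : ℝ) 1) :
    ext (primC g) x = ∫ s in (0 : ℝ)..x, g s := by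
  rw [ext_of_mem _ hx, primC_apply]

theorem norm_primC_le (g : L2) : ‖primC g‖ ≤ ‖g‖ := by
  refine (primC.le_opNorm g).trans ?_
  exact mul_le_of_le_one_left (norm_nonneg _) (LinearMap.mkContinuous_norm_le _ zero_le_one _)

/-- By Lebesgue differentiation, the primitive has derivative `g` almost everywhere, and a constant
has derivative zero. -/
theorem primC_eq_const_imp {g : L2} {c : ℝ} (h : ∀ x, primC g x = c) : g = 0 := by
  refine Lp.eq_zero_iff_ae_eq_zero.mpr ?_
  have h0 : ∀ᵐ x ∂vol01, x ≠ 0 ∧ x ≠ 1 := by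
    refine ae_restrict_of_ae ?_
    rw [eventually_and]
    exact ⟨by simp [ae_iff, measure_singleton], by simp [ae_iff, measure_singleton]⟩
  filter_upwards [ae_restrict_of_ae (intervalIntegrable_L2 g).ae_hasDerivAt_integral, h0,
    ae_vol01_mem] with x hx hx0 hx1
  have hd := hx (by rwa [uIcc_of_le zero_le_one]) 0 (by simp)
  have hmem : Ioo (0 : ℝ) 1 ∈ 𝓝 x :=
    Ioo_mem_nhds (lt_of_le_of_ne hx1.1 (Ne.symm hx0.1)) (lt_of_le_of_ne hx1.2 hx0.2)
  have hc : (fun y => ∫ s in (0 : ℝ)..y, g s) =ᶠ[𝓝 x] fun _ => c := by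
    filter_upwards [hmem] with y hy
    exact h ⟨y, hy.1.le, hy.2.le⟩
  exact hd.unique ((hasDerivAt_const x c).congr_of_eventuallyEq hc)

/-- Primitives of integrable functions are absolutely continuous, which is all that the product rule
under the integral needs. -/
theorem integral_primitive_by_parts {p h : ℝ → ℝ} (hp : IntervalIntegrable p volume 0 1)
    (hh : IntervalIntegrable h volume 0 1) :
    ∫ x in (0 : ℝ)..1, (p x * (∫ s in (0 : ℝ)..x, h s) + (∫ s in (0 : ℝ)..x, p s) * h x) =
      (∫ s in (0 : ℝ)..1, p s) * ∫ s in (0 : ℝ)..1, h s := by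
  have hP := hp.absolutelyContinuousOnInterval_intervalIntegral (c := 0) (by simp)
  have hH := hh.absolutelyContinuousOnInterval_intervalIntegral (c := 0) (by simp)
  have := hP.integral_deriv_mul_eq_sub hH
  simp only [intervalIntegral.integral_same, mul_zero, sub_zero] at this
  rw [← this]
  refine intervalIntegral.integral_congr_ae ?_
  filter_upwards [hp.ae_hasDerivAt_integral, hh.ae_hasDerivAt_integral] with x h1 h2 hx
  have hx' := uIoc_subset_uIcc hx
  rw [(h1 hx' 0 (by simp)).deriv, (h2 hx' 0 (by simp)).deriv]

theorem norm_toL2_le (m : C01) : ‖toL2 m‖ ≤ ‖m‖ := by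
  have h := Lp.norm_le_of_ae_bound (f := toL2 m) (norm_nonneg m)
    ((toL2_ae m).mono fun x hx => by rw [hx]; exact abs_ext_le m x)
  have h1 : measureUnivNNReal vol01 = 1 := by
    rw [measureUnivNNReal, measure_univ]; rfl
  simpa [h1] using h


/-! ### The energy space `H¹`, its compact embedding and the resolvent -/

/-- A continuous, strictly positive potential on `[0,1]`. -/
structure Potential where
  toC01 : C01
  pos : ∀ x, 0 < toC01 x

/-- The Sobolev space `H¹(0,1)`, as the space of pairs `(f(0), f')`. -/
def H1 (_ : Potential) : Type := ℝ × L2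

namespace H1

variable {P : Potential}

/-- Only the algebraic structure is inherited from `ℝ × L2`: the norm is to come from the energy
form, which depends on the phantom argument `P`. -/
instance : AddCommGroup (H1 P) := inferInstanceAs (AddCommGroup (ℝ × L2))
instance : Module ℝ (H1 P) := inferInstanceAs (Module ℝ (ℝ × L2))

/-- The function `f(x) = a + ∫₀ˣ g` with given `(a, g)`. -/
def fnₗ : H1 P →ₗ[ℝ] C01 where
  toFun z := ContinuousMap.const _ z.1 + primC z.2
  map_add' z w := by
    ext x
    change (z.1 + w.1) + primC (z.2 + w.2) x = (z.1 + primC z.2 x) + (w.1 + primC w.2 x)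
    rw [map_add, ContinuousMap.add_apply]; ring
  map_smul' c z := by
    ext x
    change c * z.1 + primC (c • z.2) x = c * (z.1 + primC z.2 x)
    rw [map_smul, ContinuousMap.smul_apply, smul_eq_mul]; ring

theorem fnₗ_apply (z : H1 P) (x : Icc (0 : ℝ) 1) : fnₗ z x = z.1 + primC z.2 x := rfl

/-- The energy form `∫ V f h + ∫ f' h'`. -/
def form (z w : H1 P) : ℝ :=
  inner ℝ (mulC P.toC01 (toL2 (fnₗ z))) (toL2 (fnₗ w)) + inner ℝ z.2 w.2

theorem inner_mulC (m n k : C01) :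
    inner ℝ (mulC m (toL2 n)) (toL2 k) = ∫ x in (0 : ℝ)..1, ext m x * ext n x * ext k x := by
  rw [inner_L2]
  refine integral_congr_vol01 ?_
  filter_upwards [mulC_ae m (toL2 n), toL2_ae n, toL2_ae k] with x h1 h2 h3
  rw [h1, h2, h3]

theorem form_eq (z w : H1 P) : form z w =
    (∫ x in (0 : ℝ)..1, ext P.toC01 x * ext (fnₗ z) x * ext (fnₗ w) x) + inner ℝ z.2 w.2 := by
  rw [form, inner_mulC]

theorem _root_.BurgersKoopman.Potential.exists_lower_bound (P : Potential) :
    ∃ δ : ℝ, 0 < δ ∧ ∀ x, δ ≤ P.toC01 x := by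
  obtain ⟨x, -, hx⟩ := isCompact_univ.exists_isMinOn (univ_nonempty) P.toC01.continuous.continuousOn
  exact ⟨P.toC01 x, P.pos x, fun y => hx (mem_univ y)⟩

/-- Coercivity. A positive lower bound of the potential makes the energy control both the function
and its derivative in `L²`. -/
theorem form_self_ge {δ : ℝ} (hδ : ∀ x, δ ≤ P.toC01 x) (z : H1 P) :
    δ * ‖toL2 (fnₗ z)‖ ^ 2 + ‖z.2‖ ^ 2 ≤ form z z := by
  rw [form_eq, real_inner_self_eq_norm_sq, ← real_inner_self_eq_norm_sq (toL2 _), inner_toL2_toL2,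
    ← intervalIntegral.integral_const_mul]
  gcongr
  refine intervalIntegral.integral_mono_on zero_le_one ?_ ?_ fun x _ => ?_
  · exact (((continuous_ext _).mul (continuous_ext _)).const_mul _).intervalIntegrable _ _
  · exact (((continuous_ext _).mul (continuous_ext _)).mul (continuous_ext _)).intervalIntegrable _ _
  · rw [mul_assoc]
    exact mul_le_mul_of_nonneg_right (hδ _) (mul_self_nonneg _)

theorem form_self_nonneg (z : H1 P) : 0 ≤ form z z := by
  obtain ⟨δ, h0, hδ⟩ := P.exists_lower_bound
  exact le_trans (by positivity) (form_self_ge hδ z)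

/-- The constant function with value `f(x)` has `L²` norm `|f(x)|`, since the total mass is one, and
differs from `f` by at most `‖f'‖` everywhere. -/
theorem abs_fnₗ_le (z : H1 P) (x : Icc (0 : ℝ) 1) : |fnₗ z x| ≤ ‖toL2 (fnₗ z)‖ + ‖z.2‖ := by
  have h1 : ‖toL2 (ContinuousMap.const _ (fnₗ z x))‖ = |fnₗ z x| := by
    rw [← sq_eq_sq₀ (norm_nonneg _) (abs_nonneg _), sq_abs, ← real_inner_self_eq_norm_sq,
      inner_toL2_toL2]
    have : ∀ y, ext (ContinuousMap.const _ (fnₗ z x)) y = fnₗ z x := fun _ => rfl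
    simp [this, sq]
  have h2 : ‖toL2 (ContinuousMap.const _ (fnₗ z x) - fnₗ z)‖ ≤ ‖z.2‖ := by
    refine (norm_toL2_le _).trans ?_
    rw [ContinuousMap.norm_le _ (norm_nonneg _)]
    intro y
    have : (ContinuousMap.const _ (fnₗ z x) - fnₗ z : C01) y = ∫ s in (y : ℝ)..x, z.2 s := by
      rw [ContinuousMap.sub_apply, ContinuousMap.const_apply, fnₗ_apply, fnₗ_apply,
        primC_apply, primC_apply, ← intervalIntegral.integral_interval_sub_left
        (intervalIntegrable_L2' z.2 (x := 0) (by simp) x.2)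
        (intervalIntegrable_L2' z.2 (x := 0) (by simp) y.2)]
      ring
    rw [this]
    refine (abs_integral_L2_le _ y.2 x.2).trans (mul_le_of_le_one_left (norm_nonneg _) ?_)
    refine Real.sqrt_le_one.mpr ?_
    rw [abs_le]; constructor <;> linarith [x.2.1, x.2.2, y.2.1, y.2.2]
  calc |fnₗ z x| = ‖toL2 (fnₗ z) + toL2 (ContinuousMap.const _ (fnₗ z x) - fnₗ z)‖ := by
        rw [← h1, map_sub]; congr 1; abel
    _ ≤ _ := (norm_add_le _ _).trans (by gcongr)

theorem form_definite (z : H1 P) (h : form z z = 0) : z = 0 := by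
  obtain ⟨δ, h0, hδ⟩ := P.exists_lower_bound
  have h1 := form_self_ge hδ z
  rw [h] at h1
  have h2 : ‖toL2 (fnₗ z)‖ = 0 := by
    by_contra hne
    have : 0 < ‖toL2 (fnₗ z)‖ ^ 2 := by positivity
    nlinarith [sq_nonneg ‖z.2‖]
  have h3 : ‖z.2‖ = 0 := by
    by_contra hne
    have : 0 < ‖z.2‖ ^ 2 := by positivity
    nlinarith [sq_nonneg ‖toL2 (fnₗ z)‖]
  have h4 : fnₗ z = 0 := toL2_injective (by rw [norm_eq_zero.mp h2, map_zero])
  have h5 : z.1 = 0 := by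
    have := congrArg (fun m : C01 => m ⟨0, by simp⟩) h4
    simpa [fnₗ_apply, norm_eq_zero.mp h3] using this
  exact Prod.ext h5 (norm_eq_zero.mp h3)

/-- The energy form as an inner product. -/
@[reducible]
def core (P : Potential) : InnerProductSpace.Core ℝ (H1 P) where
  inner := form
  conj_inner_symm z w := by
    simp only [form_eq, conj_trivial, real_inner_comm w.2 z.2]
    congr 1
    exact integral_congr_Icc fun x _ => by ring
  re_inner_nonneg z := form_self_nonneg z
  add_left x y z := by
    have : (x + y).2 = x.2 + y.2 := rfl
    simp only [form, map_add, inner_add_left, this]; ring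
  smul_left x y r := by
    have : (r • x).2 = r • x.2 := rfl
    simp only [form, map_smul, inner_smul_left, this]; ring
  definite := form_definite

instance : NormedAddCommGroup (H1 P) := (core P).toNormedAddCommGroup
instance : InnerProductSpace ℝ (H1 P) := InnerProductSpace.ofCore (core P).toCore

theorem norm_sq_eq (z : H1 P) : ‖z‖ ^ 2 = form z z := by
  rw [← real_inner_self_eq_norm_sq]; rfl

theorem exists_abs_fnₗ_le (P : Potential) :
    ∃ C : ℝ, 0 < C ∧ ∀ (z : H1 P), ‖fnₗ z‖ ≤ C * ‖z‖ := by
  obtain ⟨δ, h0, hδ⟩ := P.exists_lower_bound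
  refine ⟨1 / √δ + 1, by positivity, fun z => ?_⟩
  rw [ContinuousMap.norm_le _ (by positivity)]
  intro x
  refine (abs_fnₗ_le z x).trans ?_
  have h1 := form_self_ge hδ z
  rw [← norm_sq_eq] at h1
  have h2 : ‖z.2‖ ≤ ‖z‖ := by
    refine abs_le_of_sq_le_sq' ?_ (norm_nonneg _) |>.2
    nlinarith [sq_nonneg ‖toL2 (fnₗ z)‖]
  have h3 : √δ * ‖toL2 (fnₗ z)‖ ≤ ‖z‖ := by
    refine abs_le_of_sq_le_sq' ?_ (norm_nonneg _) |>.2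
    rw [mul_pow, Real.sq_sqrt h0.le]
    nlinarith [sq_nonneg ‖z.2‖]
  have h4 : ‖toL2 (fnₗ z)‖ ≤ 1 / √δ * ‖z‖ := by
    rw [div_mul_eq_mul_div, one_mul, le_div_iff₀ (by positivity)]; linarith
  linarith

theorem norm_snd_le (z : H1 P) : ‖z.2‖ ≤ ‖z‖ := by
  obtain ⟨δ, h0, hδ⟩ := P.exists_lower_bound
  have h1 := form_self_ge hδ z
  rw [← norm_sq_eq] at h1
  refine abs_le_of_sq_le_sq' ?_ (norm_nonneg _) |>.2
  nlinarith [sq_nonneg ‖toL2 (fnₗ z)‖]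

/-- The function in `C([0,1])` represented by an element of `H¹`. -/
def fn : H1 P →L[ℝ] C01 :=
  LinearMap.mkContinuous fnₗ (exists_abs_fnₗ_le P).choose
    (exists_abs_fnₗ_le P).choose_spec.2

theorem fn_apply (z : H1 P) (x : Icc (0 : ℝ) 1) :
    fn z x = z.1 + ∫ s in (0 : ℝ)..x, z.2 s := rfl

theorem fn_eq (z : H1 P) : fn z = ContinuousMap.const _ z.1 + primC z.2 := rfl

theorem ext_fn (z : H1 P) {x : ℝ} (hx : x ∈ Icc (0 : ℝ) 1) :
    ext (fn z) x = z.1 + ∫ s in (0 : ℝ)..x, z.2 s := by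
  rw [ext_of_mem _ hx, fn_apply]

theorem inner_eq_fn (z w : H1 P) : inner ℝ z w =
    (∫ x in (0 : ℝ)..1, ext P.toC01 x * ext (fn z) x * ext (fn w) x) + inner ℝ z.2 w.2 :=
  form_eq z w

theorem exists_norm_le (P : Potential) :
    ∃ C : ℝ, 0 ≤ C ∧ ∀ (z : H1 P), ‖z‖ ≤ C * ‖(show ℝ × L2 from z)‖ := by
  refine ⟨√(‖P.toC01‖ * 4 + 1), by positivity, fun z => ?_⟩
  set N := ‖(show ℝ × L2 from z)‖
  have ha : |z.1| ≤ N := norm_fst_le (show ℝ × L2 from z)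
  have hg : ‖z.2‖ ≤ N := _root_.norm_snd_le (show ℝ × L2 from z)
  have hN : 0 ≤ N := norm_nonneg _
  have hf : ∀ x, |ext (fn z) x| ≤ 2 * N := fun x => by
    refine (abs_add_le _ _).trans ?_
    have h2 : |ext (primC z.2) x| ≤ N :=
      (abs_ext_le _ _).trans ((norm_primC_le _).trans hg)
    have h3 : |(ContinuousMap.const (Icc (0 : ℝ) 1) z.1) (projIcc 0 1 zero_le_one x)| ≤ N := ha
    calc _ ≤ N + N := add_le_add h3 h2
      _ = _ := by ring
  refine abs_le_of_sq_le_sq' ?_ (by positivity) |>.2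
  rw [mul_pow, Real.sq_sqrt (by positivity), ← real_inner_self_eq_norm_sq, inner_eq_fn,
    real_inner_self_eq_norm_sq]
  have h1 : ∫ x in (0 : ℝ)..1, ext P.toC01 x * ext (fn z) x * ext (fn z) x ≤
      ∫ x in (0 : ℝ)..1, ‖P.toC01‖ * (4 * N ^ 2) := by
    refine intervalIntegral.integral_mono_on zero_le_one ?_ (by simp) fun x _ => ?_
    · exact (((continuous_ext _).mul (continuous_ext _)).mul
        (continuous_ext _)).intervalIntegrable _ _
    · rw [mul_assoc]
      refine mul_le_mul ((le_abs_self _).trans (abs_ext_le _ x)) ?_ (mul_self_nonneg _)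
        (norm_nonneg _)
      nlinarith [abs_le.mp (hf x)]
  rw [intervalIntegral.integral_const, sub_zero, one_smul] at h1
  have h2 : ‖z.2‖ ^ 2 ≤ N ^ 2 := by gcongr
  nlinarith

/-- `H¹(0,1)` is isomorphic to `ℝ × L²([0,1])`. -/
def equiv (P : Potential) : H1 P ≃L[ℝ] ℝ × L2 :=
  LinearEquiv.toContinuousLinearEquivOfBounds
    (show H1 P ≃ₗ[ℝ] ℝ × L2 from LinearEquiv.refl ℝ (ℝ × L2))
    ((exists_abs_fnₗ_le P).choose + 1) (exists_norm_le P).choose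
    (fun z => by
      have hC := (exists_abs_fnₗ_le P).choose_spec
      set C := (exists_abs_fnₗ_le P).choose
      have h0 := norm_nonneg z
      refine (norm_prod_le_iff (x := (show ℝ × L2 from z))).mpr ⟨?_, ?_⟩
      · have h1 : fnₗ z ⟨0, by simp⟩ = z.1 := by simp [fnₗ_apply, primC_apply]
        have h2 := ((fnₗ z).norm_coe_le_norm ⟨0, by simp⟩).trans (hC.2 z)
        rw [h1] at h2
        refine h2.trans ?_
        gcongr; linarith
      · exact (norm_snd_le z).trans (by nlinarith [hC.1]))
    (fun z => (exists_norm_le P).choose_spec.2 z)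

/-- The element of `H¹` with value `a` at `0` and derivative `g`. -/
def mk (a : ℝ) (g : L2) : H1 P := (equiv P).symm (a, g)

@[simp] theorem mk_fst (a : ℝ) (g : L2) : (mk a g : H1 P).1 = a := rfl

@[simp] theorem mk_snd (a : ℝ) (g : L2) : (mk a g : H1 P).2 = g := rfl

instance : CompleteSpace (H1 P) :=
  (completeSpace_congr (e := (equiv P).toEquiv) (equiv P).isUniformEmbedding).mpr inferInstance

/-- The embedding of `H¹` in `L²`. -/
def emb : H1 P →L[ℝ] L2 := toL2.comp fn

theorem emb_ae (z : H1 P) : emb z =ᵐ[vol01] ext (fn z) := toL2_ae _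

theorem inner_emb_emb (z w : H1 P) :
    inner ℝ (emb z) (emb w) = ∫ x in (0 : ℝ)..1, ext (fn z) x * ext (fn w) x :=
  inner_toL2_toL2 _ _

theorem inner_emb (z : H1 P) (f : L2) :
    inner ℝ (emb z) f = ∫ x in (0 : ℝ)..1, ext (fn z) x * f x :=
  inner_toL2 _ _

theorem fn_injective : Function.Injective (fn : H1 P → C01) := by
  rw [injective_iff_map_eq_zero]
  intro z hz
  have h1 : z.2 = 0 := by
    refine primC_eq_const_imp (c := -z.1) fun x => ?_
    have : fn z x = 0 := by rw [hz]; rfl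
    rw [fn_apply] at this
    rw [primC_apply]; linarith
  have h2 : fn z ⟨0, by simp⟩ = 0 := by rw [hz]; rfl
  rw [fn_apply] at h2
  simp only [intervalIntegral.integral_same, add_zero] at h2
  exact Prod.ext h2 h1

theorem emb_injective : Function.Injective (emb : H1 P → L2) :=
  toL2_injective.comp fn_injective

/-- Arzelà–Ascoli: the unit ball of `H¹` is uniformly bounded and ½-Hölder with constant one. -/
theorem isCompactOperator_fn : IsCompactOperator (fn : H1 P → C01) := by
  obtain ⟨C, hC0, hC⟩ := exists_abs_fnₗ_le P
  let E := BoundedContinuousFunction.mkOfCompact (α := Icc (0 : ℝ) 1) (β := ℝ)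
  let A : Set (BoundedContinuousFunction (Icc (0 : ℝ) 1) ℝ) :=
    (fun z : H1 P => E (fn z)) '' Metric.ball 0 1
  have hA : IsCompact (closure A) := by
    refine BoundedContinuousFunction.arzela_ascoli (Icc (-C) C) isCompact_Icc A ?_ ?_
    · rintro _ x ⟨z, hz, rfl⟩
      have h1 : |fn z x| ≤ C := ((fn z).norm_coe_le_norm x).trans
        ((hC z).trans (mul_le_of_le_one_right hC0.le (by simpa using (mem_ball_zero_iff.mp hz).le)))
      exact abs_le.mp h1
    · refine Metric.equicontinuous_of_continuity_modulus (fun d => √d) ?_ _ ?_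
      · simpa using Real.continuous_sqrt.tendsto 0
      · rintro x y ⟨_, z, hz, rfl⟩
        change dist (fn z x) (fn z y) ≤ _
        rw [dist_comm, Real.dist_eq, fn_apply, fn_apply, add_sub_add_left_eq_sub,
          intervalIntegral.integral_interval_sub_left
          (intervalIntegrable_L2' _ (by simp) y.2) (intervalIntegrable_L2' _ (by simp) x.2)]
        refine (abs_integral_L2_le _ x.2 y.2).trans ?_
        have : √|(y : ℝ) - x| = √(dist x y) := by
          rw [dist_comm]; rfl
        rw [this]
        exact mul_le_of_le_one_right (Real.sqrt_nonneg _)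
          ((norm_snd_le z).trans (mem_ball_zero_iff.mp hz).le)
  let R := (ContinuousMap.isometryEquivBoundedOfCompact (Icc (0 : ℝ) 1) ℝ).symm
  refine ⟨R '' closure A, hA.image R.continuous, ?_⟩
  filter_upwards [Metric.ball_mem_nhds (0 : H1 P) one_pos] with z hz
  exact ⟨E (fn z), subset_closure ⟨z, hz, rfl⟩, by ext x; rfl⟩

theorem isCompactOperator_emb : IsCompactOperator (emb : H1 P → L2) :=
  isCompactOperator_fn.clm_comp toL2

/-- The solution operator of `-f'' + V f = F` with Neumann boundary conditions. -/
def solve (P : Potential) : L2 →L[ℝ] H1 P := (emb : H1 P →L[ℝ] L2).adjoint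

/-- This is the weak form of the Neumann problem. The inner product on the left is the energy form,
so the adjoint of the embedding is already the solution operator. -/
theorem inner_solve (F : L2) (z : H1 P) : inner ℝ (solve P F) z = inner ℝ F (emb z) :=
  ContinuousLinearMap.adjoint_inner_left _ _ _

/-- The resolvent `(-∂ₓₓ + V)⁻¹` on `L²`. -/
def resolvent (P : Potential) : L2 →L[ℝ] L2 := emb.comp (solve P)

theorem isCompactOperator_resolvent : IsCompactOperator (resolvent P) :=
  isCompactOperator_emb.comp_clm (solve P)

theorem isSymmetric_resolvent : (resolvent P).IsSymmetric := fun F G => by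
  change inner ℝ (emb (solve P F)) G = inner ℝ F (emb (solve P G))
  rw [← inner_solve, real_inner_comm, ← inner_solve, real_inner_comm]

/-- Equivalent to density of `H¹` in `L²`. If `F` is orthogonal to `H¹`, testing with `1` shows that
it has mean zero; testing with primitives and integrating by parts shows that its own primitive is
orthogonal to all of `L²`. -/
theorem solve_injective : Function.Injective (solve P) := by
  rw [injective_iff_map_eq_zero]
  intro F hF
  have key : ∀ (a : ℝ) (g : L2), inner ℝ F (emb (mk a g : H1 P)) = 0 := fun a g => by
    rw [← inner_solve, hF, inner_zero_left]
  have key' : ∀ (a : ℝ) (g : L2),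
      ∫ x in (0 : ℝ)..1, (a + ∫ s in (0 : ℝ)..x, g s) * F x = 0 := fun a g => by
    refine Eq.trans ?_ (key a g)
    rw [real_inner_comm, inner_emb]
    refine integral_congr_Icc fun x hx => ?_
    rw [ext_fn _ hx, mk_fst, mk_snd]
  have h0 : ∫ x in (0 : ℝ)..1, F x = 0 := by
    refine Eq.trans ?_ (key' 1 0)
    refine integral_congr_vol01 ?_
    filter_upwards [ae_vol01_mem] with x hx
    rw [← ext_primC _ hx, map_zero]
    simp [ext]
  refine primC_eq_const_imp (c := 0) fun x => ?_
  have h1 : ∀ g : L2, inner ℝ (toL2 (primC F)) g = 0 := fun g => by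
    have := integral_primitive_by_parts (intervalIntegrable_L2 F) (intervalIntegrable_L2 g)
    have i1 : IntervalIntegrable (fun x => F x * ∫ s in (0 : ℝ)..x, g s) volume 0 1 :=
      (intervalIntegrable_L2 F).mul_continuousOn (by
        rw [uIcc_of_le zero_le_one]; exact continuousOn_integral_L2 g)
    have i2 : IntervalIntegrable (fun x => (∫ s in (0 : ℝ)..x, F s) * g x) volume 0 1 :=
      (intervalIntegrable_L2 g).continuousOn_mul (by
        rw [uIcc_of_le zero_le_one]; exact continuousOn_integral_L2 F)
    rw [h0, zero_mul, intervalIntegral.integral_add i1 i2] at this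
    have h2 := key' 0 g
    simp only [zero_add] at h2
    simp only [mul_comm (F _)] at this
    rw [h2, zero_add] at this
    rw [inner_toL2]
    refine Eq.trans ?_ this
    refine integral_congr_Icc fun x hx => ?_
    rw [ext_primC _ hx]
  have h2 : toL2 (primC F) = 0 := inner_self_eq_zero.mp (h1 _)
  have h3 : primC F = 0 := toL2_injective (by rw [h2, map_zero])
  rw [h3]; rfl

theorem resolvent_injective : Function.Injective (resolvent P) :=
  emb_injective.comp solve_injective

end H1


/-! ### Classical and weak eigenfunctions, simplicity of eigenvalues -/

theorem integral_eq_sub_of_hasDerivWithinAt_Icc {f f' : ℝ → ℝ} {a b : ℝ} (hab : a ≤ b)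
    (h : ∀ x ∈ Icc a b, HasDerivWithinAt f (f' x) (Icc a b) x) (hc : ContinuousOn f' (Icc a b)) :
    ∫ x in a..b, f' x = f b - f a := by
  refine intervalIntegral.integral_eq_sub_of_hasDerivAt_of_le hab
    (fun x hx => (h x hx).continuousWithinAt)
    (fun x hx => (h x (Ioo_subset_Icc_self hx)).hasDerivAt (Icc_mem_nhds hx.1 hx.2)) ?_
  exact (uIcc_of_le hab ▸ hc).intervalIntegrable

theorem primitive_eq_of_hasDerivWithinAt {f f' : ℝ → ℝ}
    (h : ∀ x ∈ Icc (0 : ℝ) 1, HasDerivWithinAt f (f' x) (Icc 0 1) x)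
    (hc : ContinuousOn f' (Icc 0 1)) {x : ℝ} (hx : x ∈ Icc (0 : ℝ) 1) :
    f x = f 0 + ∫ s in (0 : ℝ)..x, f' s := by
  have hsub : Icc 0 x ⊆ Icc (0 : ℝ) 1 := Icc_subset_Icc_right hx.2
  rw [integral_eq_sub_of_hasDerivWithinAt_Icc hx.1
    (fun y hy => (h y (hsub hy)).mono hsub) (hc.mono hsub)]
  ring

/-- The zero mean of `p` kills the boundary term at `1`. -/
theorem H1.integral_by_parts {P : Potential} {p : ℝ → ℝ} (hp : Continuous p)
    (h0 : ∫ x in (0 : ℝ)..1, p x = 0) (z : H1 P) :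
    ∫ x in (0 : ℝ)..1, p x * ext (H1.fn z) x =
      - ∫ x in (0 : ℝ)..1, (∫ s in (0 : ℝ)..x, p s) * z.2 x := by
  have hP : Continuous fun x => ∫ s in (0 : ℝ)..x, p s :=
    intervalIntegral.continuous_primitive (fun a b => hp.intervalIntegrable a b) 0
  have h := integral_primitive_by_parts (hp.intervalIntegrable 0 1) (intervalIntegrable_L2 z.2)
  have i1 : IntervalIntegrable (fun x => p x * ∫ s in (0 : ℝ)..x, z.2 s) volume 0 1 := by
    refine ContinuousOn.intervalIntegrable ?_
    rw [uIcc_of_le zero_le_one]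
    exact hp.continuousOn.mul (continuousOn_integral_L2 z.2)
  have i2 : IntervalIntegrable (fun x => (∫ s in (0 : ℝ)..x, p s) * z.2 x) volume 0 1 :=
    (intervalIntegrable_L2 z.2).continuousOn_mul hP.continuousOn
  rw [intervalIntegral.integral_add i1 i2, h0, zero_mul] at h
  have h1 : ∫ x in (0 : ℝ)..1, p x * ext (H1.fn z) x =
      ∫ x in (0 : ℝ)..1, (p x * z.1 + p x * ∫ s in (0 : ℝ)..x, z.2 s) :=
    integral_congr_Icc fun x hx => by rw [H1.ext_fn _ hx]; ring
  rw [h1, intervalIntegral.integral_add ((hp.mul_const _).intervalIntegrable _ _) i1,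
    intervalIntegral.integral_mul_const, h0]
  linarith

/-- `e` is a solution of `-e'' + V e = μ e` on `[0,1]` with Neumann boundary conditions, and `e₁`
is its derivative. -/
structure IsEigenfun (P : Potential) (μ : ℝ) (e e₁ : ℝ → ℝ) : Prop where
  deriv : ∀ x ∈ Icc (0 : ℝ) 1, HasDerivWithinAt e (e₁ x) (Icc 0 1) x
  deriv₁ : ∀ x ∈ Icc (0 : ℝ) 1,
    HasDerivWithinAt e₁ ((ext P.toC01 x - μ) * e x) (Icc 0 1) x
  zero : e₁ 0 = 0
  one : e₁ 1 = 0

namespace IsEigenfun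

variable {P : Potential} {μ : ℝ} {e e₁ : ℝ → ℝ}

theorem continuousOn (h : IsEigenfun P μ e e₁) : ContinuousOn e (Icc 0 1) :=
  fun x hx => (h.deriv x hx).continuousWithinAt

theorem continuousOn₁ (h : IsEigenfun P μ e e₁) : ContinuousOn e₁ (Icc 0 1) :=
  fun x hx => (h.deriv₁ x hx).continuousWithinAt

/-- An eigenfunction as an element of `H¹`. -/
def toH1 (h : IsEigenfun P μ e e₁) : H1 P := H1.mk (e 0) (toL2 (ofCont e₁ h.continuousOn₁))

theorem toH1_snd_ae (h : IsEigenfun P μ e e₁) : h.toH1.2 =ᵐ[vol01] e₁ :=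
  toL2_ofCont_ae h.continuousOn₁

theorem integral_congr_subinterval {f g : ℝ → ℝ} (h : f =ᵐ[vol01] g) {x : ℝ}
    (hx : x ∈ Icc (0 : ℝ) 1) : ∫ s in (0 : ℝ)..x, f s = ∫ s in (0 : ℝ)..x, g s := by
  refine intervalIntegral.integral_congr_ae_restrict ?_
  refine ae_restrict_of_ae_restrict_of_subset (t := Icc 0 1) ?_ h
  rw [uIoc_of_le hx.1]
  exact fun z hz => ⟨hz.1.le, hz.2.trans hx.2⟩

theorem fn_toH1 (h : IsEigenfun P μ e e₁) : H1.fn h.toH1 = ofCont e h.continuousOn := by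
  ext x
  rw [H1.fn_apply, ofCont_apply, primitive_eq_of_hasDerivWithinAt h.deriv h.continuousOn₁ x.2,
    integral_congr_subinterval h.toH1_snd_ae x.2]
  rfl

theorem ext_fn_toH1 (h : IsEigenfun P μ e e₁) {x : ℝ} (hx : x ∈ Icc (0 : ℝ) 1) :
    ext (H1.fn h.toH1) x = e x := by
  rw [fn_toH1, ext_ofCont _ hx]

theorem emb_toH1_ae (h : IsEigenfun P μ e e₁) : H1.emb h.toH1 =ᵐ[vol01] e := by
  filter_upwards [H1.emb_ae h.toH1, ae_vol01_mem] with x h1 h2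
  rw [h1, h.ext_fn_toH1 h2]

/-- Integration by parts of the eigenvalue equation. The condition `e₁ 0 = 0` makes `e₁` the
primitive of `(V - μ) e`, and `e₁ 1 = 0` gives that function mean zero. -/
theorem inner_toH1 (h : IsEigenfun P μ e e₁) (z : H1 P) :
    inner ℝ h.toH1 z = μ * inner ℝ (H1.emb h.toH1) (H1.emb z) := by
  set w := h.toH1 with hw
  set p : ℝ → ℝ := fun x => (ext P.toC01 x - μ) * ext (H1.fn w) x with hp
  have hpc : Continuous p := ((continuous_ext _).sub continuous_const).mul (continuous_ext _)
  have hpe : ∀ x ∈ Icc (0 : ℝ) 1, p x = (ext P.toC01 x - μ) * e x := fun x hx => by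
    rw [hp]; simp only; rw [h.ext_fn_toH1 hx]
  have hP : ∀ x ∈ Icc (0 : ℝ) 1, ∫ s in (0 : ℝ)..x, p s = e₁ x := fun x hx => by
    have := primitive_eq_of_hasDerivWithinAt (f' := p)
      (fun y hy => by rw [hpe y hy]; exact h.deriv₁ y hy) hpc.continuousOn hx
    rw [h.zero, zero_add] at this
    exact this.symm
  have h0 : ∫ x in (0 : ℝ)..1, p x = 0 := by rw [hP 1 (by simp), h.one]
  have key := H1.integral_by_parts hpc h0 z
  have h1 : ∫ x in (0 : ℝ)..1, (∫ s in (0 : ℝ)..x, p s) * z.2 x = inner ℝ w.2 z.2 := by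
    rw [inner_L2]
    refine integral_congr_vol01 ?_
    filter_upwards [h.toH1_snd_ae, ae_vol01_mem] with x h1 h2
    rw [hP x h2, h1]
  rw [h1] at key
  have h2 : ∫ x in (0 : ℝ)..1, p x * ext (H1.fn z) x =
      (∫ x in (0 : ℝ)..1, ext P.toC01 x * ext (H1.fn w) x * ext (H1.fn z) x) -
        μ * ∫ x in (0 : ℝ)..1, ext (H1.fn w) x * ext (H1.fn z) x := by
    rw [← intervalIntegral.integral_const_mul, ← intervalIntegral.integral_sub]
    · exact integral_congr_Icc fun x _ => by simp only [hp]; ring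
    · exact (((continuous_ext _).mul (continuous_ext _)).mul
        (continuous_ext _)).intervalIntegrable _ _
    · exact (((continuous_ext _).mul (continuous_ext _)).const_mul _).intervalIntegrable _ _
  rw [H1.inner_eq_fn, H1.inner_emb_emb]
  linarith

theorem norm_toH1_sq (h : IsEigenfun P μ e e₁) : ‖h.toH1‖ ^ 2 = μ * ‖H1.emb h.toH1‖ ^ 2 := by
  rw [← real_inner_self_eq_norm_sq, h.inner_toH1, real_inner_self_eq_norm_sq]

/-- Gronwall for `E = e² + e₁²`: since `|E'| ≤ K E`, the function `e^{-Kx} E` decreases and `e^{Kx}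
E` increases, so a zero of `E` propagates both to the right and to the left. -/
theorem eq_zero_of_initial (h : IsEigenfun P μ e e₁) {x₀ : ℝ} (hx₀ : x₀ ∈ Icc (0 : ℝ) 1)
    (he : e x₀ = 0) (he₁ : e₁ x₀ = 0) : ∀ x ∈ Icc (0 : ℝ) 1, e x = 0 := by
  -- `E' = (1 + V - μ) · 2 e e₁` with `|2 e e₁| ≤ E`, and `K` bounds the first factor.
  set K : ℝ := 1 + ‖P.toC01‖ + |μ| with hK
  have hE : ∀ x ∈ Icc (0 : ℝ) 1, HasDerivWithinAt (fun x => e x ^ 2 + e₁ x ^ 2)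
      (2 * e x * e₁ x + 2 * e₁ x * ((ext P.toC01 x - μ) * e x)) (Icc 0 1) x := fun x hx => by
    refine (((h.deriv x hx).pow 2).add ((h.deriv₁ x hx).pow 2)).congr_deriv ?_
    norm_num
  have hbound : ∀ x, |2 * e x * e₁ x + 2 * e₁ x * ((ext P.toC01 x - μ) * e x)| ≤
      K * (e x ^ 2 + e₁ x ^ 2) := fun x => by
    have h1 : |1 + ext P.toC01 x - μ| ≤ K := by
      calc _ ≤ |1 + ext P.toC01 x| + |μ| := abs_sub _ _
        _ ≤ |1| + |ext P.toC01 x| + |μ| := by gcongr; exact abs_add_le _ _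
        _ ≤ _ := by rw [hK, abs_one]; gcongr; exact abs_ext_le _ _
    have h2 : |2 * e x * e₁ x| ≤ e x ^ 2 + e₁ x ^ 2 := by
      rw [abs_le]; constructor <;> nlinarith [sq_nonneg (e x + e₁ x), sq_nonneg (e x - e₁ x)]
    calc _ = |1 + ext P.toC01 x - μ| * |2 * e x * e₁ x| := by rw [← abs_mul]; congr 1; ring
      _ ≤ _ := by gcongr
  have hexp : ∀ (c x : ℝ), HasDerivWithinAt (fun x => Real.exp (c * x)) (Real.exp (c * x) * c)
      (Icc 0 1) x := fun c x => by
    simpa using ((hasDerivAt_id x).const_mul c).exp.hasDerivWithinAt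
  have hD : ∀ (c x : ℝ), x ∈ Icc (0 : ℝ) 1 → HasDerivWithinAt
      (fun x => Real.exp (c * x) * (e x ^ 2 + e₁ x ^ 2))
      (Real.exp (c * x) * (c * (e x ^ 2 + e₁ x ^ 2) +
        (2 * e x * e₁ x + 2 * e₁ x * ((ext P.toC01 x - μ) * e x)))) (Icc 0 1) x := fun c x hx =>
    ((hexp c x).mul (hE x hx)).congr_deriv (by ring)
  have hcont : ∀ c : ℝ, ContinuousOn (fun x => Real.exp (c * x) * (e x ^ 2 + e₁ x ^ 2))
      (Icc 0 1) := fun c x hx => (hD c x hx).continuousWithinAt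
  have hint : ∀ (c x : ℝ), x ∈ interior (Icc (0 : ℝ) 1) → HasDerivWithinAt
      (fun x => Real.exp (c * x) * (e x ^ 2 + e₁ x ^ 2))
      (Real.exp (c * x) * (c * (e x ^ 2 + e₁ x ^ 2) +
        (2 * e x * e₁ x + 2 * e₁ x * ((ext P.toC01 x - μ) * e x)))) (interior (Icc 0 1)) x :=
    fun c x hx => (hD c x (interior_subset hx)).mono interior_subset
  have hanti : AntitoneOn (fun x => Real.exp (-K * x) * (e x ^ 2 + e₁ x ^ 2)) (Icc 0 1) :=
    antitoneOn_of_hasDerivWithinAt_nonpos (convex_Icc 0 1) (hcont _) (hint _) fun x _ =>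
      mul_nonpos_of_nonneg_of_nonpos (Real.exp_nonneg _) (by linarith [(abs_le.mp (hbound x)).2])
  have hmono : MonotoneOn (fun x => Real.exp (K * x) * (e x ^ 2 + e₁ x ^ 2)) (Icc 0 1) :=
    monotoneOn_of_hasDerivWithinAt_nonneg (convex_Icc 0 1) (hcont _) (hint _) fun x _ =>
      mul_nonneg (Real.exp_nonneg _) (by linarith [(abs_le.mp (hbound x)).1])
  intro x hx
  have h0 : e x ^ 2 + e₁ x ^ 2 ≤ 0 := by
    rcases le_total x₀ x with hle | hle
    · have := hanti hx₀ hx hle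
      simp only [he, he₁] at this
      exact nonpos_of_mul_nonpos_right (by linarith) (Real.exp_pos (-K * x))
    · have := hmono hx hx₀ hle
      simp only [he, he₁] at this
      exact nonpos_of_mul_nonpos_right (by linarith) (Real.exp_pos (K * x))
  nlinarith [sq_nonneg (e x), sq_nonneg (e₁ x)]

theorem smul (h : IsEigenfun P μ e e₁) (c : ℝ) :
    IsEigenfun P μ (fun x => c * e x) (fun x => c * e₁ x) where
  deriv x hx := (h.deriv x hx).const_mul c
  deriv₁ x hx := ((h.deriv₁ x hx).const_mul c).congr_deriv (by ring)
  zero := by simp [h.zero]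
  one := by simp [h.one]

theorem sub {f f₁ : ℝ → ℝ} (h : IsEigenfun P μ e e₁) (h' : IsEigenfun P μ f f₁) :
    IsEigenfun P μ (fun x => e x - f x) (fun x => e₁ x - f₁ x) where
  deriv x hx := (h.deriv x hx).sub (h'.deriv x hx)
  deriv₁ x hx := ((h.deriv₁ x hx).sub (h'.deriv₁ x hx)).congr_deriv (by ring)
  zero := by simp [h.zero, h'.zero]
  one := by simp [h.one, h'.one]

/-- Eigenvalues are simple: the Neumann condition fixes the slope at `0`, so the value at `0`
determines the eigenfunction. -/
theorem proportional {f f₁ : ℝ → ℝ} (h : IsEigenfun P μ e e₁) (h' : IsEigenfun P μ f f₁)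
    (h0 : ∃ x ∈ Icc (0 : ℝ) 1, e x ≠ 0) : ∃ c, ∀ x ∈ Icc (0 : ℝ) 1, f x = c * e x := by
  have he : e 0 ≠ 0 := fun he => by
    obtain ⟨x, hx, hne⟩ := h0
    exact hne (h.eq_zero_of_initial (by simp) he h.zero x hx)
  refine ⟨f 0 / e 0, fun x hx => ?_⟩
  have := (h'.sub (h.smul (f 0 / e 0))).eq_zero_of_initial (x₀ := 0) (by simp)
    (by field_simp; ring) (by simp [h.zero, h'.zero]) x hx
  linarith

end IsEigenfun

/-- Elliptic regularity in one dimension. Testing with the constant `1` gives `∫ p = 0`, and testing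
with functions vanishing at `0` identifies `w'` with the primitive of the continuous function `p`.
The Neumann conditions thus come out as natural boundary conditions. -/
theorem H1.exists_isEigenfun {P : Potential} {μ : ℝ} (w : H1 P)
    (hw : ∀ z : H1 P, inner ℝ w z = μ * inner ℝ (H1.emb w) (H1.emb z)) :
    ∃ e e₁, IsEigenfun P μ e e₁ ∧ ∀ x ∈ Icc (0 : ℝ) 1, e x = ext (H1.fn w) x := by
  set p : ℝ → ℝ := fun x => (ext P.toC01 x - μ) * ext (H1.fn w) x with hp
  have hpc : Continuous p := ((continuous_ext _).sub continuous_const).mul (continuous_ext _)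
  have hPd : ∀ x, HasDerivAt (fun x => ∫ s in (0 : ℝ)..x, p s) (p x) x := fun x =>
    intervalIntegral.integral_hasDerivAt_right (hpc.intervalIntegrable _ _)
      (hpc.stronglyMeasurableAtFilter _ _) hpc.continuousAt
  have hPc : Continuous fun x => ∫ s in (0 : ℝ)..x, p s :=
    continuous_iff_continuousAt.mpr fun x => (hPd x).continuousAt
  have key : ∀ z : H1 P, (∫ x in (0 : ℝ)..1, p x * ext (H1.fn z) x) + inner ℝ w.2 z.2 = 0 :=
    fun z => by
    have h := hw z
    rw [H1.inner_eq_fn, H1.inner_emb_emb] at h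
    have h2 : ∫ x in (0 : ℝ)..1, p x * ext (H1.fn z) x =
        (∫ x in (0 : ℝ)..1, ext P.toC01 x * ext (H1.fn w) x * ext (H1.fn z) x) -
          μ * ∫ x in (0 : ℝ)..1, ext (H1.fn w) x * ext (H1.fn z) x := by
      rw [← intervalIntegral.integral_const_mul, ← intervalIntegral.integral_sub]
      · exact integral_congr_Icc fun x _ => by simp only [hp]; ring
      · exact (((continuous_ext _).mul (continuous_ext _)).mul
          (continuous_ext _)).intervalIntegrable _ _
      · exact (((continuous_ext _).mul (continuous_ext _)).const_mul _).intervalIntegrable _ _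
    linarith
  have h0 : ∫ x in (0 : ℝ)..1, p x = 0 := by
    have h := key (H1.mk 1 0)
    rw [H1.mk_snd, inner_zero_right, add_zero] at h
    refine Eq.trans (integral_congr_Icc fun x hx => ?_) h
    have : ext (H1.fn (H1.mk 1 0 : H1 P)) x = 1 := by
      rw [ext, H1.fn_eq]; simp
    rw [this, mul_one]
  have hg : w.2 = toL2 (ofCont _ hPc.continuousOn) := by
    rw [← sub_eq_zero, ← inner_self_eq_zero (𝕜 := ℝ)]
    -- The discrepancy to be killed serves as the derivative of the test function.
    set g : L2 := w.2 - toL2 (ofCont _ hPc.continuousOn) with hgdef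
    have h1 := key (H1.mk 0 g)
    rw [H1.integral_by_parts hpc h0, H1.mk_snd] at h1
    rw [hgdef, inner_sub_left, ← hgdef, inner_toL2]
    have h2 : ∫ x in (0 : ℝ)..1, ext (ofCont _ hPc.continuousOn) x * g x =
        ∫ x in (0 : ℝ)..1, (∫ s in (0 : ℝ)..x, p s) * g x :=
      integral_congr_Icc fun x hx => by rw [ext_ofCont _ hx]
    rw [h2]; linarith
  have hfn : ∀ x ∈ Icc (0 : ℝ) 1,
      ext (H1.fn w) x = w.1 + ∫ s in (0 : ℝ)..x, ∫ r in (0 : ℝ)..s, p r := fun x hx => by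
    rw [H1.ext_fn _ hx, hg, IsEigenfun.integral_congr_subinterval
      (toL2_ofCont_ae hPc.continuousOn) hx]
  refine ⟨fun x => w.1 + ∫ s in (0 : ℝ)..x, ∫ r in (0 : ℝ)..s, p r,
    fun x => ∫ s in (0 : ℝ)..x, p s, ⟨fun x _ => ?_, fun x hx => ?_, by simp, h0⟩,
    fun x hx => (hfn x hx).symm⟩
  · exact ((intervalIntegral.integral_hasDerivAt_right (hPc.intervalIntegrable _ _)
      (hPc.stronglyMeasurableAtFilter _ _) hPc.continuousAt).const_add _).hasDerivWithinAt
  · rw [← hfn x hx]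
    exact (hPd x).hasDerivWithinAt


/-! ### Orthonormal eigenfamilies and summability of `1/μ` -/

/-- An orthonormal family of Neumann eigenfunctions. -/
structure EigenFamily (P : Potential) (ι : Type*) where
  μ : ι → ℝ
  e : ι → ℝ → ℝ
  e₁ : ι → ℝ → ℝ
  eig : ∀ n, IsEigenfun P (μ n) (e n) (e₁ n)
  orth : Orthonormal ℝ fun n => H1.emb (eig n).toH1

namespace EigenFamily

variable {P : Potential} {ι : Type*} (S : EigenFamily P ι)

/-- The eigenfunctions as elements of `H¹`. -/
def w (n : ι) : H1 P := (S.eig n).toH1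

theorem norm_emb_w (n : ι) : ‖H1.emb (S.w n)‖ = 1 := S.orth.1 n

theorem norm_w_sq (n : ι) : ‖S.w n‖ ^ 2 = S.μ n := by
  rw [w, (S.eig n).norm_toH1_sq]
  change _ * ‖H1.emb (S.w n)‖ ^ 2 = _
  rw [norm_emb_w]; ring

theorem inner_w (n : ι) (z : H1 P) :
    inner ℝ (S.w n) z = S.μ n * inner ℝ (H1.emb (S.w n)) (H1.emb z) := (S.eig n).inner_toH1 z

theorem μ_pos (n : ι) : 0 < S.μ n := by
  rw [← S.norm_w_sq]
  have : S.w n ≠ 0 := fun h => by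
    have := S.norm_emb_w n
    rw [h, map_zero, norm_zero] at this
    exact zero_ne_one this
  positivity

/-- The eigenfunctions normalized in `H¹`. -/
def W (n : ι) : H1 P := (√(S.μ n))⁻¹ • S.w n

theorem sqrt_μ_pos (n : ι) : 0 < √(S.μ n) := Real.sqrt_pos.mpr (S.μ_pos n)

theorem inner_W (n : ι) (z : H1 P) :
    inner ℝ (S.W n) z = √(S.μ n) * inner ℝ (H1.emb (S.w n)) (H1.emb z) := by
  have h := S.sqrt_μ_pos n
  rw [W, inner_smul_left, inner_w, conj_trivial]
  nth_rw 2 [← Real.mul_self_sqrt (S.μ_pos n).le]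
  field_simp

theorem orthonormal_W : Orthonormal ℝ S.W := by
  classical
  rw [orthonormal_iff_ite]
  intro m n
  have h := orthonormal_iff_ite.mp S.orth m n
  rw [inner_W]
  change √(S.μ m) * inner ℝ (H1.emb (S.w m)) (H1.emb ((√(S.μ n))⁻¹ • S.w n)) = _
  rw [map_smul, inner_smul_right]
  change √(S.μ m) * (_ * inner ℝ (H1.emb (S.eig m).toH1) (H1.emb (S.eig n).toH1)) = _
  rw [h]
  split_ifs with hmn
  · subst hmn
    have := (S.sqrt_μ_pos m).ne'
    field_simp
  · simp

/-- A bound for point evaluation on `H¹`. -/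
def _root_.BurgersKoopman.Potential.evalBound (P : Potential) : ℝ :=
  (H1.exists_abs_fnₗ_le P).choose

theorem _root_.BurgersKoopman.Potential.evalBound_pos (P : Potential) : 0 < P.evalBound :=
  (H1.exists_abs_fnₗ_le P).choose_spec.1

theorem _root_.BurgersKoopman.H1.norm_fn_le (z : H1 P) : ‖H1.fn z‖ ≤ P.evalBound * ‖z‖ :=
  (H1.exists_abs_fnₗ_le P).choose_spec.2 z

theorem _root_.BurgersKoopman.H1.abs_ext_fn_le (z : H1 P) (x : ℝ) :
    |ext (H1.fn z) x| ≤ P.evalBound * ‖z‖ :=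
  (abs_ext_le _ x).trans (H1.norm_fn_le z)

theorem ext_fn_W (n : ι) {x : ℝ} (hx : x ∈ Icc (0 : ℝ) 1) :
    ext (H1.fn (S.W n)) x = S.e n x / √(S.μ n) := by
  rw [W, map_smul, ext_smul, w, (S.eig n).ext_fn_toH1 hx]
  ring

/-- Bessel's inequality for evaluation at `x`. The vector `z` with coefficients `W_n(x)` satisfies
`z(x) = ‖z‖²`, while `z(x)` is at most `P.evalBound * ‖z‖`. -/
theorem sum_sq_div_le (s : Finset ι) {x : ℝ} (hx : x ∈ Icc (0 : ℝ) 1) :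
    ∑ n ∈ s, S.e n x ^ 2 / S.μ n ≤ P.evalBound ^ 2 := by
  set c : ι → ℝ := fun n => S.e n x / √(S.μ n)
  set z : H1 P := ∑ n ∈ s, c n • S.W n
  have h1 : ‖z‖ ^ 2 = ∑ n ∈ s, c n ^ 2 := by
    rw [← real_inner_self_eq_norm_sq, S.orthonormal_W.inner_sum]
    simp [sq]
  have h2 : ext (H1.fn z) x = ∑ n ∈ s, c n ^ 2 := by
    rw [map_sum, ext_of_mem _ hx, ContinuousMap.sum_apply]
    refine Finset.sum_congr rfl fun n _ => ?_
    rw [← ext_of_mem _ hx, map_smul, ext_smul, S.ext_fn_W n hx, sq]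
  have h3 : ∑ n ∈ s, S.e n x ^ 2 / S.μ n = ‖z‖ ^ 2 := by
    rw [h1]
    refine Finset.sum_congr rfl fun n _ => ?_
    rw [div_pow, Real.sq_sqrt (S.μ_pos n).le]
  rw [h3]
  have h4 := (le_abs_self _).trans (H1.abs_ext_fn_le z x)
  rw [h2, ← h1] at h4
  rcases (norm_nonneg z).eq_or_lt with h0 | h0
  · rw [← h0]; nlinarith [sq_nonneg P.evalBound]
  · have : ‖z‖ ≤ P.evalBound := by nlinarith
    gcongr

theorem abs_e_le (n : ι) {x : ℝ} (hx : x ∈ Icc (0 : ℝ) 1) :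
    |S.e n x| ≤ P.evalBound * √(S.μ n) := by
  have h := S.sum_sq_div_le {n} hx
  rw [Finset.sum_singleton, div_le_iff₀ (S.μ_pos n)] at h
  rw [← abs_of_pos (mul_pos P.evalBound_pos (S.sqrt_μ_pos n)), ← sq_le_sq, mul_pow,
    Real.sq_sqrt (S.μ_pos n).le]
  exact h

theorem integral_e_mul_e [DecidableEq ι] (m n : ι) :
    ∫ x in (0 : ℝ)..1, S.e m x * S.e n x = if m = n then 1 else 0 := by
  rw [← orthonormal_iff_ite.mp S.orth m n, H1.inner_emb_emb]
  refine integral_congr_Icc fun x hx => ?_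
  rw [(S.eig m).ext_fn_toH1 hx, (S.eig n).ext_fn_toH1 hx]

/-- Integrating the pointwise bound over `[0,1]` takes the place of Weyl asymptotics: it forces the
eigenvalues to infinity and controls every heat series below. -/
theorem sum_inv_le (s : Finset ι) : ∑ n ∈ s, (S.μ n)⁻¹ ≤ P.evalBound ^ 2 := by
  classical
  have hi : ∀ n ∈ s, IntervalIntegrable (fun x => S.e n x ^ 2 / S.μ n) volume 0 1 := fun n _ => by
    refine ContinuousOn.intervalIntegrable ?_
    rw [uIcc_of_le zero_le_one]
    exact ((S.eig n).continuousOn.pow 2).div_const _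
  have h1 : ∫ x in (0 : ℝ)..1, ∑ n ∈ s, S.e n x ^ 2 / S.μ n = ∑ n ∈ s, (S.μ n)⁻¹ := by
    rw [intervalIntegral.integral_finsetSum hi]
    refine Finset.sum_congr rfl fun n _ => ?_
    rw [intervalIntegral.integral_div]
    simp only [sq]
    rw [integral_e_mul_e, if_pos rfl, one_div]
  rw [← h1]
  have h2 : ∫ x in (0 : ℝ)..1, ∑ n ∈ s, S.e n x ^ 2 / S.μ n ≤
      ∫ x in (0 : ℝ)..1, P.evalBound ^ 2 := by
    refine intervalIntegral.integral_mono_on zero_le_one ?_ (by simp) fun x hx =>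
      S.sum_sq_div_le s hx
    convert! IntervalIntegrable.sum s hi using 1
    ext x; simp
  simpa using h2

theorem summable_inv : Summable fun n => (S.μ n)⁻¹ :=
  summable_of_sum_le (fun n => (inv_pos.mpr (S.μ_pos n)).le) S.sum_inv_le

theorem finite_le (R : ℝ) : {n | S.μ n ≤ R}.Finite := by
  have h := S.summable_inv.tendsto_cofinite_zero
  rcases le_or_gt R 0 with hR | hR
  · convert Set.finite_empty
    ext n
    simp only [mem_ofPred_eq, mem_empty_iff_false, iff_false, not_le]
    exact hR.trans_lt (S.μ_pos n)
  · have := h.eventually (gt_mem_nhds (inv_pos.mpr hR))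
    refine Set.Finite.subset this fun n hn => ?_
    simp only [mem_ofPred_eq] at hn
    simp only [mem_compl_iff, mem_ofPred_eq, not_lt]
    exact inv_anti₀ (S.μ_pos n) hn

/-- Reindexing of an eigenfamily. -/
def reindex {κ : Type*} (σ : κ → ι) (hσ : Function.Injective σ) : EigenFamily P κ where
  μ := S.μ ∘ σ
  e := S.e ∘ σ
  e₁ := S.e₁ ∘ σ
  eig n := S.eig (σ n)
  orth := S.orth.comp σ hσ

end EigenFamily

/-! ### The spectrum: completeness and enumeration -/

/-- The Neumann spectrum of `-∂ₓₓ + V`. -/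
def spec (P : Potential) : Set ℝ :=
  {μ | ∃ e e₁, IsEigenfun P μ e e₁ ∧ ∃ x ∈ Icc (0 : ℝ) 1, e x ≠ 0}

theorem IsEigenfun.emb_toH1_ne_zero {P : Potential} {μ : ℝ} {e e₁ : ℝ → ℝ}
    (h : IsEigenfun P μ e e₁) (h0 : ∃ x ∈ Icc (0 : ℝ) 1, e x ≠ 0) : H1.emb h.toH1 ≠ 0 := by
  intro h1
  obtain ⟨x, hx, hne⟩ := h0
  have h2 : h.toH1 = 0 := H1.emb_injective (by rw [h1, map_zero])
  rw [← h.ext_fn_toH1 hx, h2, map_zero] at hne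
  exact hne rfl

theorem IsEigenfun.emb_toH1_congr {P : Potential} {μ c ν : ℝ} {e e₁ f f₁ : ℝ → ℝ}
    (h : IsEigenfun P μ e e₁) (h' : IsEigenfun P ν f f₁)
    (hc : ∀ x ∈ Icc (0 : ℝ) 1, f x = c * e x) : H1.emb h'.toH1 = c • H1.emb h.toH1 := by
  refine Lp.ext ?_
  filter_upwards [h'.emb_toH1_ae, h.emb_toH1_ae, ae_vol01_mem,
    Lp.coeFn_smul c (H1.emb h.toH1)] with x h1 h2 h3 h4
  rw [h1, h4, Pi.smul_apply, h2, hc x h3, smul_eq_mul]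

theorem exists_normalized {P : Potential} {μ : ℝ} (hμ : μ ∈ spec P) :
    ∃ (e e₁ : ℝ → ℝ) (h : IsEigenfun P μ e e₁), ‖H1.emb h.toH1‖ = 1 := by
  obtain ⟨e, e₁, h, h0⟩ := hμ
  have hne := h.emb_toH1_ne_zero h0
  refine ⟨_, _, h.smul ‖H1.emb h.toH1‖⁻¹, ?_⟩
  rw [h.emb_toH1_congr (c := ‖H1.emb h.toH1‖⁻¹) _ fun x _ => rfl, norm_smul, norm_inv, norm_norm,
    inv_mul_cancel₀ (norm_ne_zero_iff.mpr hne)]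

/-- The family of all normalized Neumann eigenfunctions, indexed by the spectrum. -/
def specFamily (P : Potential) : EigenFamily P (spec P) where
  μ := Subtype.val
  e n := (exists_normalized n.2).choose
  e₁ n := (exists_normalized n.2).choose_spec.choose
  eig n := (exists_normalized n.2).choose_spec.choose_spec.choose
  orth := by
    refine ⟨fun n => (exists_normalized n.2).choose_spec.choose_spec.choose_spec, fun m n hmn => ?_⟩
    set hm := (exists_normalized m.2).choose_spec.choose_spec.choose
    set hn := (exists_normalized n.2).choose_spec.choose_spec.choose
    have h1 := hm.inner_toH1 hn.toH1
    have h2 := hn.inner_toH1 hm.toH1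
    rw [real_inner_comm, h1, real_inner_comm (H1.emb hm.toH1)] at h2
    have h3 : ((m : ℝ) - n) * inner ℝ (H1.emb hm.toH1) (H1.emb hn.toH1) = 0 := by linarith
    rcases mul_eq_zero.mp h3 with h | h
    · exact absurd (Subtype.ext (sub_eq_zero.mp h)) hmn
    · exact h

/-- Spectral theorem for the compact, symmetric, injective resolvent: its eigenspaces span a dense
subspace. An eigenvector for `τ` is a weak, hence classical, eigenfunction for `τ⁻¹`, and by
simplicity a multiple of the chosen one. -/
theorem specFamily_complete (P : Potential) (f : L2)
    (hf : ∀ n, inner ℝ (H1.emb ((specFamily P).w n)) f = 0) : f = 0 := by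
  have key : f ∈ (⨆ τ, Module.End.eigenspace (H1.resolvent P : Module.End ℝ L2) τ)ᗮ := by
    rw [Submodule.mem_orthogonal]
    intro u hu
    induction hu using Submodule.iSup_induction' with
    | zero => exact inner_zero_left _
    | add x y _ _ hx hy => rw [inner_add_left, hx, hy, add_zero]
    | mem τ F hF =>
      rw [Module.End.mem_eigenspace_iff] at hF
      change H1.emb (H1.solve P F) = τ • F at hF
      rcases eq_or_ne F 0 with rfl | hF0
      · exact inner_zero_left _
      have hτ : τ ≠ 0 := by
        rintro rfl
        rw [zero_smul] at hF
        exact hF0 (H1.resolvent_injective (by rw [map_zero]; exact hF))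
      have hF' : F = τ⁻¹ • H1.emb (H1.solve P F) := by
        rw [hF, smul_smul, inv_mul_cancel₀ hτ, one_smul]
      obtain ⟨e, e₁, h, he⟩ := H1.exists_isEigenfun (μ := τ⁻¹) (H1.solve P F) fun z => by
        rw [H1.inner_solve]
        nth_rw 1 [hF']
        rw [inner_smul_left]; rfl
      have hemb : H1.emb h.toH1 = H1.emb (H1.solve P F) := by
        refine Lp.ext ?_
        filter_upwards [h.emb_toH1_ae, H1.emb_ae (H1.solve P F), ae_vol01_mem] with x h1 h2 h3
        rw [h1, h2, he x h3]
      have hspec : τ⁻¹ ∈ spec P := by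
        refine ⟨e, e₁, h, ?_⟩
        by_contra! hall
        refine hF0 (H1.solve_injective (P := P) (H1.fn_injective ?_))
        rw [map_zero, map_zero]
        ext x
        rw [← ext_of_mem _ x.2, ← he x x.2, hall x x.2]; rfl
      obtain ⟨c, hc⟩ := ((specFamily P).eig ⟨_, hspec⟩).proportional h (by
        by_contra! hall
        have h1 := (specFamily P).norm_emb_w ⟨_, hspec⟩
        have h2 : H1.emb ((specFamily P).w ⟨_, hspec⟩) = 0 := by
          refine Lp.ext ?_
          filter_upwards [((specFamily P).eig ⟨_, hspec⟩).emb_toH1_ae, ae_vol01_mem,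
            Lp.coeFn_zero ℝ 2 vol01] with x h1 h2 h3
          rw [h3]
          exact h1.trans (hall x h2)
        rw [h2, norm_zero] at h1
        exact zero_ne_one h1)
      rw [hF', ← hemb, ((specFamily P).eig ⟨_, hspec⟩).emb_toH1_congr h hc, inner_smul_left,
        inner_smul_left]
      have := hf ⟨_, hspec⟩
      change inner ℝ (H1.emb ((specFamily P).eig ⟨_, hspec⟩).toH1) f = 0 at this
      rw [this]; simp
  rw [ContinuousLinearMap.orthogonalComplement_iSup_eigenspaces_eq_bot
    H1.isCompactOperator_resolvent H1.isSymmetric_resolvent] at key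
  exact (Submodule.mem_bot ℝ).mp key

/-- `H¹`, which is `ℝ × L²` as a vector space, embeds in `L²`; in finite dimension `d` this would
say `1 + d ≤ d`. -/
theorem not_finiteDimensional_L2 (P : Potential) : ¬ FiniteDimensional ℝ L2 := fun _ => by
  have h := LinearMap.finrank_le_finrank_of_injective
    (f := (H1.emb (P := P)).toLinearMap ∘ₗ (H1.equiv P).symm.toLinearMap)
    (H1.emb_injective.comp (H1.equiv P).symm.injective)
  rw [Module.finrank_prod, Module.finrank_self] at h
  omega

theorem infinite_spec (P : Potential) : Infinite (spec P) := by
  by_contra hfin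
  rw [not_infinite_iff_finite] at hfin
  refine not_finiteDimensional_L2 P ?_
  set U : Submodule ℝ L2 := Submodule.span ℝ (range fun n => H1.emb ((specFamily P).w n)) with hU
  have : FiniteDimensional ℝ U := FiniteDimensional.span_of_finite ℝ (finite_range _)
  have h1 : Uᗮ = ⊥ := by
    rw [Submodule.eq_bot_iff]
    intro f hf
    refine specFamily_complete P f fun n => ?_
    exact (Submodule.mem_orthogonal _ _).mp hf _ (Submodule.subset_span ⟨n, rfl⟩)
  rw [Submodule.orthogonal_eq_bot_iff] at h1
  exact Module.Finite.of_surjective U.subtype (by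
    rw [← LinearMap.range_eq_top, Submodule.range_subtype, h1])

/-- Sublevel sets of the spectrum are finite, so it is a locally finite linear order with a least
element; being infinite, it has no greatest one. Such an order is that of `ℕ`. -/
theorem exists_orderIso_spec (P : Potential) : Nonempty (ℕ ≃o spec P) := by
  have hfin : ∀ R : ℝ, {n : spec P | (n : ℝ) ≤ R}.Finite := (specFamily P).finite_le
  have hinf := infinite_spec P
  let : LocallyFiniteOrder (spec P) := LocallyFiniteOrder.ofFiniteIcc fun a b =>
    (hfin b).subset fun x hx => hx.2
  have hne : Nonempty (spec P) := inferInstance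
  obtain ⟨a⟩ := hne
  obtain ⟨b, hb, hmin⟩ := Set.exists_min_image _ (fun n : spec P => (n : ℝ)) (hfin a)
    ⟨a, le_refl (a : ℝ)⟩
  let : OrderBot (spec P) :=
    { bot := b
      bot_le := fun x => by
        rcases le_total (x : ℝ) a with h | h
        · exact hmin x h
        · exact le_trans (hmin a (le_refl (a : ℝ))) h }
  have : NoMaxOrder (spec P) := ⟨fun c => by
    by_contra! hc
    exact (Set.infinite_univ (α := spec P)) ((hfin c).subset fun x _ => hc x)⟩
  let := LinearLocallyFiniteOrder.succOrder (ι := spec P)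
  let := LinearLocallyFiniteOrder.predOrder (ι := spec P)
  exact ⟨orderIsoNatOfLinearSuccPredArch.symm⟩

/-- A complete orthonormal sequence of eigenfunctions with increasing eigenvalues. -/
structure EigenBasis (P : Potential) extends EigenFamily P ℕ where
  mono : Monotone μ
  complete : ∀ f : L2, (∀ n, inner ℝ (H1.emb (toEigenFamily.w n)) f = 0) → f = 0

theorem exists_eigenBasis (P : Potential) : ∃ B : EigenBasis P, StrictMono B.μ := by
  obtain ⟨σ⟩ := exists_orderIso_spec P
  refine ⟨{ (specFamily P).reindex σ σ.injective with
    mono := fun m n h => σ.monotone h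
    complete := fun f hf => specFamily_complete P f fun n => ?_ }, σ.strictMono⟩
  have := hf (σ.symm n)
  change inner ℝ (H1.emb ((specFamily P).w (σ (σ.symm n)))) f = 0 at this
  rwa [σ.apply_symm_apply] at this


/-! ### Hilbert bases and positivity of the ground state -/

namespace EigenBasis

variable {P : Potential} (B : EigenBasis P)

/-- The normalized eigenfunctions as a Hilbert basis of `H¹`. -/
def basisH1 : HilbertBasis ℕ ℝ (H1 P) :=
  HilbertBasis.mkOfOrthogonalEqBot B.orthonormal_W (by
    rw [Submodule.eq_bot_iff]
    intro z hz
    refine H1.emb_injective ?_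
    rw [map_zero]
    refine B.complete _ fun n => ?_
    have h := (Submodule.mem_orthogonal _ _).mp hz _ (Submodule.subset_span ⟨n, rfl⟩)
    rw [B.inner_W] at h
    exact (mul_eq_zero.mp h).resolve_left (B.sqrt_μ_pos n).ne')

theorem basisH1_apply (n : ℕ) : B.basisH1 n = B.W n := by
  simp [basisH1]

/-- The eigenfunctions as a Hilbert basis of `L²`. -/
def basisL2 : HilbertBasis ℕ ℝ L2 :=
  HilbertBasis.mkOfOrthogonalEqBot B.orth (by
    rw [Submodule.eq_bot_iff]
    intro f hf
    exact B.complete f fun n =>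
      (Submodule.mem_orthogonal _ _).mp hf _ (Submodule.subset_span ⟨n, rfl⟩))

theorem basisL2_apply (n : ℕ) : B.basisL2 n = H1.emb (B.w n) := by
  simp [basisL2, EigenFamily.w]

theorem hasSum_norm_sq_H1 (z : H1 P) :
    HasSum (fun n => (inner ℝ (B.W n) z) ^ 2) (‖z‖ ^ 2) := by
  have h := B.basisH1.hasSum_inner_mul_inner z z
  rw [real_inner_self_eq_norm_sq] at h
  refine h.congr_fun fun n => ?_
  rw [basisH1_apply, real_inner_comm, sq]

theorem hasSum_norm_sq_L2 (f : L2) :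
    HasSum (fun n => (inner ℝ (H1.emb (B.w n)) f) ^ 2) (‖f‖ ^ 2) := by
  have h := B.basisL2.hasSum_inner_mul_inner f f
  rw [real_inner_self_eq_norm_sq] at h
  refine h.congr_fun fun n => ?_
  rw [basisL2_apply, real_inner_comm, sq]

theorem inner_emb_w (n : ℕ) (f : L2) :
    inner ℝ (H1.emb (B.w n)) f = ∫ x in (0 : ℝ)..1, B.e n x * f x := by
  rw [H1.inner_emb]
  exact integral_congr_Icc fun x hx => by rw [EigenFamily.w, (B.eig n).ext_fn_toH1 hx]

theorem inner_emb_w_emb (n : ℕ) (z : H1 P) :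
    inner ℝ (H1.emb (B.w n)) (H1.emb z) = ∫ x in (0 : ℝ)..1, B.e n x * ext (H1.fn z) x := by
  rw [H1.inner_emb_emb]
  exact integral_congr_Icc fun x hx => by rw [EigenFamily.w, (B.eig n).ext_fn_toH1 hx]

end EigenBasis

namespace EigenFamily

variable {P : Potential} {ι : Type*} (S : EigenFamily P ι)

theorem exists_ne_zero (n : ι) : ∃ x ∈ Icc (0 : ℝ) 1, S.e n x ≠ 0 := by
  by_contra! hall
  have h1 := S.norm_emb_w n
  have h2 : H1.emb (S.w n) = 0 := by
    refine Lp.ext ?_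
    filter_upwards [(S.eig n).emb_toH1_ae, ae_vol01_mem, Lp.coeFn_zero ℝ 2 vol01] with x h1 h2 h3
    rw [h3]
    exact h1.trans (hall x h2)
  rw [h2, norm_zero] at h1
  exact zero_ne_one h1

theorem exists_ne_zero_of_Ioo (n : ι) {a b : ℝ} (ha : 0 ≤ a) (hab : a < b) (hb : b ≤ 1) :
    ∃ x ∈ Ioo a b, S.e n x ≠ 0 := by
  by_contra! hall
  obtain ⟨c, hc⟩ := nonempty_Ioo.mpr hab
  have hc1 : c ∈ Icc (0 : ℝ) 1 := ⟨ha.trans hc.1.le, hc.2.le.trans hb⟩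
  obtain ⟨x, hx, hne⟩ := S.exists_ne_zero n
  refine hne ((S.eig n).eq_zero_of_initial hc1 (hall c hc) ?_ x hx)
  have h1 : HasDerivAt (S.e n) (S.e₁ n c) c :=
    ((S.eig n).deriv c hc1).hasDerivAt (Icc_mem_nhds (ha.trans_lt hc.1) (hc.2.trans_le hb))
  have h2 : S.e n =ᶠ[𝓝 c] fun _ => 0 := by
    filter_upwards [Ioo_mem_nhds hc.1 hc.2] with y hy using hall y hy
  exact h1.unique ((hasDerivAt_const c (0 : ℝ)).congr_of_eventuallyEq h2)

/-- The family with all signs changed. -/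
def neg : EigenFamily P ι where
  μ := S.μ
  e n x := -1 * S.e n x
  e₁ n x := -1 * S.e₁ n x
  eig n := (S.eig n).smul (-1)
  orth := by
    classical
    have h : ∀ n, H1.emb ((S.eig n).smul (-1)).toH1 = -H1.emb (S.eig n).toH1 := fun n => by
      exact ((S.eig n).emb_toH1_congr (c := -1) ((S.eig n).smul (-1)) fun x _ => rfl).trans
        (neg_one_smul ℝ _)
    rw [orthonormal_iff_ite]
    intro m n
    rw [h, h, inner_neg_neg]
    exact orthonormal_iff_ite.mp S.orth m n

theorem emb_w_neg (n : ι) : H1.emb (S.neg.w n) = -H1.emb (S.w n) :=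
  ((S.eig n).emb_toH1_congr (c := -1) ((S.eig n).smul (-1)) fun _ _ => rfl).trans
    (neg_one_smul ℝ _)

end EigenFamily

namespace EigenBasis

variable {P : Potential} (B : EigenBasis P)

/-- The eigenbasis with all signs changed. -/
def neg : EigenBasis P where
  toEigenFamily := B.toEigenFamily.neg
  mono := B.mono
  complete f hf := B.complete f fun n => by
    have := hf n
    rwa [EigenFamily.emb_w_neg, inner_neg_left, neg_eq_zero] at this

/-- If `e₀` vanished at `x₀`, then `z`, equal to `e₀` left of `x₀` and to `0` right of it, would lie
in `H¹` and have Rayleigh quotient `μ₀`. As `μ₀` is strictly the least eigenvalue, `z = c e₀`. Then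
`e₀` vanishes on the left interval if `c = 0`, on the right one otherwise, against ODE uniqueness.
-/
theorem ground_state_ne_zero (hμ : StrictMono B.μ) {x₀ : ℝ} (hx₀ : x₀ ∈ Ioo (0 : ℝ) 1) :
    B.e 0 x₀ ≠ 0 := by
  intro h0
  have hx₀' : x₀ ∈ Icc (0 : ℝ) 1 := Ioo_subset_Icc_self hx₀
  have hmem : MemLp (indicator (Iic x₀) (B.w 0).2) 2 vol01 :=
    (Lp.memLp (B.w 0).2).indicator measurableSet_Iic
  set g : L2 := hmem.toLp _ with hg
  have hgae : g =ᵐ[vol01] indicator (Iic x₀) (B.w 0).2 := hmem.coeFn_toLp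
  set z : H1 P := H1.mk (B.e 0 0) g with hz
  have hew : ∀ x ∈ Icc (0 : ℝ) 1, ext (H1.fn (B.w 0)) x = B.e 0 x := fun x hx =>
    (B.eig 0).ext_fn_toH1 hx
  have hw0 : (B.w 0).1 = B.e 0 0 := rfl
  have hle : ∀ x ∈ Icc (0 : ℝ) 1, x ≤ x₀ → ext (H1.fn z) x = B.e 0 x := fun x hx hxx => by
    rw [← hew x hx, H1.ext_fn _ hx, H1.ext_fn _ hx, hw0, hz, H1.mk_fst, H1.mk_snd,
      IsEigenfun.integral_congr_subinterval hgae hx]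
    congr 1
    refine intervalIntegral.integral_congr fun y hy => ?_
    rw [uIcc_of_le hx.1] at hy
    exact indicator_of_mem (show y ∈ Iic x₀ from hy.2.trans hxx) _
  have hgt : ∀ x ∈ Icc (0 : ℝ) 1, x₀ ≤ x → ext (H1.fn z) x = 0 := fun x hx hxx => by
    have h1 : ext (H1.fn z) x = ext (H1.fn z) x₀ + ∫ s in x₀..x, g s := by
      have hadd := intervalIntegral.integral_add_adjacent_intervals
        (intervalIntegrable_L2' g (x := 0) (by simp) hx₀') (intervalIntegrable_L2' g hx₀' hx)
      rw [H1.ext_fn _ hx, H1.ext_fn _ hx₀', hz, H1.mk_fst, H1.mk_snd, add_assoc, hadd]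
    have h2 : ∫ s in x₀..x, g s = 0 := by
      refine Eq.trans ?_ (intervalIntegral.integral_zero (a := x₀) (b := x) (μ := volume))
      refine intervalIntegral.integral_congr_ae_restrict ?_
      have hsub : uIoc x₀ x ⊆ Icc 0 1 := by
        rw [uIoc_of_le hxx]
        exact fun y hy => ⟨hx₀.1.le.trans hy.1.le, hy.2.trans hx.2⟩
      filter_upwards [ae_restrict_mem measurableSet_uIoc,
        ae_restrict_of_ae_restrict_of_subset hsub hgae] with y hy hgy
      rw [uIoc_of_le hxx] at hy
      rw [hgy]
      exact indicator_of_notMem (by simpa using hy.1) _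
    rw [h1, h2, hle x₀ hx₀' le_rfl, h0, add_zero]
  have hmul : ∀ x ∈ Icc (0 : ℝ) 1,
      ext (H1.fn z) x * ext (H1.fn z) x = ext (H1.fn (B.w 0)) x * ext (H1.fn z) x := fun x hx => by
    rcases le_total x x₀ with h | h
    · rw [hle x hx h, hew x hx]
    · rw [hgt x hx h, mul_zero, mul_zero]
  have e1 : inner ℝ z z = inner ℝ (B.w 0) z := by
    rw [H1.inner_eq_fn, H1.inner_eq_fn]
    congr 1
    · exact integral_congr_Icc fun x hx => by rw [mul_assoc, hmul x hx, mul_assoc]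
    · rw [inner_L2, inner_L2]
      refine integral_congr_vol01 ?_
      filter_upwards [hgae] with x hx
      rw [hz, H1.mk_snd, hx]
      by_cases hxx : x ∈ Iic x₀
      · rw [indicator_of_mem hxx]
      · rw [indicator_of_notMem hxx, mul_zero, mul_zero]
  have e2 : inner ℝ (H1.emb z) (H1.emb z) = inner ℝ (H1.emb (B.w 0)) (H1.emb z) := by
    rw [H1.inner_emb_emb, H1.inner_emb_emb]
    exact integral_congr_Icc hmul
  have e3 : ‖z‖ ^ 2 = B.μ 0 * ‖H1.emb z‖ ^ 2 := by
    rw [← real_inner_self_eq_norm_sq, ← real_inner_self_eq_norm_sq, e1, e2, B.inner_w]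
  -- Parseval in `H¹` minus `μ₀` times Parseval in `L²`: a vanishing sum of the nonnegative terms
  -- `(μₙ - μ₀) cₙ²`.
  have s1 := (B.hasSum_norm_sq_H1 z).sub ((B.hasSum_norm_sq_L2 (H1.emb z)).mul_left (B.μ 0))
  rw [e3, sub_self] at s1
  have hterm : ∀ n, inner ℝ (B.W n) z ^ 2 - B.μ 0 * inner ℝ (H1.emb (B.w n)) (H1.emb z) ^ 2 =
      (B.μ n - B.μ 0) * inner ℝ (H1.emb (B.w n)) (H1.emb z) ^ 2 := fun n => by
    rw [B.inner_W, mul_pow, Real.sq_sqrt (B.μ_pos n).le]; ring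
  simp only [hterm] at s1
  have hnn : ∀ n, 0 ≤ (B.μ n - B.μ 0) * inner ℝ (H1.emb (B.w n)) (H1.emb z) ^ 2 := fun n =>
    mul_nonneg (sub_nonneg.mpr (B.mono (Nat.zero_le n))) (sq_nonneg _)
  have hzero := (hasSum_zero_iff_of_nonneg hnn).mp s1
  have hcoef : ∀ n, n ≠ 0 → inner ℝ (H1.emb (B.w n)) (H1.emb z) = 0 := fun n hn => by
    have h := congrFun hzero n
    simp only [Pi.zero_apply] at h
    have h' : B.μ n - B.μ 0 ≠ 0 := (sub_pos.mpr (hμ (Nat.pos_of_ne_zero hn))).ne'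
    exact pow_eq_zero_iff two_ne_zero |>.mp ((mul_eq_zero.mp h).resolve_left h')
  set c := inner ℝ (H1.emb (B.w 0)) (H1.emb z) with hc
  have hzc : z = c • B.w 0 := by
    refine H1.emb_injective (sub_eq_zero.mp (B.complete _ fun n => ?_))
    rw [map_smul, inner_sub_right, inner_smul_right]
    have ho := orthonormal_iff_ite.mp B.orth n 0
    change inner ℝ (H1.emb (B.w n)) (H1.emb (B.w 0)) = _ at ho
    rw [ho]
    split_ifs with hn
    · rw [hn, ← hc]; ring
    · rw [hcoef n hn]; ring
  have hfz : ∀ x ∈ Icc (0 : ℝ) 1, ext (H1.fn z) x = c * B.e 0 x := fun x hx => by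
    rw [hzc, map_smul, ext_smul, hew x hx]
  by_cases hc0 : c = 0
  · obtain ⟨x, hx, hne⟩ := B.exists_ne_zero_of_Ioo 0 le_rfl hx₀.1 hx₀.2.le
    have hx' : x ∈ Icc (0 : ℝ) 1 := ⟨hx.1.le, hx.2.le.trans hx₀.2.le⟩
    have := hfz x hx'
    rw [hle x hx' hx.2.le, hc0, zero_mul] at this
    exact hne this
  · obtain ⟨x, hx, hne⟩ := B.exists_ne_zero_of_Ioo 0 hx₀.1.le hx₀.2 le_rfl
    have hx' : x ∈ Icc (0 : ℝ) 1 := ⟨hx₀.1.le.trans hx.1.le, hx.2.le⟩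
    have := hfz x hx'
    rw [hgt x hx' hx.1.le] at this
    exact (mul_ne_zero hc0 hne) this.symm

/-- A zero at an endpoint, together with the Neumann condition there, would be zero Cauchy data.
Positivity up to the boundary makes `inf e₀` positive. -/
theorem ground_state_pos_Icc (hpos : ∀ x ∈ Ioo (0 : ℝ) 1, 0 < B.e 0 x) :
    ∀ x ∈ Icc (0 : ℝ) 1, 0 < B.e 0 x := by
  have hge : ∀ x ∈ Icc (0 : ℝ) 1, 0 ≤ B.e 0 x := by
    have hcl : closure (Ioo (0 : ℝ) 1) = Icc 0 1 := closure_Ioo zero_ne_one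
    intro x hx
    rw [← hcl] at hx
    have hc : ContinuousWithinAt (B.e 0) (Ioo 0 1) x :=
      ((B.eig 0).continuousOn x (hcl ▸ hx)).mono Ioo_subset_Icc_self
    exact closure_minimal (s := B.e 0 '' Ioo 0 1) (t := Ici 0)
      (by rintro _ ⟨y, hy, rfl⟩; exact (hpos y hy).le) isClosed_Ici (hc.mem_closure_image hx)
  have hend : ∀ x ∈ Icc (0 : ℝ) 1, B.e₁ 0 x = 0 → 0 < B.e 0 x := fun x hx h1 => by
    refine lt_of_le_of_ne (hge x hx) fun h0 => ?_
    obtain ⟨y, hy, hne⟩ := B.exists_ne_zero 0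
    exact hne ((B.eig 0).eq_zero_of_initial hx h0.symm h1 y hy)
  intro x hx
  rcases hx.1.eq_or_lt with h | h
  · exact h ▸ hend 0 (by simp) (B.eig 0).zero
  rcases hx.2.eq_or_lt with h' | h'
  · exact h' ▸ hend 1 (by simp) (B.eig 0).one
  exact hpos x ⟨h, h'⟩

end EigenBasis

theorem exists_eigenBasis_pos (P : Potential) :
    ∃ B : EigenBasis P, ∀ x ∈ Icc (0 : ℝ) 1, 0 < B.e 0 x := by
  obtain ⟨B, hB⟩ := exists_eigenBasis P
  have hne : ∀ x ∈ Ioo (0 : ℝ) 1, B.e 0 x ≠ 0 := fun x hx => B.ground_state_ne_zero hB hx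
  have hcont : ContinuousOn (B.e 0) (Ioo 0 1) := (B.eig 0).continuousOn.mono Ioo_subset_Icc_self
  have himg : IsPreconnected (B.e 0 '' Ioo 0 1) := isPreconnected_Ioo.image _ hcont
  have hsign : (∀ x ∈ Ioo (0 : ℝ) 1, 0 < B.e 0 x) ∨ ∀ x ∈ Ioo (0 : ℝ) 1, B.e 0 x < 0 := by
    by_contra! h
    obtain ⟨⟨x, hx, hx0⟩, y, hy, hy0⟩ := h
    obtain ⟨z, hz, hz0⟩ := himg.ordConnected.out ⟨x, hx, rfl⟩ ⟨y, hy, rfl⟩ ⟨hx0, hy0⟩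
    exact hne z hz hz0
  rcases hsign with h | h
  · exact ⟨B, B.ground_state_pos_Icc h⟩
  · refine ⟨B.neg, B.neg.ground_state_pos_Icc fun x hx => ?_⟩
    have : B.neg.e 0 x = -1 * B.e 0 x := rfl
    rw [this]
    linarith [h x hx]

/-! ### Passage between `EigenBasis` and `IsNeumannEigensystem` -/

section Conversion

variable {P : Potential} {V : ℝ → ℝ}

theorem IsEigenfun.contDiffOn {μ : ℝ} {e e₁ : ℝ → ℝ} (h : IsEigenfun P μ e e₁) :
    ContDiffOn ℝ 2 e (Icc 0 1) := by
  have hu : UniqueDiffOn ℝ (Icc (0 : ℝ) 1) := uniqueDiffOn_Icc zero_lt_one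
  have hd : ∀ x ∈ Icc (0 : ℝ) 1, derivWithin e (Icc 0 1) x = e₁ x := fun x hx =>
    (h.deriv x hx).derivWithin (hu x hx)
  have hd₁ : ∀ x ∈ Icc (0 : ℝ) 1, derivWithin e₁ (Icc 0 1) x = (ext P.toC01 x - μ) * e x :=
    fun x hx => (h.deriv₁ x hx).derivWithin (hu x hx)
  have h1 : ContDiffOn ℝ 1 e₁ (Icc 0 1) := by
    rw [show (1 : WithTop ℕ∞) = 0 + 1 by norm_num, contDiffOn_succ_iff_derivWithin hu]
    refine ⟨fun x hx => (h.deriv₁ x hx).differentiableWithinAt, by simp, ?_⟩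
    rw [contDiffOn_zero]
    refine ContinuousOn.congr ?_ hd₁
    exact ((continuous_ext _).sub continuous_const).continuousOn.mul h.continuousOn
  rw [show (2 : WithTop ℕ∞) = 1 + 1 by norm_num, contDiffOn_succ_iff_derivWithin hu]
  exact ⟨fun x hx => (h.deriv x hx).differentiableWithinAt, by simp, h1.congr hd⟩

theorem EigenBasis.isNeumannEigensystem (B : EigenBasis P)
    (hPV : ∀ x ∈ Icc (0 : ℝ) 1, ext P.toC01 x = V x) (hpos : ∀ x ∈ Icc (0 : ℝ) 1, 0 < B.e 0 x) :
    IsNeumannEigensystem V B.μ B.e := by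
  have hu : UniqueDiffOn ℝ (Icc (0 : ℝ) 1) := uniqueDiffOn_Icc zero_lt_one
  have hd : ∀ n, ∀ x ∈ Icc (0 : ℝ) 1, derivWithin (B.e n) (Icc 0 1) x = B.e₁ n x :=
    fun n x hx => ((B.eig n).deriv x hx).derivWithin (hu x hx)
  refine ⟨B.mono, fun n => (B.eig n).contDiffOn, fun n x hx => ?_, fun n => ?_, fun m n => ?_,
    fun f hf => ?_, fun x hx => hpos x (Ioo_subset_Icc_self hx)⟩
  · rw [derivWithin_congr (hd n) (hd n x hx), ((B.eig n).deriv₁ x hx).derivWithin (hu x hx),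
      hPV x hx]
    ring
  · rw [hd n 0 (by simp), hd n 1 (by simp)]
    exact ⟨(B.eig n).zero, (B.eig n).one⟩
  · exact B.integral_e_mul_e m n
  · exact B.complete f fun n => by rw [B.inner_emb_w, hf n]

theorem IsNeumannEigensystem.isEigenfun {μ : ℕ → ℝ} {e : ℕ → ℝ → ℝ}
    (h : IsNeumannEigensystem V μ e) (hPV : ∀ x ∈ Icc (0 : ℝ) 1, ext P.toC01 x = V x) (n : ℕ) :
    IsEigenfun P (μ n) (e n) (derivWithin (e n) (Icc 0 1)) := by
  have hu : UniqueDiffOn ℝ (Icc (0 : ℝ) 1) := uniqueDiffOn_Icc zero_lt_one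
  have h1 := h.contDiffOn n
  rw [show (2 : WithTop ℕ∞) = 1 + 1 by norm_num, contDiffOn_succ_iff_derivWithin hu] at h1
  refine ⟨fun x hx => (h1.1 x hx).hasDerivWithinAt, fun x hx => ?_, (h.neumann n).1,
    (h.neumann n).2⟩
  have h2 := ((h1.2.2.differentiableOn (by norm_num)) x hx).hasDerivWithinAt
  refine h2.congr_deriv ?_
  rw [hPV x hx]
  linarith [h.eigen n x hx]

theorem IsNeumannEigensystem.exists_eigenBasis {μ : ℕ → ℝ} {e : ℕ → ℝ → ℝ}
    (h : IsNeumannEigensystem V μ e) (hPV : ∀ x ∈ Icc (0 : ℝ) 1, ext P.toC01 x = V x) :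
    ∃ B : EigenBasis P, B.μ = μ ∧ B.e = e ∧ (∀ n, B.e₁ n = derivWithin (e n) (Icc 0 1)) ∧
      ∀ x ∈ Icc (0 : ℝ) 1, 0 < B.e 0 x := by
  have horth : Orthonormal ℝ fun n => H1.emb (h.isEigenfun hPV n).toH1 := by
    rw [orthonormal_iff_ite]
    intro m n
    rw [← h.orthonormal m n, H1.inner_emb_emb]
    refine integral_congr_Icc fun x hx => ?_
    rw [(h.isEigenfun hPV m).ext_fn_toH1 hx, (h.isEigenfun hPV n).ext_fn_toH1 hx]
  let S : EigenFamily P ℕ := ⟨μ, e, _, h.isEigenfun hPV, horth⟩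
  let B : EigenBasis P := ⟨S, h.monotone, fun f hf => h.complete f fun n => by
    refine Eq.trans ?_ (hf n)
    rw [H1.inner_emb]
    exact integral_congr_Icc fun x hx => by
      rw [EigenFamily.w, (S.eig n).ext_fn_toH1 hx]⟩
  exact ⟨B, rfl, rfl, fun n => rfl, B.ground_state_pos_Icc h.pos⟩

end Conversion


/-! ### Regularity of the series `∑ e^{-μₙ t} gₙ(x)` -/

theorem hasDerivWithinAt_of_eq_primitive {f f' : ℝ → ℝ} (hc : ContinuousOn f' (Icc 0 1))
    (h : ∀ x ∈ Icc (0 : ℝ) 1, f x = f 0 + ∫ s in (0 : ℝ)..x, f' s) {x : ℝ}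
    (hx : x ∈ Icc (0 : ℝ) 1) : HasDerivWithinAt f (f' x) (Icc 0 1) x := by
  have hcont := continuous_ext (ofCont f' hc)
  have hd : HasDerivAt (fun x => f 0 + ∫ s in (0 : ℝ)..x, ext (ofCont f' hc) s)
      (ext (ofCont f' hc) x) x :=
    (intervalIntegral.integral_hasDerivAt_right (hcont.intervalIntegrable _ _)
      (hcont.stronglyMeasurableAtFilter _ _) hcont.continuousAt).const_add _
  rw [ext_ofCont hc hx] at hd
  have heq : ∀ y ∈ Icc (0 : ℝ) 1, f y = f 0 + ∫ s in (0 : ℝ)..y, ext (ofCont f' hc) s :=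
    fun y hy => by
    rw [h y hy]
    congr 1
    refine intervalIntegral.integral_congr fun s hs => ?_
    rw [uIcc_of_le hy.1] at hs
    exact (ext_ofCont hc ⟨hs.1, hs.2.trans hy.2⟩).symm
  exact hd.hasDerivWithinAt.congr heq (heq x hx)

namespace EigenBasis

variable {P : Potential} (B : EigenBasis P)

/-- With `y = 1 + μₙ`, one term of the exponential series gives `e^{-yt} ≤ (k+1)!/(yt)^{k+1}`. One
power more than `k` leaves a factor `y⁻¹ ≤ μₙ⁻¹`, which is summable. -/
theorem summable_pow_mul_exp (k : ℕ) {t : ℝ} (ht : 0 < t) :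
    Summable fun n => (1 + B.μ n) ^ k * Real.exp (-B.μ n * t) := by
  refine Summable.of_nonneg_of_le (fun n => ?_) (fun n => ?_)
    (B.summable_inv.mul_left (Real.exp t * ((k + 1).factorial / t ^ (k + 1))))
  · have := B.μ_pos n
    positivity
  · have hμ := B.μ_pos n
    set y := 1 + B.μ n with hy
    have hy0 : 0 < y := by positivity
    have h1 := Real.pow_div_factorial_le_exp (x := y * t) (by positivity) (k + 1)
    have h2 : Real.exp (-B.μ n * t) = Real.exp t * (Real.exp (y * t))⁻¹ := by
      rw [← Real.exp_neg, ← Real.exp_add]; congr 1; rw [hy]; ring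
    have h3 : (Real.exp (y * t))⁻¹ ≤ (k + 1).factorial / (y * t) ^ (k + 1) := by
      rw [← inv_div]
      exact inv_anti₀ (by positivity) h1
    calc y ^ k * Real.exp (-B.μ n * t)
        ≤ y ^ k * (Real.exp t * ((k + 1).factorial / (y * t) ^ (k + 1))) := by
          rw [h2]; gcongr
      _ = Real.exp t * ((k + 1).factorial / t ^ (k + 1)) * y⁻¹ := by
          rw [mul_pow]; field_simp; ring
      _ ≤ _ := by gcongr; rw [hy]; linarith

/-- Sequences of functions on `[0,1]` with polynomial growth in the eigenvalues. -/
structure Tame (g : ℕ → ℝ → ℝ) : Prop where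
  cont : ∀ n, ContinuousOn (g n) (Icc 0 1)
  bound : ∃ (C : ℝ) (k : ℕ), 0 ≤ C ∧ ∀ n, ∀ x ∈ Icc (0 : ℝ) 1, |g n x| ≤ C * (1 + B.μ n) ^ k

variable {B}

theorem one_le_one_add_μ (n : ℕ) : 1 ≤ 1 + B.μ n := by linarith [B.μ_pos n]

theorem tame_e : B.Tame B.e := by
  refine ⟨fun n => (B.eig n).continuousOn, P.evalBound, 1, P.evalBound_pos.le, fun n x hx => ?_⟩
  refine (B.abs_e_le n hx).trans ?_
  have := P.evalBound_pos
  gcongr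
  rw [Real.sqrt_le_left (by linarith [B.μ_pos n])]
  nlinarith [B.μ_pos n]

theorem Tame.add {f g : ℕ → ℝ → ℝ} (hf : B.Tame f) (hg : B.Tame g) :
    B.Tame fun n x => f n x + g n x := by
  obtain ⟨C, k, hC, h1⟩ := hf.bound
  obtain ⟨D, l, hD, h2⟩ := hg.bound
  refine ⟨fun n => (hf.cont n).add (hg.cont n), C + D, max k l, by positivity, fun n x hx => ?_⟩
  have hone := one_le_one_add_μ (B := B) n
  calc |f n x + g n x| ≤ |f n x| + |g n x| := abs_add_le _ _
    _ ≤ C * (1 + B.μ n) ^ k + D * (1 + B.μ n) ^ l := add_le_add (h1 n x hx) (h2 n x hx)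
    _ ≤ C * (1 + B.μ n) ^ max k l + D * (1 + B.μ n) ^ max k l := by
      gcongr
      · exact le_max_left _ _
      · exact le_max_right _ _
    _ = _ := by ring

theorem Tame.neg_μ_mul {g : ℕ → ℝ → ℝ} (hg : B.Tame g) : B.Tame fun n x => -B.μ n * g n x := by
  obtain ⟨C, k, hC, h1⟩ := hg.bound
  refine ⟨fun n => (hg.cont n).const_smul (-B.μ n), C, k + 1, hC, fun n x hx => ?_⟩
  have hμ := B.μ_pos n
  rw [abs_mul, abs_neg, abs_of_pos hμ]
  calc B.μ n * |g n x| ≤ (1 + B.μ n) * (C * (1 + B.μ n) ^ k) := by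
        gcongr
        · linarith
        · exact h1 n x hx
    _ = _ := by ring

theorem Tame.coeff_mul {g : ℕ → ℝ → ℝ} (hg : B.Tame g) {c : ℕ → ℝ} {M : ℝ}
    (hc : ∀ n, |c n| ≤ M) : B.Tame fun n x => c n * g n x := by
  obtain ⟨C, k, hC, h1⟩ := hg.bound
  have hM : 0 ≤ M := (abs_nonneg _).trans (hc 0)
  refine ⟨fun n => (hg.cont n).const_smul (c n), M * C, k, by positivity, fun n x hx => ?_⟩
  have hμ := B.μ_pos n
  rw [abs_mul, mul_assoc]
  exact mul_le_mul (hc n) (h1 n x hx) (abs_nonneg _) hM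

theorem Tame.ext_mul {g : ℕ → ℝ → ℝ} (hg : B.Tame g) (m : C01) :
    B.Tame fun n x => ext m x * g n x := by
  obtain ⟨C, k, hC, h1⟩ := hg.bound
  refine ⟨fun n => (continuous_ext m).continuousOn.mul (hg.cont n), ‖m‖ * C, k, by positivity,
    fun n x hx => ?_⟩
  rw [abs_mul, mul_assoc]
  exact mul_le_mul (abs_ext_le m x) (h1 n x hx) (abs_nonneg _) (norm_nonneg _)

theorem tame_potential_e : B.Tame fun n x => (ext P.toC01 x - B.μ n) * B.e n x := by
  convert (tame_e.ext_mul P.toC01).add (tame_e (B := B)).neg_μ_mul using 3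
  ring

/-- Mean value inequality from `e₁ 0 = 0` and the bound on `e₁' = (V - μ) e`. -/
theorem tame_e₁ : B.Tame B.e₁ := by
  obtain ⟨C, k, hC, h1⟩ := (tame_potential_e (B := B)).bound
  refine ⟨fun n => (B.eig n).continuousOn₁, C, k, hC, fun n x hx => ?_⟩
  have h := (convex_Icc (0 : ℝ) 1).norm_image_sub_le_of_norm_hasDerivWithin_le
    (fun y hy => (B.eig n).deriv₁ y hy) (fun y hy => h1 n y hy) (x := 0) (y := x) (by simp) hx
  rw [(B.eig n).zero, sub_zero, sub_zero, Real.norm_eq_abs, Real.norm_eq_abs] at h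
  refine h.trans (mul_le_of_le_one_right ?_ (abs_le.mpr ⟨by linarith [hx.1], hx.2⟩))
  have := B.μ_pos n
  positivity

variable (B)

/-- The superposition `∑ e^{-μₙ t} gₙ(x)`. -/
def heat (g : ℕ → ℝ → ℝ) (t x : ℝ) : ℝ := ∑' n, Real.exp (-B.μ n * t) * g n x

variable {B}

namespace Tame

variable {g : ℕ → ℝ → ℝ}

/-- A single majorant serves all times `t ≥ τ`, which permits termwise operations locally uniformly
in `t > 0`. -/
theorem exists_majorant (hg : B.Tame g) {τ : ℝ} (hτ : 0 < τ) :
    ∃ u : ℕ → ℝ, Summable u ∧ ∀ n, ∀ t, τ ≤ t → ∀ x ∈ Icc (0 : ℝ) 1,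
      ‖Real.exp (-B.μ n * t) * g n x‖ ≤ u n := by
  obtain ⟨C, k, hC, h1⟩ := hg.bound
  refine ⟨_, (B.summable_pow_mul_exp k hτ).mul_left C, fun n t ht x hx => ?_⟩
  have := B.μ_pos n
  rw [norm_mul, Real.norm_of_nonneg (Real.exp_nonneg _), Real.norm_eq_abs]
  calc Real.exp (-B.μ n * t) * |g n x| ≤ Real.exp (-B.μ n * τ) * (C * (1 + B.μ n) ^ k) := by
        refine mul_le_mul (Real.exp_le_exp.mpr ?_) (h1 n x hx) (abs_nonneg _) (Real.exp_nonneg _)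
        nlinarith
    _ = _ := by ring

theorem summable (hg : B.Tame g) {t x : ℝ} (ht : 0 < t) (hx : x ∈ Icc (0 : ℝ) 1) :
    Summable fun n => Real.exp (-B.μ n * t) * g n x := by
  obtain ⟨u, hu, h⟩ := hg.exists_majorant ht
  exact Summable.of_norm_bounded hu fun n => h n t le_rfl x hx

theorem hasSum (hg : B.Tame g) {t x : ℝ} (ht : 0 < t) (hx : x ∈ Icc (0 : ℝ) 1) :
    HasSum (fun n => Real.exp (-B.μ n * t) * g n x) (B.heat g t x) :=
  (hg.summable ht hx).hasSum

theorem continuousOn_heat (hg : B.Tame g) :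
    ContinuousOn (Function.uncurry (B.heat g)) (Ioi 0 ×ˢ Icc 0 1) := by
  rintro ⟨t, x⟩ ⟨ht, hx⟩
  have ht' : 0 < t := ht
  obtain ⟨u, hu, h⟩ := hg.exists_majorant (half_pos ht')
  have hc : ContinuousOn (Function.uncurry (B.heat g)) (Ioi (t / 2) ×ˢ Icc 0 1) := by
    refine continuousOn_tsum (fun n => ?_) hu fun n p hp => h n p.1 (le_of_lt hp.1) p.2 hp.2
    refine ContinuousOn.mul (by fun_prop) ?_
    exact (hg.cont n).comp continuousOn_snd fun p hp => hp.2
  refine (hc (t, x) ⟨half_lt_self ht', hx⟩).mono_of_mem_nhdsWithin ?_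
  rw [nhdsWithin_prod_eq]
  refine prod_mem_prod ?_ self_mem_nhdsWithin
  exact mem_nhdsWithin_of_mem_nhds (Ioi_mem_nhds (half_lt_self ht'))

theorem continuousOn_heat_slice (hg : B.Tame g) {t : ℝ} (ht : 0 < t) :
    ContinuousOn (B.heat g t) (Icc 0 1) :=
  hg.continuousOn_heat.comp (continuousOn_const.prodMk continuousOn_id) fun _ hx => ⟨ht, hx⟩

theorem hasDerivAt_heat (hg : B.Tame g) {t x : ℝ} (ht : 0 < t) (hx : x ∈ Icc (0 : ℝ) 1) :
    HasDerivAt (fun s => B.heat g s x) (B.heat (fun n x => -B.μ n * g n x) t x) t := by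
  obtain ⟨u, hu, h⟩ := hg.neg_μ_mul.exists_majorant (half_pos ht)
  have hd := hasDerivAt_tsum_of_isPreconnected (g := fun n s => Real.exp (-B.μ n * s) * g n x)
    (g' := fun n s => Real.exp (-B.μ n * s) * (-B.μ n * g n x)) (t := Ioi (t / 2)) (y₀ := t)
    (y := t) hu isOpen_Ioi isPreconnected_Ioi (fun n s _ => ?_)
    (fun n s hs => h n s (le_of_lt hs) x hx) (half_lt_self ht) (hg.summable ht hx)
    (half_lt_self ht)
  · exact hd
  · have := (((hasDerivAt_id s).const_mul (-B.μ n)).exp).mul_const (g n x)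
    refine this.congr_deriv ?_
    simp only [id, mul_one]; ring

/-- The derivative series is integrated termwise and the sum differentiated back. This reaches the
endpoints of `[0,1]`, where only one-sided derivatives exist. -/
theorem hasDerivWithinAt_heat {g' : ℕ → ℝ → ℝ} (hg : B.Tame g) (hg' : B.Tame g')
    (hd : ∀ n, ∀ x ∈ Icc (0 : ℝ) 1, HasDerivWithinAt (g n) (g' n x) (Icc 0 1) x) {t x : ℝ}
    (ht : 0 < t) (hx : x ∈ Icc (0 : ℝ) 1) :
    HasDerivWithinAt (B.heat g t) (B.heat g' t x) (Icc 0 1) x := by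
  refine hasDerivWithinAt_of_eq_primitive (hg'.continuousOn_heat_slice ht) (fun y hy => ?_) hx
  obtain ⟨u, hu, h⟩ := hg'.exists_majorant ht
  have hsub : uIoc 0 y ⊆ Icc (0 : ℝ) 1 := by
    rw [uIoc_of_le hy.1]
    exact fun s hs => ⟨hs.1.le, hs.2.trans hy.2⟩
  have key := intervalIntegral.hasSum_integral_of_dominated_convergence (a := 0) (b := y)
    (μ := volume) (F := fun n s => Real.exp (-B.μ n * t) * g' n s) (f := B.heat g' t)
    (fun n _ => u n)
    (fun n => ((continuousOn_const.mul (hg'.cont n)).mono hsub).aestronglyMeasurable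
      measurableSet_uIoc)
    (fun n => ae_of_all _ fun s hs => h n t le_rfl s (hsub hs))
    (ae_of_all _ fun _ _ => hu) intervalIntegrable_const
    (ae_of_all _ fun s hs => hg'.hasSum ht (hsub hs))
  have h1 : ∀ n, ∫ s in (0 : ℝ)..y, Real.exp (-B.μ n * t) * g' n s =
      Real.exp (-B.μ n * t) * g n y - Real.exp (-B.μ n * t) * g n 0 := fun n => by
    rw [intervalIntegral.integral_const_mul,
      primitive_eq_of_hasDerivWithinAt (hd n) (hg'.cont n) hy]
    ring
  simp only [h1] at key
  have h2 := (hg.hasSum ht hy).sub (hg.hasSum ht (x := 0) (by simp))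
  rw [key.unique h2]; ring

end Tame

theorem heat_potential {c : ℕ → ℝ} {M : ℝ} (hc : ∀ n, |c n| ≤ M) {t x : ℝ} (ht : 0 < t)
    (hx : x ∈ Icc (0 : ℝ) 1) :
    B.heat (fun n x => c n * ((ext P.toC01 x - B.μ n) * B.e n x)) t x =
      ext P.toC01 x * B.heat (fun n x => c n * B.e n x) t x +
        B.heat (fun n x => -B.μ n * (c n * B.e n x)) t x := by
  have h0 := (tame_e (B := B)).coeff_mul hc
  have h1 := ((h0.hasSum ht hx).mul_left (ext P.toC01 x)).add (h0.neg_μ_mul.hasSum ht hx)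
  rw [← h1.tsum_eq, heat]
  congr 1
  ext n; ring

/-! ### The heat semigroup on `H¹` -/

variable (B)

theorem norm_sq_eq_tsum (z : H1 P) : ‖z‖ ^ 2 = ∑' n, (inner ℝ (B.W n) z) ^ 2 :=
  (B.hasSum_norm_sq_H1 z).tsum_eq.symm

/-- The semigroup generated by `∂ₓₓ - V` on `H¹`. -/
def semigroup (t : ℝ≥0) (z : H1 P) : H1 P :=
  B.basisH1.repr.symm ⟨fun n => Real.exp (-B.μ n * t) * inner ℝ (B.W n) z, by
    refine memℓp_gen ?_
    simp only [ENNReal.toReal_ofNat, Real.rpow_ofNat]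
    refine Summable.of_nonneg_of_le (fun n => by positivity) (fun n => ?_)
      (B.hasSum_norm_sq_H1 z).summable
    rw [norm_mul, mul_pow, Real.norm_eq_abs, Real.norm_eq_abs, sq_abs (inner ℝ _ _), sq_abs]
    refine mul_le_of_le_one_left (sq_nonneg _) (pow_le_one₀ (Real.exp_nonneg _) ?_)
    exact Real.exp_le_one_iff.mpr (by have := B.μ_pos n; have := t.2; nlinarith [t.coe_nonneg])⟩

theorem inner_W_semigroup (t : ℝ≥0) (z : H1 P) (n : ℕ) :
    inner ℝ (B.W n) (B.semigroup t z) = Real.exp (-B.μ n * t) * inner ℝ (B.W n) z := by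
  rw [← basisH1_apply, ← HilbertBasis.repr_apply_apply, semigroup,
    LinearIsometryEquiv.apply_symm_apply, basisH1_apply]

theorem ext_inner_W {y z : H1 P} (h : ∀ n, inner ℝ (B.W n) y = inner ℝ (B.W n) z) : y = z := by
  rw [← sub_eq_zero, ← norm_eq_zero, ← sq_eq_zero_iff, norm_sq_eq_tsum B]
  simp [inner_sub_right, h]

theorem semigroup_zero (z : H1 P) : B.semigroup 0 z = z :=
  B.ext_inner_W fun n => by rw [inner_W_semigroup]; simp

theorem exp_le_one (n : ℕ) (t : ℝ≥0) : Real.exp (-B.μ n * t) ≤ 1 :=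
  Real.exp_le_one_iff.mpr (by have := B.μ_pos n; nlinarith [t.coe_nonneg])

theorem norm_semigroup_sub_le (t : ℝ≥0) (y z : H1 P) :
    ‖B.semigroup t y - B.semigroup t z‖ ≤ ‖y - z‖ := by
  refine abs_le_of_sq_le_sq' ?_ (norm_nonneg _) |>.2
  rw [norm_sq_eq_tsum B (y - z), norm_sq_eq_tsum B]
  refine Summable.tsum_le_tsum (fun n => ?_) (B.hasSum_norm_sq_H1 _).summable
    (B.hasSum_norm_sq_H1 _).summable
  rw [inner_sub_right, inner_sub_right, inner_W_semigroup, inner_W_semigroup, ← mul_sub, mul_pow]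
  exact mul_le_of_le_one_left (sq_nonneg _) (pow_le_one₀ (Real.exp_nonneg _) (B.exp_le_one n t))

theorem continuous_semigroup (t : ℝ≥0) : Continuous (B.semigroup t) :=
  LipschitzWith.continuous (K := 1) <| LipschitzWith.of_dist_le_mul fun y z => by
    rw [dist_eq_norm, dist_eq_norm, NNReal.coe_one, one_mul]
    exact B.norm_semigroup_sub_le t y z

/-- Dominated convergence in Parseval's identity, in the `H¹` norm and including time `0`:
continuity of `-2 v_x/v` in `L²` requires that of `v_x`. -/
theorem continuous_semigroup_time (z : H1 P) : Continuous fun t => B.semigroup t z := by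
  rw [continuous_iff_continuousAt]
  intro s
  have hsq : Tendsto (fun t => ‖B.semigroup t z - B.semigroup s z‖ ^ 2) (𝓝 s) (𝓝 0) := by
    have h0 : ∀ t n, inner ℝ (B.W n) (B.semigroup t z - B.semigroup s z) ^ 2 =
        (Real.exp (-B.μ n * t) - Real.exp (-B.μ n * s)) ^ 2 * inner ℝ (B.W n) z ^ 2 :=
      fun t n => by
      rw [inner_sub_right, inner_W_semigroup, inner_W_semigroup, ← sub_mul, mul_pow]
    simp only [norm_sq_eq_tsum B, h0]
    have := tendsto_tsum_of_dominated_convergence (𝓕 := 𝓝 s)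
      (f := fun (t : ℝ≥0) n =>
        (Real.exp (-B.μ n * t) - Real.exp (-B.μ n * s)) ^ 2 * inner ℝ (B.W n) z ^ 2)
      (g := fun _ => 0) (B.hasSum_norm_sq_H1 z).summable (fun n => ?_)
      (Eventually.of_forall fun t n => ?_)
    · simpa using this
    · have hc : Continuous fun t : ℝ≥0 =>
          (Real.exp (-B.μ n * t) - Real.exp (-B.μ n * s)) ^ 2 * inner ℝ (B.W n) z ^ 2 := by
        fun_prop
      simpa using hc.tendsto s
    · rw [Real.norm_of_nonneg (by positivity)]
      refine mul_le_of_le_one_left (sq_nonneg _) ?_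
      rw [sq_le_one_iff_abs_le_one, abs_le]
      have h1 := B.exp_le_one n t
      have h2 := B.exp_le_one n s
      constructor <;> linarith [Real.exp_pos (-B.μ n * t), Real.exp_pos (-B.μ n * s)]
  have hn : Tendsto (fun t => ‖B.semigroup t z - B.semigroup s z‖) (𝓝 s) (𝓝 0) := by
    simpa [Function.comp_def, Real.sqrt_sq] using (Real.continuous_sqrt.tendsto 0).comp hsq
  exact tendsto_iff_norm_sub_tendsto_zero.mpr hn

/-- The Fourier coefficients of an element of `H¹`. -/
def coef (z : H1 P) (n : ℕ) : ℝ := inner ℝ (H1.emb (B.w n)) (H1.emb z)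

theorem abs_coef_le (z : H1 P) (n : ℕ) : |B.coef z n| ≤ ‖H1.emb z‖ := by
  refine (abs_real_inner_le_norm _ _).trans ?_
  rw [B.norm_emb_w, one_mul]

/-- Evaluation at `x` is continuous on `H¹`, so the expansion may be evaluated termwise; the two
factors `√μₙ` from normalization cancel. -/
theorem ext_fn_semigroup (t : ℝ≥0) (ht : 0 < t) (z : H1 P) {x : ℝ} (hx : x ∈ Icc (0 : ℝ) 1) :
    ext (H1.fn (B.semigroup t z)) x = B.heat (fun n x => B.coef z n * B.e n x) t x := by
  have h1 := B.basisH1.hasSum_repr (B.semigroup t z)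
  let ev : H1 P →L[ℝ] ℝ := (ContinuousMap.evalCLM ℝ (⟨x, hx⟩ : Icc (0 : ℝ) 1)).comp H1.fn
  have h2 := h1.mapL ev
  have h3 : ∀ y : H1 P, ev y = ext (H1.fn y) x := fun y => by rw [ext_of_mem _ hx]; rfl
  rw [h3] at h2
  refine h2.unique ?_
  have ht' : (0 : ℝ) < t := ht
  refine (((tame_e (B := B)).coeff_mul (B.abs_coef_le z)).hasSum ht' hx).congr_fun fun n => ?_
  have h0 := (B.sqrt_μ_pos n).ne'
  rw [map_smul, h3, basisH1_apply, B.ext_fn_W n hx, HilbertBasis.repr_apply_apply, basisH1_apply,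
    inner_W_semigroup, B.inner_W, smul_eq_mul]
  change Real.exp (-B.μ n * t) * (√(B.μ n) * B.coef z n) * (B.e n x / √(B.μ n)) = _
  field_simp

theorem heat_hasDerivWithinAt (z : H1 P) {t x : ℝ} (ht : 0 < t) (hx : x ∈ Icc (0 : ℝ) 1) :
    HasDerivWithinAt (B.heat (fun n x => B.coef z n * B.e n x) t)
      (B.heat (fun n x => B.coef z n * B.e₁ n x) t x) (Icc 0 1) x :=
  ((tame_e (B := B)).coeff_mul (B.abs_coef_le z)).hasDerivWithinAt_heat
    ((tame_e₁ (B := B)).coeff_mul (B.abs_coef_le z))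
    (fun n x hx => ((B.eig n).deriv x hx).const_mul _) ht hx

theorem semigroup_snd_ae (t : ℝ≥0) (ht : 0 < t) (z : H1 P) :
    (B.semigroup t z).2 =ᵐ[vol01] B.heat (fun n x => B.coef z n * B.e₁ n x) t := by
  have hc := ((tame_e₁ (B := B)).coeff_mul (B.abs_coef_le z)).continuousOn_heat_slice
    (t := t) ht
  have h : B.semigroup t z = H1.mk (B.heat (fun n x => B.coef z n * B.e n x) t 0)
      (toL2 (ofCont _ hc)) := by
    refine H1.fn_injective ?_
    ext x
    rw [← ext_of_mem _ x.2, ← ext_of_mem _ x.2, B.ext_fn_semigroup t ht z x.2, H1.ext_fn _ x.2,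
      H1.mk_fst, H1.mk_snd, IsEigenfun.integral_congr_subinterval (toL2_ofCont_ae hc) x.2]
    exact primitive_eq_of_hasDerivWithinAt (fun x hx => B.heat_hasDerivWithinAt z ht hx) hc x.2
  rw [h, H1.mk_snd]
  exact toL2_ofCont_ae hc

end EigenBasis


/-! ### Positivity for the heat equation with potential -/

theorem ContinuousOn.slice {F : ℝ → ℝ → ℝ}
    (hF : ContinuousOn (Function.uncurry F) (Ioi 0 ×ˢ Icc 0 1)) {t : ℝ} (ht : 0 < t) :
    ContinuousOn (F t) (Icc 0 1) :=
  hF.comp (f := fun x => (t, x)) (continuousOn_const.prodMk continuousOn_id) fun _ hx => ⟨ht, hx⟩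

theorem hasDerivAt_integral_Icc {F F' : ℝ → ℝ → ℝ}
    (hF : ContinuousOn (Function.uncurry F) (Ioi 0 ×ˢ Icc 0 1))
    (hF' : ContinuousOn (Function.uncurry F') (Ioi 0 ×ˢ Icc 0 1))
    (hd : ∀ t : ℝ, 0 < t → ∀ x ∈ Icc (0 : ℝ) 1, HasDerivAt (fun s => F s x) (F' t x) t)
    {t y : ℝ} (ht : 0 < t) (hy : y ∈ Icc (0 : ℝ) 1) :
    HasDerivAt (fun s => ∫ x in (0 : ℝ)..y, F s x) (∫ x in (0 : ℝ)..y, F' t x) t := by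
  -- A compact time neighbourhood inside `(0,∞)`, on which `F'` has a uniform bound.
  have hK : IsCompact (Icc (t / 2) (2 * t) ×ˢ Icc (0 : ℝ) 1) := isCompact_Icc.prod isCompact_Icc
  have hsub : Icc (t / 2) (2 * t) ×ˢ Icc (0 : ℝ) 1 ⊆ Ioi 0 ×ˢ Icc 0 1 := fun p hp =>
    ⟨lt_of_lt_of_le (half_pos ht) hp.1.1, hp.2⟩
  obtain ⟨M, hM⟩ := hK.exists_bound_of_continuousOn (hF'.mono hsub)
  have hI : uIoc 0 y ⊆ Icc (0 : ℝ) 1 := by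
    rw [uIoc_of_le hy.1]
    exact fun s hs => ⟨hs.1.le, hs.2.trans hy.2⟩
  refine (intervalIntegral.hasDerivAt_integral_of_dominated_loc_of_deriv_le
    (F' := F') (bound := fun _ => M)
    (Icc_mem_nhds (half_lt_self ht) (by linarith : t < 2 * t)) ?_ ?_ ?_ ?_ ?_ ?_).2
  · filter_upwards [Ioi_mem_nhds ht] with s hs
    exact ((ContinuousOn.slice hF hs).mono hI).aestronglyMeasurable measurableSet_uIoc
  · refine ContinuousOn.intervalIntegrable ((ContinuousOn.slice hF ht).mono ?_)
    rw [uIcc_of_le hy.1]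
    exact Icc_subset_Icc_right hy.2
  · exact ((ContinuousOn.slice hF' ht).mono hI).aestronglyMeasurable measurableSet_uIoc
  · exact ae_of_all _ fun x hx s hs => hM (s, x) ⟨hs, hI hx⟩
  · exact intervalIntegrable_const
  · exact ae_of_all _ fun x hx s hs => hd s (lt_of_lt_of_le (half_pos ht) hs.1) x (hI hx)

/-- The negative part becomes differentiable once raised to a power at least two. The fourth power
serves as the energy density in the barrier argument, so that its derivative, a cube, may still be
integrated by parts. -/
theorem hasDerivAt_min_zero_pow (k : ℕ) (y : ℝ) :
    HasDerivAt (fun y : ℝ => min y 0 ^ (k + 2)) ((k + 2) * min y 0 ^ (k + 1)) y := by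
  have hpow : ∀ y : ℝ, HasDerivAt (fun y : ℝ => y ^ (k + 2)) ((k + 2) * y ^ (k + 1)) y :=
    fun y => by simpa using hasDerivAt_pow (k + 2) y
  rcases lt_trichotomy y 0 with h | h | h
  · rw [min_eq_left h.le]
    refine (hpow y).congr_of_eventuallyEq ?_
    filter_upwards [Iio_mem_nhds h] with x hx
    rw [min_eq_left (le_of_lt hx)]
  · subst h
    have h1 : HasDerivWithinAt (fun y : ℝ => min y 0 ^ (k + 2)) 0 (Iic 0) 0 := by
      have := (hpow 0).hasDerivWithinAt (s := Iic 0)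
      simp only [ne_eq, Nat.succ_ne_zero, not_false_eq_true, zero_pow, mul_zero] at this
      exact this.congr (fun x hx => by rw [min_eq_left hx]) (by simp)
    have h2 : HasDerivWithinAt (fun y : ℝ => min y 0 ^ (k + 2)) 0 (Ici 0) 0 :=
      (hasDerivWithinAt_const 0 (Ici 0) (0 : ℝ)).congr
        (fun x hx => by rw [min_eq_right hx]; simp) (by simp)
    have h3 := h1.union h2
    rw [Iic_union_Ici, hasDerivWithinAt_univ] at h3
    simpa using h3
  · rw [min_eq_right h.le]
    have : HasDerivAt (fun _ : ℝ => (0 : ℝ)) 0 y := hasDerivAt_const _ _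
    simp only [ne_eq, Nat.succ_ne_zero, not_false_eq_true, zero_pow, mul_zero]
    refine this.congr_of_eventuallyEq ?_
    filter_upwards [Ioi_mem_nhds h] with x hx
    rw [min_eq_right (le_of_lt hx)]; simp

/-- A lower barrier for solutions of `vₜ = vₓₓ - V v` with Neumann boundary conditions. -/
theorem pos_of_heat_equation {m : C01} {v vt vx vxx : ℝ → ℝ → ℝ}
    (hv : ContinuousOn (Function.uncurry v) (Ioi 0 ×ˢ Icc 0 1))
    (hvt : ContinuousOn (Function.uncurry vt) (Ioi 0 ×ˢ Icc 0 1))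
    (hvx : ContinuousOn (Function.uncurry vx) (Ioi 0 ×ˢ Icc 0 1))
    (hvxx : ContinuousOn (Function.uncurry vxx) (Ioi 0 ×ˢ Icc 0 1))
    (dt : ∀ t : ℝ, 0 < t → ∀ x ∈ Icc (0 : ℝ) 1, HasDerivAt (fun s => v s x) (vt t x) t)
    (dx : ∀ t : ℝ, 0 < t → ∀ x ∈ Icc (0 : ℝ) 1, HasDerivWithinAt (v t) (vx t x) (Icc 0 1) x)
    (dxx : ∀ t : ℝ, 0 < t → ∀ x ∈ Icc (0 : ℝ) 1, HasDerivWithinAt (vx t) (vxx t x) (Icc 0 1) x)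
    (heq : ∀ t : ℝ, 0 < t → ∀ x ∈ Icc (0 : ℝ) 1, vt t x = vxx t x - ext m x * v t x)
    (hm : ∀ x, 0 ≤ m x)
    (bc : ∀ t : ℝ, 0 < t → vx t 0 = 0 ∧ vx t 1 = 0) {ε δ : ℝ} (hε : 0 < ε) (hδ : 0 < δ)
    (hinit : ∀ x ∈ Icc (0 : ℝ) 1, δ ≤ v ε x) :
    ∀ t, ε ≤ t → ∀ x ∈ Icc (0 : ℝ) 1, 0 < v t x := by
  set M := ‖m‖
  -- Constant in space with `b' = -M b` and `M ≥ m`, hence a subsolution, and `b ε ≤ δ`. The energy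
  -- `∫ min(v - b, 0)⁴` vanishes at `ε` and does not increase, so `v ≥ b > 0` afterwards.
  set b : ℝ → ℝ := fun t => δ * Real.exp (-M * t) with hb
  have hbpos : ∀ t, 0 < b t := fun t => by positivity
  have hbd : ∀ t, HasDerivAt b (-M * b t) t := fun t => by
    have := (((hasDerivAt_id t).const_mul (-M)).exp).const_mul δ
    refine this.congr_deriv ?_
    simp only [hb, id, mul_one]; ring
  have hbc : Continuous b := by fun_prop
  set N : ℝ → ℝ → ℝ := fun t x => min (v t x - b t) 0 with hN
  have hNc : ContinuousOn (Function.uncurry N) (Ioi 0 ×ˢ Icc 0 1) := by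
    have h1 : ContinuousOn (fun p : ℝ × ℝ => b p.1) (Ioi 0 ×ˢ Icc 0 1) :=
      (hbc.comp continuous_fst).continuousOn
    exact (hv.sub h1).inf continuousOn_const
  have hΨ : ContinuousOn (Function.uncurry fun t x => N t x ^ 4) (Ioi 0 ×ˢ Icc 0 1) := hNc.pow 4
  have hΨ' : ContinuousOn (Function.uncurry fun t x => 4 * N t x ^ 3 * (vt t x + M * b t))
      (Ioi 0 ×ˢ Icc 0 1) := by
    have h1 : ContinuousOn (fun p : ℝ × ℝ => M * b p.1) (Ioi 0 ×ˢ Icc 0 1) :=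
      ((hbc.comp continuous_fst).const_mul M).continuousOn
    exact ((hNc.pow 3).const_smul (4 : ℝ)).mul (hvt.add h1)
  have hEd : ∀ t, 0 < t → HasDerivAt (fun s => ∫ x in (0 : ℝ)..1, N s x ^ 4)
      (∫ x in (0 : ℝ)..1, 4 * N t x ^ 3 * (vt t x + M * b t)) t := fun t ht =>
    hasDerivAt_integral_Icc hΨ hΨ' (fun s hs x hx => by
      have h1 := (hasDerivAt_min_zero_pow 2 (v s x - b s)).comp s ((dt s hs x hx).sub (hbd s))
      refine h1.congr_deriv ?_
      simp only [hN]; norm_num) ht (by simp)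
  have hneg : ∀ t, 0 < t → ∫ x in (0 : ℝ)..1, 4 * N t x ^ 3 * (vt t x + M * b t) ≤ 0 := by
    intro t ht
    -- The Neumann conditions make this derivative integrate to zero, so that `∫ 4 N³ v_xx = -∫ 12
    -- N² v_x² ≤ 0`.
    have hF : ∀ x ∈ Icc (0 : ℝ) 1, HasDerivWithinAt (fun x => 4 * N t x ^ 3 * vx t x)
        (12 * N t x ^ 2 * vx t x ^ 2 + 4 * N t x ^ 3 * vxx t x) (Icc 0 1) x := fun x hx => by
      have h1 := (hasDerivAt_min_zero_pow 1 (v t x - b t)).comp_hasDerivWithinAt x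
        ((dx t ht x hx).sub_const (b t))
      refine ((h1.const_mul 4).mul (dxx t ht x hx)).congr_deriv ?_
      simp only [hN, Function.comp_apply]; norm_num; ring
    have hNt := ContinuousOn.slice hNc ht
    have hxt := ContinuousOn.slice hvx ht
    have hxxt := ContinuousOn.slice hvxx ht
    have hFc : ContinuousOn (fun x => 12 * N t x ^ 2 * vx t x ^ 2 + 4 * N t x ^ 3 * vxx t x)
        (Icc 0 1) :=
      (((hNt.pow 2).const_smul (12 : ℝ)).mul (hxt.pow 2)).add
        (((hNt.pow 3).const_smul (4 : ℝ)).mul hxxt)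
    have hint := integral_eq_sub_of_hasDerivWithinAt_Icc zero_le_one hF hFc
    rw [(bc t ht).1, (bc t ht).2, mul_zero, mul_zero, sub_zero] at hint
    refine le_trans ?_ hint.le
    refine intervalIntegral.integral_mono_on zero_le_one ?_ ?_ fun x hx => ?_
    · refine ContinuousOn.intervalIntegrable ?_
      rw [uIcc_of_le zero_le_one]; exact ContinuousOn.slice hΨ' ht
    · refine ContinuousOn.intervalIntegrable ?_
      rw [uIcc_of_le zero_le_one]; exact hFc
    · rw [heq t ht x hx]
      have hV0 : 0 ≤ ext m x := hm _
      have hVM : ext m x ≤ M := (le_abs_self _).trans (abs_ext_le m x)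
      have hbt := hbpos t
      -- Where `v < b` one has `m v ≤ m b ≤ M b` and `N³ ≤ 0`; elsewhere `N = 0`.
      have key : 0 ≤ -(N t x ^ 3 * (M * b t - ext m x * v t x)) := by
        simp only [hN]
        rcases le_total (v t x - b t) 0 with h | h
        · rw [min_eq_left h]
          have h3 : 0 ≤ -(v t x - b t) ^ 3 := by
            have : -(v t x - b t) ^ 3 = (-(v t x - b t)) ^ 3 := by ring
            rw [this]
            exact pow_nonneg (by linarith) 3
          have h4 : 0 ≤ M * b t - ext m x * v t x := by nlinarith
          nlinarith [mul_nonneg h3 h4]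
        · rw [min_eq_right h]; simp
      have h12 : 0 ≤ N t x ^ 2 * vx t x ^ 2 := by positivity
      nlinarith
  have hanti : AntitoneOn (fun s => ∫ x in (0 : ℝ)..1, N s x ^ 4) (Ici ε) := by
    refine antitoneOn_of_hasDerivWithinAt_nonpos (convex_Ici ε)
      (fun s hs => (hEd s (hε.trans_le hs)).continuousAt.continuousWithinAt)
      (fun s hs => (hEd s (hε.trans_le (interior_subset hs))).hasDerivWithinAt)
      (fun s hs => hneg s (hε.trans_le (interior_subset hs)))
  have h0 : ∫ x in (0 : ℝ)..1, N ε x ^ 4 = 0 := by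
    rw [integral_congr_Icc (g := fun _ => 0) fun x hx => ?_]
    · simp
    · have h1 : b ε ≤ δ := by
        refine mul_le_of_le_one_right hδ.le (Real.exp_le_one_iff.mpr ?_)
        have := norm_nonneg m
        nlinarith
      simp only [hN]
      rw [min_eq_right (by linarith [hinit x hx])]; simp
  intro t ht x hx
  have ht0 := hε.trans_le ht
  have hle : ∫ x in (0 : ℝ)..1, N t x ^ 4 ≤ 0 := by
    have := hanti (mem_Ici.mpr le_rfl) ht ht
    simp only [h0] at this
    exact this
  by_contra! hcon
  refine absurd hle (not_le.mpr ?_)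
  refine intervalIntegral.integral_pos zero_lt_one (ContinuousOn.slice hΨ ht0)
    (fun y _ => by positivity) ⟨x, hx, ?_⟩
  have : N t x < 0 := by
    simp only [hN]
    exact min_lt_of_left_lt (by linarith [hbpos t])
  exact Even.pow_pos (by decide) this.ne

namespace EigenBasis

variable {P : Potential} (B : EigenBasis P) (z : H1 P)

/-- The solution of the heat equation `vₜ = vₓₓ - V v` with data `z`. -/
def sol : ℝ → ℝ → ℝ := B.heat fun n x => B.coef z n * B.e n x

/-- The space derivative of `sol`. -/
def solx : ℝ → ℝ → ℝ := B.heat fun n x => B.coef z n * B.e₁ n x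

/-- The time derivative of `sol`. -/
def solt : ℝ → ℝ → ℝ := B.heat fun n x => -B.μ n * (B.coef z n * B.e n x)

/-- The mixed derivative of `sol`. -/
def soltx : ℝ → ℝ → ℝ := B.heat fun n x => -B.μ n * (B.coef z n * B.e₁ n x)

theorem tame_coef_e : B.Tame fun n x => B.coef z n * B.e n x :=
  tame_e.coeff_mul (B.abs_coef_le z)

theorem tame_coef_e₁ : B.Tame fun n x => B.coef z n * B.e₁ n x :=
  tame_e₁.coeff_mul (B.abs_coef_le z)

theorem continuousOn_sol : ContinuousOn (Function.uncurry (B.sol z)) (Ioi 0 ×ˢ Icc 0 1) :=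
  (B.tame_coef_e z).continuousOn_heat

theorem continuousOn_solx : ContinuousOn (Function.uncurry (B.solx z)) (Ioi 0 ×ˢ Icc 0 1) :=
  (B.tame_coef_e₁ z).continuousOn_heat

theorem continuousOn_solt : ContinuousOn (Function.uncurry (B.solt z)) (Ioi 0 ×ˢ Icc 0 1) :=
  (B.tame_coef_e z).neg_μ_mul.continuousOn_heat

theorem continuousOn_soltx : ContinuousOn (Function.uncurry (B.soltx z)) (Ioi 0 ×ˢ Icc 0 1) :=
  (B.tame_coef_e₁ z).neg_μ_mul.continuousOn_heat

variable {t x : ℝ}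

theorem hasDerivAt_sol (ht : 0 < t) (hx : x ∈ Icc (0 : ℝ) 1) :
    HasDerivAt (fun s => B.sol z s x) (B.solt z t x) t := (B.tame_coef_e z).hasDerivAt_heat ht hx

theorem hasDerivAt_solx (ht : 0 < t) (hx : x ∈ Icc (0 : ℝ) 1) :
    HasDerivAt (fun s => B.solx z s x) (B.soltx z t x) t :=
  (B.tame_coef_e₁ z).hasDerivAt_heat ht hx

theorem hasDerivWithinAt_sol (ht : 0 < t) (hx : x ∈ Icc (0 : ℝ) 1) :
    HasDerivWithinAt (B.sol z t) (B.solx z t x) (Icc 0 1) x := B.heat_hasDerivWithinAt z ht hx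

theorem hasDerivWithinAt_solt (ht : 0 < t) (hx : x ∈ Icc (0 : ℝ) 1) :
    HasDerivWithinAt (B.solt z t) (B.soltx z t x) (Icc 0 1) x :=
  (B.tame_coef_e z).neg_μ_mul.hasDerivWithinAt_heat (B.tame_coef_e₁ z).neg_μ_mul
    (fun n _ hx => (((B.eig n).deriv _ hx).const_mul _).const_mul _) ht hx

theorem hasDerivWithinAt_solx (ht : 0 < t) (hx : x ∈ Icc (0 : ℝ) 1) :
    HasDerivWithinAt (B.solx z t) (ext P.toC01 x * B.sol z t x + B.solt z t x) (Icc 0 1) x := by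
  rw [sol, solt, ← heat_potential (B.abs_coef_le z) ht hx]
  exact (B.tame_coef_e₁ z).hasDerivWithinAt_heat
    (tame_potential_e.coeff_mul (B.abs_coef_le z))
    (fun n _ hx => ((B.eig n).deriv₁ _ hx).const_mul _) ht hx

theorem solx_boundary (t : ℝ) : B.solx z t 0 = 0 ∧ B.solx z t 1 = 0 := by
  simp [solx, heat, (B.eig _).zero, (B.eig _).one]

/-- The series is classical only for `t > 0`, so the barrier starts at a small `ε`. Uniform
continuity of the flow at time `0` keeps the solution there above half the minimum of `z`. -/
theorem sol_pos (ht : 0 < t) (hz : ∀ x, 0 < H1.fn z x) (hx : x ∈ Icc (0 : ℝ) 1) :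
    0 < B.sol z t x := by
  obtain ⟨x₀, -, hx₀⟩ := isCompact_univ.exists_isMinOn univ_nonempty
    (H1.fn z).continuous.continuousOn
  set δ := H1.fn z x₀ / 2 with hδ
  have hδ0 : 0 < δ := half_pos (hz x₀)
  have hnear : ∀ᶠ s : ℝ≥0 in 𝓝 0, ∀ x, δ ≤ H1.fn (B.semigroup s z) x := by
    have hc : Continuous fun s => H1.fn (B.semigroup s z) :=
      H1.fn.continuous.comp (B.continuous_semigroup_time z)
    have h1 := (hc.continuousAt (x := 0)).eventually (Metric.ball_mem_nhds _ hδ0)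
    filter_upwards [h1] with s hs x
    rw [B.semigroup_zero, dist_eq_norm] at hs
    have h2 := ((H1.fn (B.semigroup s z) - H1.fn z).norm_coe_le_norm x).trans_lt hs
    have h3 : H1.fn z x₀ ≤ H1.fn z x := hx₀ (mem_univ x)
    rw [ContinuousMap.sub_apply, Real.norm_eq_abs, abs_lt] at h2
    linarith [h2.1]
  obtain ⟨ε, hε, hεt, hlow⟩ : ∃ ε : ℝ≥0, 0 < ε ∧ (ε : ℝ) ≤ t ∧
      ∀ x, δ ≤ H1.fn (B.semigroup ε z) x := by
    have h1 : ∀ᶠ s : ℝ≥0 in 𝓝[>] 0, ∀ x, δ ≤ H1.fn (B.semigroup s z) x :=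
      hnear.filter_mono nhdsWithin_le_nhds
    have h2 : ∀ᶠ s : ℝ≥0 in 𝓝[>] 0, s ≤ ⟨t, ht.le⟩ :=
      nhdsWithin_le_nhds (Iic_mem_nhds (show (0 : ℝ≥0) < ⟨t, ht.le⟩ from ht))
    obtain ⟨s, ⟨hs1, hs2⟩, hs3⟩ := ((h1.and h2).and self_mem_nhdsWithin).exists
    exact ⟨s, hs3, hs2, hs1⟩
  have hε' : (0 : ℝ) < ε := hε
  refine pos_of_heat_equation (m := P.toC01) (B.continuousOn_sol z) (B.continuousOn_solt z)
    (B.continuousOn_solx z)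
    (vxx := fun t x => ext P.toC01 x * B.sol z t x + B.solt z t x) ?_
    (fun t ht x hx => B.hasDerivAt_sol z ht hx) (fun t ht x hx => B.hasDerivWithinAt_sol z ht hx)
    (fun t ht x hx => B.hasDerivWithinAt_solx z ht hx) (fun t _ x _ => by ring)
    (fun x => (P.pos x).le) (fun t _ => B.solx_boundary z t) hε' hδ0 (fun y hy => ?_) t hεt x hx
  · exact (((continuous_ext P.toC01).comp continuous_snd).continuousOn.mul
      (B.continuousOn_sol z)).add (B.continuousOn_solt z)
  · rw [sol, ← B.ext_fn_semigroup ε hε z hy]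
    exact hlow _

end EigenBasis


/-! ### The Cole–Hopf transform, its inverse and the Burgers flow -/

theorem ext_mul (m n : C01) (x : ℝ) : ext (m * n) x = ext m x * ext n x := rfl

theorem mulC_mulC (m n : C01) (f : L2) : mulC m (mulC n f) = mulC (m * n) f := by
  refine Lp.ext ?_
  filter_upwards [mulC_ae m (mulC n f), mulC_ae n f, mulC_ae (m * n) f] with x h1 h2 h3
  rw [h1, h2, h3, ext_mul, mul_assoc]

theorem one_mulC (f : L2) : mulC 1 f = f := by
  refine Lp.ext ?_
  filter_upwards [mulC_ae 1 f] with x h1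
  rw [h1, show ext 1 x = 1 from rfl, one_mul]

theorem denseRange_toL2 : DenseRange toL2 := by
  refine (BoundedContinuousFunction.toLp_denseRange (p := 2) ℝ vol01 ℝ (by norm_num)).mono ?_
  rintro _ ⟨f, rfl⟩
  refine ⟨ofCont f f.continuous.continuousOn, Lp.ext ?_⟩
  filter_upwards [toL2_ofCont_ae f.continuous.continuousOn,
    BoundedContinuousFunction.coeFn_toLp (p := 2) vol01 ℝ f] with x h1 h2
  rw [h1, h2]

/-- The function `exp(-½ ∫₀ˣ u)`. -/
def expPrim (u : L2) : C01 :=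
  (⟨fun y => Real.exp (-(1 / 2) * y), by fun_prop⟩ : C(ℝ, ℝ)).comp (primC u)

theorem expPrim_apply (u : L2) (x : Icc (0 : ℝ) 1) :
    expPrim u x = Real.exp (-(1 / 2) * ∫ s in (0 : ℝ)..x, u s) := rfl

theorem ext_expPrim (u : L2) {x : ℝ} (hx : x ∈ Icc (0 : ℝ) 1) :
    ext (expPrim u) x = Real.exp (-(1 / 2) * ∫ s in (0 : ℝ)..x, u s) := by
  rw [ext_of_mem _ hx, expPrim_apply]

theorem expPrim_pos (u : L2) (x : Icc (0 : ℝ) 1) : 0 < expPrim u x := Real.exp_pos _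

theorem continuous_expPrim : Continuous expPrim :=
  (ContinuousMap.continuous_postcomp _).comp primC.continuous

theorem continuous_mulC_expPrim : Continuous fun u => mulC (expPrim u) u :=
  (mulC.continuous.comp continuous_expPrim).clm_apply continuous_id

/-- The integrated form of `q' = -½ u q`. Both sides are continuous in `u ∈ L²`, so it suffices to
treat continuous `u`, where the chain rule applies. -/
theorem expPrim_eq (u : L2) :
    expPrim u = 1 + primC (-(1 / 2 : ℝ) • mulC (expPrim u) u) := by
  have hcl : IsClosed {u : L2 | expPrim u = 1 + primC (-(1 / 2 : ℝ) • mulC (expPrim u) u)} := by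
    exact isClosed_eq continuous_expPrim (continuous_const.add (primC.continuous.comp
      ((continuous_const_smul (-(1 / 2 : ℝ))).comp continuous_mulC_expPrim)))
  refine denseRange_toL2.induction_on u hcl fun m => ?_
  set q := expPrim (toL2 m) with hq
  have hcm := continuous_ext m
  have hqx : ∀ x ∈ Icc (0 : ℝ) 1,
      ext q x = Real.exp (-(1 / 2) * ∫ s in (0 : ℝ)..x, ext m s) := fun x hx => by
    rw [hq, ext_expPrim _ hx, IsEigenfun.integral_congr_subinterval (toL2_ae m) hx]
  have hd : ∀ x ∈ Icc (0 : ℝ) 1, HasDerivWithinAt (ext q)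
      (-(1 / 2) * (ext q x * ext m x)) (Icc 0 1) x := fun x hx => by
    have h1 := ((intervalIntegral.integral_hasDerivAt_right (hcm.intervalIntegrable 0 x)
      (hcm.stronglyMeasurableAtFilter _ _) hcm.continuousAt).const_mul (-(1 / 2 : ℝ))).exp
    refine (h1.hasDerivWithinAt.congr hqx (hqx x hx)).congr_deriv ?_
    rw [hqx x hx]; ring
  have hc : Continuous fun x => -(1 / 2) * (ext q x * ext m x) :=
    ((continuous_ext q).mul hcm).const_mul _
  ext x
  have h0 := primitive_eq_of_hasDerivWithinAt hd hc.continuousOn x.2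
  rw [ext_of_mem _ x.2] at h0
  rw [h0, ContinuousMap.add_apply, ContinuousMap.one_apply, hqx 0 (by simp), primC_apply]
  simp only [intervalIntegral.integral_same, mul_zero, Real.exp_zero]
  congr 1
  refine (IsEigenfun.integral_congr_subinterval ?_ x.2).symm
  filter_upwards [Lp.coeFn_smul (-(1 / 2 : ℝ)) (mulC q (toL2 m)), mulC_ae q (toL2 m),
    toL2_ae m] with y h1 h2 h3
  rw [h1, Pi.smul_apply, h2, h3, smul_eq_mul]

/-- Integration over `[0,1]`. -/
def integralC : C01 →L[ℝ] ℝ := (innerSL ℝ (toL2 1)).comp toL2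

theorem integralC_apply (m : C01) : integralC m = ∫ x in (0 : ℝ)..1, ext m x := by
  change inner ℝ (toL2 1) (toL2 m) = _
  rw [inner_toL2_toL2]
  exact integral_congr_Icc fun x _ => by rw [show ext 1 x = 1 from rfl, one_mul]

theorem integral_ext_pos {m : C01} (hm : ∀ x, 0 < m x) : 0 < ∫ x in (0 : ℝ)..1, ext m x :=
  intervalIntegral.intervalIntegral_pos_of_pos_on ((continuous_ext m).intervalIntegrable _ _)
    (fun _ _ => hm _) zero_lt_one

theorem integralC_pos {m : C01} (hm : ∀ x, 0 < m x) : 0 < integralC m := by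
  rw [integralC_apply]; exact integral_ext_pos hm

variable {P : Potential}

/-- The Cole-Hopf transform as a map into `H¹`. -/
def coleHopfH1 (P : Potential) (u : L2) : H1 P :=
  (integralC (expPrim u))⁻¹ • H1.mk 1 (-(1 / 2 : ℝ) • mulC (expPrim u) u)

theorem fn_coleHopfH1 (u : L2) :
    H1.fn (coleHopfH1 P u) = (integralC (expPrim u))⁻¹ • expPrim u := by
  rw [coleHopfH1, map_smul]
  congr 1
  rw [H1.fn_eq, H1.mk_fst, H1.mk_snd]
  conv_rhs => rw [expPrim_eq]
  rfl

theorem coleHopfH1_snd (u : L2) :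
    (coleHopfH1 P u).2 = -(1 / 2 : ℝ) • mulC (H1.fn (coleHopfH1 P u)) u := by
  rw [fn_coleHopfH1]
  change (integralC (expPrim u))⁻¹ • (-(1 / 2 : ℝ) • mulC (expPrim u) u) = _
  rw [map_smul, smul_apply, smul_comm]

theorem ext_fn_coleHopfH1 (u : L2) {x : ℝ} (hx : x ∈ Icc (0 : ℝ) 1) :
    ext (H1.fn (coleHopfH1 P u)) x = coleHopf u x := by
  have h : integralC (expPrim u) =
      ∫ y in (0 : ℝ)..1, Real.exp (-(1 / 2) * ∫ s in (0 : ℝ)..y, u s) := by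
    rw [integralC_apply]
    exact integral_congr_Icc fun y hy => ext_expPrim u hy
  rw [fn_coleHopfH1, ext_smul, ext_expPrim u hx, h, coleHopf]
  ring

theorem fn_coleHopfH1_pos (u : L2) (x : Icc (0 : ℝ) 1) : 0 < H1.fn (coleHopfH1 P u) x := by
  rw [fn_coleHopfH1]
  exact mul_pos (inv_pos.mpr (integralC_pos (expPrim_pos u))) (expPrim_pos u x)

/-- The derivative `-½ u v` depends continuously on `u` in `L²`, so continuity holds for the `H¹`
topology, in which the inverse transform is continuous. -/
theorem continuous_coleHopfH1 : Continuous (coleHopfH1 P) := by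
  refine Continuous.smul (Continuous.inv₀ (integralC.continuous.comp continuous_expPrim)
    fun u => (integralC_pos (expPrim_pos u)).ne') ?_
  exact (H1.equiv P).symm.continuous.comp
    (continuous_const.prodMk ((continuous_const_smul (-(1 / 2 : ℝ))).comp continuous_mulC_expPrim))

/-- The inverse Cole-Hopf transform `v ↦ -2 v' / v`. -/
def invColeHopf (z : H1 P) : L2 := (-2 : ℝ) • mulC (Ring.inverse (H1.fn z)) z.2

theorem isUnit_of_pos {m : C01} (hm : ∀ x, 0 < m x) : IsUnit m :=
  (ContinuousMap.isUnit_iff_forall_ne_zero m).mpr fun x => (hm x).ne'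

theorem ext_inverse {m : C01} (hm : ∀ x, 0 < m x) (x : ℝ) :
    ext (Ring.inverse m) x = (ext m x)⁻¹ := by
  have h := Ring.inverse_mul_cancel m (isUnit_of_pos hm)
  have h1 : ext (Ring.inverse m) x * ext m x = 1 := by rw [← ext_mul, h]; rfl
  exact eq_inv_of_mul_eq_one_left h1

theorem invColeHopf_coleHopfH1 (u : L2) : invColeHopf (coleHopfH1 P u) = u := by
  rw [invColeHopf, coleHopfH1_snd, map_smul, mulC_mulC,
    Ring.inverse_mul_cancel _ (isUnit_of_pos (fn_coleHopfH1_pos u)), one_mulC, smul_smul]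
  norm_num

/-- Positive functions are units of the Banach algebra `C([0,1])`, and inversion is continuous at
units. Positivity also avoids the value `0` that `Ring.inverse` takes at non-units. -/
theorem continuous_invColeHopf_comp {X : Type*} [TopologicalSpace X] {f : X → H1 P}
    (hf : Continuous f) (hpos : ∀ a x, 0 < H1.fn (f a) x) :
    Continuous fun a => invColeHopf (f a) := by
  have h1 : Continuous fun a => (f a).2 :=
    continuous_snd.comp ((H1.equiv P).continuous.comp hf)
  have h2 : Continuous fun a => Ring.inverse (H1.fn (f a)) := by
    rw [continuous_iff_continuousAt]
    intro a
    obtain ⟨w, hw⟩ := isUnit_of_pos (hpos a)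
    have h3 := NormedRing.inverse_continuousAt w
    rw [hw] at h3
    exact h3.comp (f := fun a => H1.fn (f a)) (H1.fn.continuous.comp hf).continuousAt
  exact (continuous_const_smul (-2 : ℝ)).comp ((mulC.continuous.comp h2).clm_apply h1)

theorem invColeHopf_ae {z : H1 P} (hz : ∀ x, 0 < H1.fn z x) :
    invColeHopf z =ᵐ[vol01] fun x => -2 * (z.2 x / ext (H1.fn z) x) := by
  filter_upwards [Lp.coeFn_smul (-2 : ℝ) (mulC (Ring.inverse (H1.fn z)) z.2),
    mulC_ae (Ring.inverse (H1.fn z)) z.2] with x h1 h2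
  rw [invColeHopf, h1, Pi.smul_apply, h2, ext_inverse hz, smul_eq_mul]
  ring

namespace EigenBasis

variable (B : EigenBasis P)

theorem fn_semigroup_pos {z : H1 P} (hz : ∀ x, 0 < H1.fn z x) (t : ℝ≥0) (x : Icc (0 : ℝ) 1) :
    0 < H1.fn (B.semigroup t z) x := by
  rcases eq_or_ne t 0 with rfl | ht
  · rw [B.semigroup_zero]; exact hz x
  · have ht' : 0 < t := pos_iff_ne_zero.mpr ht
    have h := B.sol_pos z (t := t) ht' hz x.2
    rw [sol, ← B.ext_fn_semigroup t ht' z x.2, ext_of_mem _ x.2] at h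
    exact h

/-- The Burgers flow. -/
def flow (t : ℝ≥0) : C(L2, L2) where
  toFun u := invColeHopf (B.semigroup t (coleHopfH1 P u))
  continuous_toFun := continuous_invColeHopf_comp
    ((B.continuous_semigroup t).comp continuous_coleHopfH1)
    fun u => B.fn_semigroup_pos (fn_coleHopfH1_pos u) t

theorem flow_apply (t : ℝ≥0) (u : L2) :
    B.flow t u = invColeHopf (B.semigroup t (coleHopfH1 P u)) := rfl

theorem flow_ae (t : ℝ≥0) (ht : 0 < t) (u : L2) : B.flow t u =ᵐ[vol01] fun x =>
    -2 * (B.solx (coleHopfH1 P u) t x / B.sol (coleHopfH1 P u) t x) := by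
  rw [flow_apply]
  filter_upwards [invColeHopf_ae (B.fn_semigroup_pos (fn_coleHopfH1_pos u) t),
    B.semigroup_snd_ae t ht (coleHopfH1 P u), ae_vol01_mem] with x h1 h2 h3
  rw [h1, h2, B.ext_fn_semigroup t ht _ h3]
  rfl

/-- For `w = v_x/v` the equation `v_xx = V v + v_t` gives `w_x = V + v_t/v - w²`. Differentiating
once more in `x` and comparing with `w_t` yields Burgers for `-2w`. -/
theorem isBurgersSolution_flow {V : ℝ → ℝ} (hV : ContDiffOn ℝ ∞ V (Icc 0 1))
    (hPV : ∀ x ∈ Icc (0 : ℝ) 1, ext P.toC01 x = V x) (u₀ : L2) :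
    IsBurgersSolution V u₀ fun t => B.flow t u₀ := by
  set z := coleHopfH1 P u₀ with hz
  have hzpos : ∀ x, 0 < H1.fn z x := fn_coleHopfH1_pos u₀
  set S := B.sol z
  set D := B.solx z
  set S' := B.solt z
  set D' := B.soltx z
  have hS := B.continuousOn_sol z
  have hD := B.continuousOn_solx z
  have hS' := B.continuousOn_solt z
  have hD' := B.continuousOn_soltx z
  have hpos : ∀ t : ℝ, 0 < t → ∀ x ∈ Icc (0 : ℝ) 1, S t x ≠ 0 := fun t ht x hx =>
    (B.sol_pos z ht hzpos hx).ne'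
  have hne : ∀ p ∈ Ioi (0 : ℝ) ×ˢ Icc (0 : ℝ) 1, Function.uncurry S p ≠ 0 := fun p hp =>
    hpos p.1 hp.1 p.2 hp.2
  set V' : ℝ → ℝ := derivWithin V (Icc 0 1)
  have hu : UniqueDiffOn ℝ (Icc (0 : ℝ) 1) := uniqueDiffOn_Icc zero_lt_one
  have hV'c : ContinuousOn V' (Icc 0 1) := hV.continuousOn_derivWithin hu (by norm_num)
  have hVd : ∀ x ∈ Icc (0 : ℝ) 1, HasDerivWithinAt (ext P.toC01) (V' x) (Icc 0 1) x :=
    fun x hx => ((hV.differentiableOn (by norm_num) x hx).hasDerivWithinAt).congr hPV (hPV x hx)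
  have hQc : ContinuousOn (fun p : ℝ × ℝ => ext P.toC01 p.2) (Ioi 0 ×ˢ Icc 0 1) :=
    ((continuous_ext _).comp continuous_snd).continuousOn
  have hV'c2 : ContinuousOn (fun p : ℝ × ℝ => V' p.2) (Ioi 0 ×ˢ Icc 0 1) :=
    hV'c.comp continuousOn_snd fun p hp => hp.2
  refine ⟨continuous_invColeHopf_comp (B.continuous_semigroup_time z)
    (B.fn_semigroup_pos hzpos), ?_, ?_⟩
  · rw [flow_apply, B.semigroup_zero, invColeHopf_coleHopfH1]
  -- Here `S`, `D`, `S'`, `D'` are `v`, `v_x`, `v_t`, `v_tx`. Every `v_xx` has been replaced through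
  -- the equation, so `V` is the only coefficient to be differentiated.
  refine ⟨fun t x => -2 * (D t x / S t x),
    fun t x => -2 * (D' t x / S t x - D t x * S' t x / S t x ^ 2),
    fun t x => -2 * (ext P.toC01 x + S' t x / S t x - (D t x / S t x) ^ 2),
    fun t x => -2 * (V' x + (D' t x / S t x - S' t x * D t x / S t x ^ 2) -
      2 * (D t x / S t x) * (ext P.toC01 x + S' t x / S t x - (D t x / S t x) ^ 2)),
    fun t ht => B.flow_ae t ht u₀, ?_, ?_, ?_, ?_, ?_, ?_, ?_⟩
  · exact (hD.div hS hne).const_smul (-2 : ℝ)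
  · exact ((hD'.div hS hne).sub ((hD.mul hS').div (hS.pow 2)
      fun p hp => pow_ne_zero 2 (hne p hp))).const_smul (-2 : ℝ)
  · exact ((hQc.add (hS'.div hS hne)).sub ((hD.div hS hne).pow 2)).const_smul (-2 : ℝ)
  · exact ((hV'c2.add ((hD'.div hS hne).sub ((hS'.mul hD).div (hS.pow 2)
      fun p hp => pow_ne_zero 2 (hne p hp)))).sub (((hD.div hS hne).const_smul (2 : ℝ)).mul
      ((hQc.add (hS'.div hS hne)).sub ((hD.div hS hne).pow 2)))).const_smul (-2 : ℝ)
  · intro t ht x hx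
    have h0 := hpos t ht x hx
    have dS := B.hasDerivWithinAt_sol z ht hx
    have dD := B.hasDerivWithinAt_solx z ht hx
    have dS' := B.hasDerivWithinAt_solt z ht hx
    have dDS := dD.fun_div dS h0
    refine ⟨?_, ?_, ?_⟩
    · refine (((B.hasDerivAt_solx z ht hx).fun_div (B.hasDerivAt_sol z ht hx) h0).const_mul
        (-2 : ℝ)).congr_deriv ?_
      change -2 * ((D' t x * S t x - D t x * S' t x) / S t x ^ 2) =
        -2 * (D' t x / S t x - D t x * S' t x / S t x ^ 2)
      field_simp
    · refine (dDS.const_mul (-2 : ℝ)).congr_deriv ?_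
      change _ = -2 * (ext P.toC01 x + S' t x / S t x - (D t x / S t x) ^ 2)
      change -2 * (((ext P.toC01 x * S t x + S' t x) * S t x - D t x * D t x) / S t x ^ 2) = _
      field_simp
    · refine ((((hVd x hx).fun_add (dS'.fun_div dS h0)).fun_sub (dDS.fun_pow 2)).const_mul
        (-2 : ℝ)).congr_deriv ?_
      change -2 * (V' x + (D' t x * S t x - S' t x * D t x) / S t x ^ 2 -
        ((2 : ℕ) : ℝ) * (D t x / S t x) ^ (2 - 1) *
        (((ext P.toC01 x * S t x + S' t x) * S t x - D t x * D t x) / S t x ^ 2)) = _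
      norm_num
      field_simp
  · intro t _
    have h := B.solx_boundary z t
    refine ⟨?_, ?_⟩
    · change -2 * (B.solx z t 0 / _) = 0
      rw [h.1]; simp
    · change -2 * (B.solx z t 1 / _) = 0
      rw [h.2]; simp
  · intro t ht x hx
    have h0 := hpos t ht x (Ioo_subset_Icc_self hx)
    have hdV : deriv V x = V' x := (derivWithin_of_mem_nhds (Icc_mem_nhds hx.1 hx.2)).symm
    simp only [hdV]
    field_simp
    ring

end EigenBasis


/-! ### Evolution of the coefficients of an arbitrary solution, and uniqueness -/

variable {P : Potential}

theorem ae_vol01_mem_Ioo : ∀ᵐ x ∂vol01, x ∈ Ioo (0 : ℝ) 1 := by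
  rw [vol01, ← Measure.restrict_congr_set Ioo_ae_eq_Icc]
  exact ae_restrict_mem measurableSet_Ioo

/-- Integrating Burgers in `x` shows that `p = exp(-½∫₀ˣ u)` satisfies `p_t = p_xx - V p + g p`.
Testing with an eigenfunction moves both space derivatives onto it. The same `g` serves all
eigenfunctions, which is what lets it cancel in quotients. -/
theorem IsBurgersSolution.exists_hasDerivAt_integral {V : ℝ → ℝ} {u₀ : L2} {u : ℝ≥0 → L2}
    (h : IsBurgersSolution V u₀ u) (hV : ContDiffOn ℝ ∞ V (Icc 0 1))
    (hPV : ∀ x ∈ Icc (0 : ℝ) 1, ext P.toC01 x = V x) :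
    ∃ g : ℝ → ℝ, ∀ t : ℝ, 0 < t → ∀ (μ : ℝ) (e e₁ : ℝ → ℝ), IsEigenfun P μ e e₁ →
      HasDerivAt (fun s : ℝ => ∫ x in (0 : ℝ)..1, e x * ext (expPrim (u s.toNNReal)) x)
        ((g t - μ) * ∫ x in (0 : ℝ)..1, e x * ext (expPrim (u t.toNNReal)) x) t := by
  obtain ⟨U, Ut, Ux, Uxx, hrep, cU, cUt, cUx, cUxx, hd, bc, heq⟩ := h.classical
  set p : ℝ → ℝ → ℝ := fun t x => ext (expPrim (u t.toNNReal)) x with hp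
  have hpc : Continuous (Function.uncurry p) := by
    have h1 : Continuous fun q : ℝ × ℝ => expPrim (u q.1.toNNReal) :=
      continuous_expPrim.comp (h.continuous.comp (continuous_real_toNNReal.comp continuous_fst))
    exact continuous_eval.comp (h1.prodMk ((continuous_projIcc (h := zero_le_one)).comp continuous_snd))
  have hpU : ∀ t : ℝ, 0 < t → ∀ x ∈ Icc (0 : ℝ) 1,
      p t x = Real.exp (-(1 / 2) * ∫ s in (0 : ℝ)..x, U t s) := fun t ht x hx => by
    have h1 := hrep t.toNNReal (Real.toNNReal_pos.mpr ht)
    rw [Real.coe_toNNReal t ht.le] at h1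
    simp only [hp]
    rw [ext_expPrim _ hx, IsEigenfun.integral_congr_subinterval h1 hx]
  have hu : UniqueDiffOn ℝ (Icc (0 : ℝ) 1) := uniqueDiffOn_Icc zero_lt_one
  set V' : ℝ → ℝ := derivWithin V (Icc 0 1)
  have hV'c : ContinuousOn V' (Icc 0 1) := hV.continuousOn_derivWithin hu (by norm_num)
  have hVd : ∀ x ∈ Icc (0 : ℝ) 1, HasDerivWithinAt V (V' x) (Icc 0 1) x :=
    fun x hx => (hV.differentiableOn (by norm_num) x hx).hasDerivWithinAt
  -- The constant of integration, chosen so that `Wt` vanishes at `x = 0`, where `U = 0`.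
  set g : ℝ → ℝ := fun t => 1 / 2 * Ux t 0 + V 0 with hg
  set Wt : ℝ → ℝ → ℝ := fun t x => Ux t x + 2 * V x - 1 / 2 * U t x ^ 2 - 2 * g t with hWt
  have hWt_eq : ∀ t : ℝ, 0 < t → ∀ x ∈ Icc (0 : ℝ) 1, ∫ s in (0 : ℝ)..x, Ut t s = Wt t x := by
    intro t ht x hx
    have h1 : ∀ x ∈ Icc (0 : ℝ) 1,
        HasDerivWithinAt (fun x => Ux t x + 2 * V x - 1 / 2 * U t x ^ 2)
          (Uxx t x + 2 * V' x - U t x * Ux t x) (Icc 0 1) x := fun x hx => by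
      obtain ⟨-, d1, d2⟩ := hd t ht x hx
      refine ((d2.fun_add ((hVd x hx).const_mul 2)).fun_sub
        ((d1.fun_pow 2).const_mul (1 / 2))).congr_deriv ?_
      norm_num; ring
    have h2 := primitive_eq_of_hasDerivWithinAt h1
      ((((ContinuousOn.slice cUxx ht).add (hV'c.const_smul (2 : ℝ))).sub
        ((ContinuousOn.slice cU ht).mul (ContinuousOn.slice cUx ht)))) hx
    have h3 : (fun x => Uxx t x + 2 * V' x - U t x * Ux t x) =ᵐ[vol01] Ut t := by
      filter_upwards [ae_vol01_mem_Ioo] with y hy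
      have h4 := heq t ht y hy
      have h5 : deriv V y = V' y := (derivWithin_of_mem_nhds (Icc_mem_nhds hy.1 hy.2)).symm
      rw [h5] at h4
      linarith
    rw [IsEigenfun.integral_congr_subinterval h3 hx, (bc t ht).1] at h2
    simp only [hWt, hg]
    linarith
  have hVc2 : ContinuousOn (fun q : ℝ × ℝ => V q.2) (Ioi 0 ×ˢ Icc 0 1) :=
    hV.continuousOn.comp continuousOn_snd fun q hq => hq.2
  have hgc : ContinuousOn (fun q : ℝ × ℝ => g q.1) (Ioi 0 ×ˢ Icc 0 1) := by
    have h1 : ContinuousOn (fun q : ℝ × ℝ => Ux q.1 0) (Ioi 0 ×ˢ Icc 0 1) :=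
      cUx.comp (f := fun q : ℝ × ℝ => (q.1, (0 : ℝ)))
        (continuousOn_fst.prodMk continuousOn_const) fun q hq => ⟨hq.1, by simp⟩
    exact (h1.const_smul (1 / 2 : ℝ)).add continuousOn_const
  have hWtc : ContinuousOn (Function.uncurry Wt) (Ioi 0 ×ˢ Icc 0 1) :=
    ((cUx.add (hVc2.const_smul (2 : ℝ))).sub ((cU.pow 2).const_smul (1 / 2 : ℝ))).sub
      (hgc.const_smul (2 : ℝ))
  refine ⟨g, fun t ht μ e e₁ he => ?_⟩
  have hec : ContinuousOn (fun q : ℝ × ℝ => e q.2) (Ioi 0 ×ˢ Icc 0 1) :=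
    he.continuousOn.comp continuousOn_snd fun q hq => hq.2
  have hF : ContinuousOn (Function.uncurry fun t x => e x * p t x) (Ioi 0 ×ˢ Icc 0 1) :=
    hec.mul hpc.continuousOn
  have hF' : ContinuousOn (Function.uncurry fun t x => e x * (-(1 / 2) * Wt t x * p t x))
      (Ioi 0 ×ˢ Icc 0 1) :=
    hec.mul ((hWtc.const_smul (-(1 / 2) : ℝ)).mul hpc.continuousOn)
  have hder := hasDerivAt_integral_Icc hF hF' (fun s hs x hx => by
    have h1 := ((hasDerivAt_integral_Icc cU cUt (fun s hs x hx => (hd s hs x hx).1) hs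
      hx).const_mul (-(1 / 2) : ℝ)).exp
    refine HasDerivAt.const_mul _ ((h1.congr_of_eventuallyEq ?_).congr_deriv ?_)
    · filter_upwards [Ioi_mem_nhds hs] with r hr
      exact hpU r hr x hx
    · rw [hpU s hs x hx, hWt_eq s hs x hx]; ring) ht (y := 1) (by simp)
  refine hder.congr_deriv ?_
  -- The Wronskian `e p_x - e₁ p`, with `p_x = -½ U p`. It vanishes at both ends by the Dirichlet
  -- condition on `U` and the Neumann condition on `e`.
  have hG : ∀ x ∈ Icc (0 : ℝ) 1, HasDerivWithinAt
      (fun x => (-(1 / 2) * (e x * U t x) - e₁ x) * p t x)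
      (e x * (-(1 / 2) * Wt t x * p t x) - (g t - μ) * (e x * p t x)) (Icc 0 1) x := fun x hx => by
    obtain ⟨-, d1, -⟩ := hd t ht x hx
    have hpd : HasDerivWithinAt (p t) (-(1 / 2) * U t x * p t x) (Icc 0 1) x := by
      have h1 := ((hasDerivWithinAt_of_eq_primitive (f := fun x => ∫ s in (0 : ℝ)..x, U t s)
        (ContinuousOn.slice cU ht) (fun x hx => by simp) hx).const_mul (-(1 / 2) : ℝ)).exp
      refine (h1.congr (hpU t ht) (hpU t ht x hx)).congr_deriv ?_
      rw [hpU t ht x hx]; ring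
    refine (((((he.deriv x hx).fun_mul d1).const_mul (-(1 / 2) : ℝ)).fun_sub
      (he.deriv₁ x hx)).fun_mul hpd).congr_deriv ?_
    simp only [hWt, hPV x hx]
    ring
  have hpt : ContinuousOn (p t) (Icc 0 1) := (continuous_ext _).continuousOn
  have c1 : ContinuousOn (fun x => e x * (-(1 / 2) * Wt t x * p t x)) (Icc 0 1) :=
    ContinuousOn.slice hF' ht
  have c2 : ContinuousOn (fun x => (g t - μ) * (e x * p t x)) (Icc 0 1) :=
    (ContinuousOn.slice hF ht).const_smul (g t - μ)
  have h0 := integral_eq_sub_of_hasDerivWithinAt_Icc zero_le_one hG (c1.sub c2)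
  rw [intervalIntegral.integral_sub (c1.intervalIntegrable_of_Icc zero_le_one)
    (c2.intervalIntegrable_of_Icc zero_le_one), intervalIntegral.integral_const_mul,
    (bc t ht).1, (bc t ht).2, he.zero, he.one] at h0
  simp only [mul_zero, sub_zero, zero_mul] at h0
  exact sub_eq_zero.mp h0

namespace EigenBasis

variable (B : EigenBasis P)

/-- The coefficients of `exp(-½ ∫₀ˣ u)`. -/
def expCoef (u : L2) (n : ℕ) : ℝ := inner ℝ (H1.emb (B.w n)) (toL2 (expPrim u))

theorem expCoef_eq (u : L2) (n : ℕ) :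
    B.expCoef u n = ∫ x in (0 : ℝ)..1, B.e n x * ext (expPrim u) x := by
  rw [expCoef, inner_emb_w]
  refine integral_congr_vol01 ?_
  filter_upwards [toL2_ae (expPrim u)] with x hx
  rw [hx]

theorem continuous_expCoef (n : ℕ) : Continuous fun u => B.expCoef u n :=
  continuous_const.inner (toL2.continuous.comp continuous_expPrim)

theorem expCoef_zero_pos (hpos : ∀ x ∈ Icc (0 : ℝ) 1, 0 < B.e 0 x) (u : L2) :
    0 < B.expCoef u 0 := by
  rw [expCoef_eq]
  refine intervalIntegral.intervalIntegral_pos_of_pos_on ?_ (fun x hx =>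
    mul_pos (hpos x (Ioo_subset_Icc_self hx)) (expPrim_pos u _)) zero_lt_one
  exact ((B.eig 0).continuousOn.mul
    (continuous_ext _).continuousOn).intervalIntegrable_of_Icc zero_le_one

theorem coef_coleHopfH1 (u : L2) (n : ℕ) :
    B.coef (coleHopfH1 P u) n = (integralC (expPrim u))⁻¹ * B.expCoef u n := by
  rw [coef, expCoef, H1.emb, ContinuousLinearMap.comp_apply, ContinuousLinearMap.comp_apply,
    fn_coleHopfH1, map_smul, inner_smul_right]

/-- The quotient rule eliminates `g`: the ratio times `e^{(μₙ-μ₀)s}` has zero derivative for `s >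
0`. The equation gives nothing at `s = 0`, where continuity in `L²` is enough for the mean value
theorem. -/
theorem expCoef_ratio (hpos : ∀ x ∈ Icc (0 : ℝ) 1, 0 < B.e 0 x) {V : ℝ → ℝ} {u₀ : L2}
    {u : ℝ≥0 → L2} (h : IsBurgersSolution V u₀ u) (hV : ContDiffOn ℝ ∞ V (Icc 0 1))
    (hPV : ∀ x ∈ Icc (0 : ℝ) 1, ext P.toC01 x = V x) (t : ℝ≥0) (n : ℕ) :
    B.expCoef (u t) n / B.expCoef (u t) 0 =
      Real.exp (-(B.μ n - B.μ 0) * t) * (B.expCoef u₀ n / B.expCoef u₀ 0) := by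
  obtain ⟨g, hg⟩ := h.exists_hasDerivAt_integral hV hPV
  set d : ℕ → ℝ → ℝ := fun k s => B.expCoef (u s.toNNReal) k with hd
  have hd0 : ∀ s, d 0 s ≠ 0 := fun s => (B.expCoef_zero_pos hpos _).ne'
  have hdd : ∀ k s, 0 < s → HasDerivAt (d k) ((g s - B.μ k) * d k s) s := fun k s hs => by
    have h1 := hg s hs _ _ _ (B.eig k)
    simp only [← expCoef_eq] at h1
    exact h1
  have hdc : ∀ k, Continuous (d k) := fun k =>
    (B.continuous_expCoef k).comp (h.continuous.comp continuous_real_toNNReal)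
  set f : ℝ → ℝ := fun s => Real.exp ((B.μ n - B.μ 0) * s) * (d n s / d 0 s) with hf
  have hfc : Continuous f := by
    have h1 : Continuous fun s => d n s / d 0 s := (hdc n).div (hdc 0) hd0
    fun_prop
  have hfd : ∀ s, 0 < s → HasDerivAt f 0 s := fun s hs => by
    refine ((((hasDerivAt_id s).const_mul (B.μ n - B.μ 0)).exp).fun_mul
      ((hdd n s hs).fun_div (hdd 0 s hs) (hd0 s))).congr_deriv ?_
    have := hd0 s
    simp only [id]
    field_simp
    ring
  have hconst : f t = f 0 := by
    rcases eq_or_ne t 0 with rfl | ht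
    · rfl
    · have ht' : (0 : ℝ) < t := NNReal.coe_pos.mpr (pos_iff_ne_zero.mpr ht)
      obtain ⟨c, -, hc⟩ := exists_hasDerivAt_eq_slope f (fun _ => 0) ht' hfc.continuousOn
        fun s hs => hfd s hs.1
      rw [eq_comm, div_eq_zero_iff] at hc
      rcases hc with hc | hc
      · exact sub_eq_zero.mp hc
      · exact absurd hc (by simpa using ht)
  simp only [hf, hd, Real.toNNReal_coe, Real.toNNReal_zero, h.initial, mul_zero, Real.exp_zero,
    one_mul] at hconst
  rw [← hconst, ← mul_assoc, ← Real.exp_add, show -(B.μ n - B.μ 0) * (t : ℝ) +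
    (B.μ n - B.μ 0) * t = 0 by ring, Real.exp_zero, one_mul]

/-- Completeness makes the two exponentials proportional. Both equal `1` at `x = 0`, so they
coincide, and so do the primitives in the exponents. -/
theorem eq_of_expCoef_ratio (hpos : ∀ x ∈ Icc (0 : ℝ) 1, 0 < B.e 0 x) {u v : L2}
    (h : ∀ n, B.expCoef u n / B.expCoef u 0 = B.expCoef v n / B.expCoef v 0) : u = v := by
  set κ := B.expCoef u 0 / B.expCoef v 0 with hκ
  have hu := (B.expCoef_zero_pos hpos u).ne'
  have hv := (B.expCoef_zero_pos hpos v).ne'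
  have h1 : toL2 (expPrim u - κ • expPrim v) = 0 := by
    refine B.complete _ fun n => ?_
    rw [map_sub, map_smul, inner_sub_right, inner_smul_right]
    change B.expCoef u n - κ * B.expCoef v n = 0
    have h2 := h n
    rw [hκ]
    field_simp at h2 ⊢
    linarith
  have h2 : expPrim u = κ • expPrim v :=
    sub_eq_zero.mp (toL2_injective (h1.trans (map_zero toL2).symm))
  have h3 : ∀ x : Icc (0 : ℝ) 1, expPrim u x = κ * expPrim v x := fun x =>
    congrArg (fun m : C01 => m x) h2
  have h4 : κ = 1 := by
    have h5 := h3 ⟨0, by simp⟩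
    simpa [expPrim_apply] using h5.symm
  refine sub_eq_zero.mp (primC_eq_const_imp (c := 0) fun x => ?_)
  have h5 := h3 x
  rw [h4, one_mul, expPrim_apply, expPrim_apply, Real.exp_eq_exp] at h5
  rw [map_sub, ContinuousMap.sub_apply, primC_apply, primC_apply]
  linarith

theorem isBurgersFlow_flow (hpos : ∀ x ∈ Icc (0 : ℝ) 1, 0 < B.e 0 x) {V : ℝ → ℝ}
    (hV : ContDiffOn ℝ ∞ V (Icc 0 1)) (hPV : ∀ x ∈ Icc (0 : ℝ) 1, ext P.toC01 x = V x) :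
    IsBurgersFlow V B.flow := fun u₀ u => by
  refine ⟨fun h t => B.eq_of_expCoef_ratio hpos fun n => ?_, fun h => ?_⟩
  · rw [B.expCoef_ratio hpos h hV hPV,
      B.expCoef_ratio hpos (B.isBurgersSolution_flow hV hPV u₀) hV hPV]
  · rw [show u = fun t => B.flow t u₀ from funext h]
    exact B.isBurgersSolution_flow hV hPV u₀

end EigenBasis


/-! ### The Koopman eigenfunctionals -/

theorem exists_expPrim_eq {v v' : ℝ → ℝ}
    (hd : ∀ x ∈ Icc (0 : ℝ) 1, HasDerivWithinAt v (v' x) (Icc 0 1) x)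
    (hc : ContinuousOn v' (Icc 0 1)) (hpos : ∀ x ∈ Icc (0 : ℝ) 1, 0 < v x) :
    ∃ u : L2, ∀ x ∈ Icc (0 : ℝ) 1, ext (expPrim u) x = v x / v 0 := by
  have hcv : ContinuousOn v (Icc 0 1) := fun x hx => (hd x hx).continuousWithinAt
  have hcu : ContinuousOn (fun x => -2 * (v' x / v x)) (Icc 0 1) :=
    (hc.div hcv fun x hx => (hpos x hx).ne').const_smul (-2 : ℝ)
  refine ⟨toL2 (ofCont _ hcu), fun x hx => ?_⟩
  have h0 : (0 : ℝ) ∈ Icc (0 : ℝ) 1 := by simp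
  have hlog := primitive_eq_of_hasDerivWithinAt
    (fun y hy => ((hd y hy).log (hpos y hy).ne').const_mul (-2 : ℝ)) hcu hx
  rw [ext_expPrim _ hx, IsEigenfun.integral_congr_subinterval (toL2_ofCont_ae hcu) hx,
    ← sub_eq_of_eq_add' hlog, ← Real.exp_log (div_pos (hpos x hx) (hpos 0 h0)),
    Real.log_div (hpos x hx).ne' (hpos 0 h0).ne']
  congr 1
  ring

namespace EigenBasis

variable {P : Potential} (B : EigenBasis P)

/-- A small multiple of `∑ e_q` added to `e₀` keeps the function positive and makes every prescribed
coefficient positive; it is, up to scale, the Cole–Hopf transform of some `u`. This shows that a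
product of ratios is not identically zero. -/
theorem exists_expCoef_pos (hpos : ∀ x ∈ Icc (0 : ℝ) 1, 0 < B.e 0 x) (s : Finset ℕ) :
    ∃ u : L2, ∀ n ∈ s, 0 < B.expCoef u n := by
  have he : ∀ n, ContinuousOn (B.e n) (Icc 0 1) := fun n => (B.eig n).continuousOn
  have hsc : ContinuousOn (fun x => ∑ q ∈ s, B.e q x) (Icc 0 1) :=
    continuousOn_finsetSum s fun q _ => he q
  obtain ⟨M, hM⟩ := isCompact_Icc.exists_bound_of_continuousOn hsc
  obtain ⟨x₀, hx₀, hmin⟩ := isCompact_Icc.exists_isMinOn (nonempty_Icc.mpr zero_le_one) (he 0)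
  have hm := hpos x₀ hx₀
  have hM0 : 0 ≤ M := (norm_nonneg _).trans (hM 0 (by simp))
  -- With `x₀` a minimum point of `e₀`, the perturbation is at most `ε M < min e₀`; the `+ 1` covers
  -- `M = 0`.
  set ε := B.e 0 x₀ / (M + 1) with hε
  have hε0 : 0 < ε := by positivity
  have hεM : ε * M < B.e 0 x₀ := by
    rw [hε, div_mul_eq_mul_div, div_lt_iff₀ (by positivity)]
    nlinarith
  have hvpos : ∀ x ∈ Icc (0 : ℝ) 1, 0 < B.e 0 x + ε * ∑ q ∈ s, B.e q x := fun x hx => by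
    have h1 := (abs_le.mp (hM x hx)).1
    have h2 : B.e 0 x₀ ≤ B.e 0 x := hmin hx
    nlinarith [mul_le_mul_of_nonneg_left h1 hε0.le]
  obtain ⟨u, hu⟩ := exists_expPrim_eq
    (fun x hx => ((B.eig 0).deriv x hx).fun_add
      ((HasDerivWithinAt.fun_sum fun q _ => (B.eig q).deriv x hx).const_mul ε))
    ((B.eig 0).continuousOn₁.add
      ((continuousOn_finsetSum s fun q _ => (B.eig q).continuousOn₁).const_smul ε)) hvpos
  refine ⟨u, fun n hn => ?_⟩
  have hi : ∀ q, IntervalIntegrable (fun x => B.e n x * B.e q x) volume 0 1 := fun q =>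
    ((he n).mul (he q)).intervalIntegrable_of_Icc zero_le_one
  have h1 : B.expCoef u n = (∫ x in (0 : ℝ)..1, (B.e n x * B.e 0 x +
      ε * ∑ q ∈ s, B.e n x * B.e q x)) / (B.e 0 0 + ε * ∑ q ∈ s, B.e q 0) := by
    rw [expCoef_eq, ← intervalIntegral.integral_div]
    refine integral_congr_Icc fun x hx => ?_
    rw [hu x hx, ← Finset.mul_sum]
    ring
  have his : IntervalIntegrable (fun x => ε * ∑ q ∈ s, B.e n x * B.e q x) volume 0 1 :=
    ((continuousOn_finsetSum s fun q _ => (he n).mul (he q)).const_smul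
      ε).intervalIntegrable_of_Icc zero_le_one
  rw [h1, intervalIntegral.integral_add (hi 0) his,
    intervalIntegral.integral_const_mul, intervalIntegral.integral_finsetSum fun q _ => hi q]
  refine div_pos ?_ (hvpos 0 (by simp))
  simp only [B.integral_e_mul_e, Finset.sum_ite_eq, hn, if_true, mul_one]
  split_ifs <;> positivity

theorem coeff_coleHopf (u : L2) (n : ℕ) :
    coeff B.e n (coleHopf u) = B.coef (coleHopfH1 P u) n := by
  rw [coef, inner_emb_w_emb, coeff]
  exact integral_congr_Icc fun x hx => by rw [ext_fn_coleHopfH1 u hx]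

theorem coeff_coleHopf_zero_pos (hpos : ∀ x ∈ Icc (0 : ℝ) 1, 0 < B.e 0 x) (u : L2) :
    0 < coeff B.e 0 (coleHopf u) := by
  rw [coeff_coleHopf, coef_coleHopfH1]
  exact mul_pos (inv_pos.mpr (integralC_pos (expPrim_pos u))) (B.expCoef_zero_pos hpos u)

/-- The normalizing integral of the transform cancels in ratios. -/
theorem coeff_coleHopf_div (u : L2) (n : ℕ) :
    coeff B.e n (coleHopf u) / coeff B.e 0 (coleHopf u) = B.expCoef u n / B.expCoef u 0 := by
  rw [coeff_coleHopf, coeff_coleHopf, coef_coleHopfH1, coef_coleHopfH1,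
    mul_div_mul_left _ _ (inv_ne_zero (integralC_pos (expPrim_pos u)).ne')]

variable {m : ℕ} (ν : Fin (m + 1) → ℕ)

theorem eigenfunctional_eq (u : L2) :
    eigenfunctional B.e ν u = ∏ i, B.expCoef u (ν i) / B.expCoef u 0 :=
  Finset.prod_congr rfl fun i _ => B.coeff_coleHopf_div u (ν i)

theorem continuous_eigenfunctional (hpos : ∀ x ∈ Icc (0 : ℝ) 1, 0 < B.e 0 x) :
    Continuous (eigenfunctional B.e ν) := by
  rw [show eigenfunctional B.e ν = _ from funext (B.eigenfunctional_eq ν)]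
  exact continuous_finsetProd _ fun i _ => (B.continuous_expCoef _).div (B.continuous_expCoef 0)
    fun u => (B.expCoef_zero_pos hpos u).ne'

theorem hasEigenvector_koopman (hpos : ∀ x ∈ Icc (0 : ℝ) 1, 0 < B.e 0 x) {V : ℝ → ℝ}
    (hV : ContDiffOn ℝ ∞ V (Icc 0 1)) (hPV : ∀ x ∈ Icc (0 : ℝ) 1, ext P.toC01 x = V x)
    {Φ : ℝ≥0 → C(L2, L2)} (hΦ : IsBurgersFlow V Φ) (t : ℝ≥0) :
    Module.End.HasEigenvector (koopman (Φ t)) (Real.exp (-lam B.μ ν * t))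
      ⟨eigenfunctional B.e ν, B.continuous_eigenfunctional ν hpos⟩ := by
  refine ⟨Module.End.mem_eigenspace_iff.mpr (ContinuousMap.ext fun u => ?_), fun h => ?_⟩
  · change eigenfunctional B.e ν (Φ t u) = Real.exp (-lam B.μ ν * t) * eigenfunctional B.e ν u
    have hsol : IsBurgersSolution V u fun t => Φ t u := (hΦ u _).mpr fun _ => rfl
    rw [eigenfunctional_eq, eigenfunctional_eq, lam, ← Finset.sum_neg_distrib, Finset.sum_mul,
      Real.exp_sum, ← Finset.prod_mul_distrib]
    exact Finset.prod_congr rfl fun i _ => B.expCoef_ratio hpos hsol hV hPV t (ν i)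
  · obtain ⟨u, hu⟩ := B.exists_expCoef_pos hpos (Finset.univ.image ν)
    have h1 : eigenfunctional B.e ν u = 0 := congrArg (fun φ : C(L2, ℝ) => φ u) h
    rw [eigenfunctional_eq] at h1
    refine (Finset.prod_pos fun i _ => div_pos (hu (ν i) ?_) (B.expCoef_zero_pos hpos u)).ne' h1
    exact Finset.mem_image_of_mem _ (Finset.mem_univ i)

end EigenBasis


/-! ### The Koopman decomposition -/

/-- The power of an absolutely convergent series expands over multi-indices, by splitting off one
factor at a time. -/
theorem hasSum_prod_fin {ι : Type*} {r : ι → ℝ} {R : ℝ} (hr : HasSum r R)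
    (hs : Summable fun i => |r i|) (m : ℕ) :
    (Summable fun q : Fin m → ι => |∏ i, r (q i)|) ∧
      HasSum (fun q : Fin m → ι => ∏ i, r (q i)) (R ^ m) := by
  induction m with
  | zero =>
    refine ⟨(hasSum_fintype _).summable, ?_⟩
    convert hasSum_fintype (fun q : Fin 0 → ι => ∏ i, r (q i)) using 1
    simp
  | succ m ih =>
    have e1 : ∀ p : ι × (Fin m → ι),
        ∏ i, r (Fin.consEquiv (fun _ : Fin (m + 1) => ι) p i) = r p.1 * ∏ i, r (p.2 i) :=
      fun p => by simp [Fin.prod_univ_succ, Fin.consEquiv]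
    have h1 : Summable fun p : ι × (Fin m → ι) => |r p.1 * ∏ i, r (p.2 i)| := by
      simp only [abs_mul]
      exact hs.mul_of_nonneg ih.1 (fun _ => abs_nonneg _) fun _ => abs_nonneg _
    refine ⟨?_, ?_⟩
    · rw [← (Fin.consEquiv fun _ : Fin (m + 1) => ι).summable_iff]
      refine h1.congr fun p => ?_
      rw [Function.comp_apply, e1]
    · rw [← (Fin.consEquiv fun _ : Fin (m + 1) => ι).hasSum_iff, pow_succ']
      refine (hr.mul ih.2 h1.of_abs).congr_fun fun p => ?_
      rw [Function.comp_apply, e1]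

theorem IsSobolevConstant.nonneg {C : ℝ} (hC : IsSobolevConstant C) : 0 ≤ C := by
  have h := hC (fun _ => 1) 1 0
    (fun x hx => by rw [← ext_primC _ hx, map_zero]; simp [ext]) 0 (by simp)
  by_contra! hneg
  have := mul_nonpos_of_nonpos_of_nonneg hneg.le (Real.sqrt_nonneg
    ((∫ y in (0 : ℝ)..1, (fun _ => (1 : ℝ)) y ^ 2) + ∫ y in (0 : ℝ)..1, (0 : L2) y ^ 2))
  rw [abs_one] at h
  linarith

namespace EigenBasis

variable {P : Potential} (B : EigenBasis P)

/-- The squared `H¹` norm of `eₙ` is `1 + ‖eₙ'‖²`, and `‖eₙ'‖² ≤ μₙ` because the potential adds a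
nonnegative share of the energy. -/
theorem abs_e_le_of_isSobolevConstant {C : ℝ} (hC : IsSobolevConstant C) (n : ℕ) {x : ℝ}
    (hx : x ∈ Icc (0 : ℝ) 1) : |B.e n x| ≤ C * √(1 + B.μ n) := by
  have h1 := hC (B.e n) (B.w n).1 (B.w n).2 (fun y hy => by
    rw [← H1.ext_fn _ hy, EigenFamily.w, (B.eig n).ext_fn_toH1 hy])
  have h2 : ∫ y in (0 : ℝ)..1, B.e n y ^ 2 = 1 := by
    simpa [sq] using B.integral_e_mul_e n n
  have h3 : ‖(B.w n).2‖ ^ 2 ≤ B.μ n := by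
    rw [← B.norm_w_sq]
    exact pow_le_pow_left₀ (norm_nonneg _) (H1.norm_snd_le _) 2
  rw [norm_sq_L2] at h3
  have hb : ∀ y ∈ Icc (0 : ℝ) 1, |B.e n y| ≤ C * √(1 + ∫ y in (0 : ℝ)..1, (B.w n).2 y ^ 2) :=
    fun y hy => by
    have h4 := h1 y hy
    rwa [h2] at h4
  exact (hb x hx).trans
    (mul_le_mul_of_nonneg_left (Real.sqrt_le_sqrt (by linarith)) hC.nonneg)

/-- Bessel's inequality for the component orthogonal to the ground state, whose higher coefficients
are those of `H(u)`. -/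
theorem sum_coef_sq_le (u : L2) (s : Finset ℕ) :
    ∑ n ∈ s, B.coef (coleHopfH1 P u) (n + 1) ^ 2 ≤
      ∫ x in (0 : ℝ)..1, (coleHopf u x - coeff B.e 0 (coleHopf u) * B.e 0 x) ^ 2 := by
  set z := coleHopfH1 P u with hz
  set y : H1 P := z - B.coef z 0 • B.w 0 with hy
  have h1 : ∫ x in (0 : ℝ)..1, (coleHopf u x - coeff B.e 0 (coleHopf u) * B.e 0 x) ^ 2 =
      ‖H1.emb y‖ ^ 2 := by
    rw [norm_sq_L2]
    refine integral_congr_vol01 ?_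
    filter_upwards [H1.emb_ae y, ae_vol01_mem] with x h1 hx
    have h2 : ext (H1.fn y) x = ext (H1.fn z) x - B.coef z 0 * ext (H1.fn (B.w 0)) x := by
      rw [hy, map_sub, map_smul]; rfl
    rw [h1, h2, B.coeff_coleHopf, ext_fn_coleHopfH1 u hx, EigenFamily.w,
      (B.eig 0).ext_fn_toH1 hx]
  have h2 := (hasSum_nat_add_iff' 1).mpr (B.hasSum_norm_sq_L2 (H1.emb y))
  have h3 : ∀ n, inner ℝ (H1.emb (B.w (n + 1))) (H1.emb y) = B.coef z (n + 1) := fun n => by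
    have ho := orthonormal_iff_ite.mp B.orth (n + 1) 0
    change inner ℝ (H1.emb (B.w (n + 1))) (H1.emb (B.w 0)) = _ at ho
    rw [hy, map_sub, map_smul, inner_sub_right, inner_smul_right, ho, if_neg (Nat.succ_ne_zero n), mul_zero,
      sub_zero]
    rfl
  simp only [h3, Finset.sum_range_one] at h2
  rw [h1]
  refine (sum_le_hasSum s (fun n _ => sq_nonneg _) h2).trans ?_
  linarith [sq_nonneg (inner ℝ (H1.emb (B.w 0)) (H1.emb y))]

/-- The ratio of the `n`-th mode to the ground mode in the expansion of the heat flow. -/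
def modeRatio (u : L2) (t x : ℝ) (n : ℕ) : ℝ :=
  Real.exp (-(B.μ n - B.μ 0) * t) *
    (coeff B.e n (coleHopf u) / coeff B.e 0 (coleHopf u)) * (B.e n x / B.e 0 x)

theorem summable_h₁ {t : ℝ} (ht : 0 < t) :
    Summable fun n : ℕ => (1 + B.μ (n + 1)) * Real.exp (-2 * (B.μ (n + 1) - B.μ 0) * t) := by
  have h1 := (B.summable_pow_mul_exp 1 (t := 2 * t) (by linarith)).mul_left
    (Real.exp (2 * B.μ 0 * t))
  refine ((summable_nat_add_iff 1).mpr h1).congr fun n => ?_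
  rw [mul_left_comm, ← Real.exp_add, pow_one]
  ring_nf

/-- Bound `eₙ` by the Sobolev inequality and `e₀` below by its infimum, then apply Cauchy–Schwarz to
`|cₙ|` and the weights `w`, whose squares are the terms of `h₁`. -/
theorem sum_abs_modeRatio_le (hpos : ∀ x ∈ Icc (0 : ℝ) 1, 0 < B.e 0 x) {C : ℝ}
    (hC : IsSobolevConstant C) (u : L2) {t : ℝ} (ht : 0 < t) {x : ℝ} (hx : x ∈ Icc (0 : ℝ) 1)
    (s : Finset ℕ) :
    ∑ n ∈ s, |B.modeRatio u t x (n + 1)| ≤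
      √(∫ x in (0 : ℝ)..1, (coleHopf u x - coeff B.e 0 (coleHopf u) * B.e 0 x) ^ 2) /
        (coeff B.e 0 (coleHopf u) * sInf (B.e 0 '' Icc 0 1)) * h₁ C B.μ t := by
  have hcomp : IsCompact (B.e 0 '' Icc 0 1) := isCompact_Icc.image_of_continuousOn
    (B.eig 0).continuousOn
  set m₀ := sInf (B.e 0 '' Icc 0 1) with hm₀
  have hm₀pos : 0 < m₀ := by
    obtain ⟨y, hy, hy'⟩ := hcomp.sInf_mem ((nonempty_Icc.mpr zero_le_one).image _)
    rw [hm₀, ← hy']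
    exact hpos y hy
  have hm₀le : m₀ ≤ B.e 0 x := csInf_le hcomp.bddBelow (mem_image_of_mem _ hx)
  set c := B.coef (coleHopfH1 P u) with hc
  set c₀ := coeff B.e 0 (coleHopf u) with hc₀
  have hc₀pos : 0 < c₀ := B.coeff_coleHopf_zero_pos hpos u
  have hC0 := hC.nonneg
  set w : ℕ → ℝ := fun n => √(1 + B.μ (n + 1)) * Real.exp (-(B.μ (n + 1) - B.μ 0) * t) with hw
  have hw2 : ∀ n, w n ^ 2 = (1 + B.μ (n + 1)) * Real.exp (-2 * (B.μ (n + 1) - B.μ 0) * t) :=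
    fun n => by
    rw [hw, mul_pow, Real.sq_sqrt (by linarith [B.μ_pos (n + 1)]), ← Real.exp_nat_mul]
    congr 2
    push_cast; ring
  have hterm : ∀ n, |B.modeRatio u t x (n + 1)| ≤ C / (c₀ * m₀) * (|c (n + 1)| * w n) := by
    intro n
    have h1 : |B.e (n + 1) x| / B.e 0 x ≤ C * √(1 + B.μ (n + 1)) / m₀ :=
      div_le_div₀ (by positivity) (B.abs_e_le_of_isSobolevConstant hC (n + 1) hx) hm₀pos hm₀le
    rw [modeRatio, abs_mul, abs_mul, abs_div, abs_div, Real.abs_exp, abs_of_pos (hpos x hx),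
      abs_of_pos hc₀pos, B.coeff_coleHopf]
    refine (mul_le_mul_of_nonneg_left h1 (by positivity)).trans (le_of_eq ?_)
    simp only [hw, hc]
    field_simp
  calc ∑ n ∈ s, |B.modeRatio u t x (n + 1)|
      ≤ ∑ n ∈ s, C / (c₀ * m₀) * (|c (n + 1)| * w n) := Finset.sum_le_sum fun n _ => hterm n
    _ = C / (c₀ * m₀) * ∑ n ∈ s, |c (n + 1)| * w n := by rw [Finset.mul_sum]
    _ ≤ C / (c₀ * m₀) * (√(∫ x in (0 : ℝ)..1, (coleHopf u x - c₀ * B.e 0 x) ^ 2) *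
          √(∑' n : ℕ, (1 + B.μ (n + 1)) * Real.exp (-2 * (B.μ (n + 1) - B.μ 0) * t))) := by
        refine mul_le_mul_of_nonneg_left ?_ (by positivity)
        refine (Real.sum_mul_le_sqrt_mul_sqrt s _ _).trans ?_
        refine mul_le_mul (Real.sqrt_le_sqrt ?_) (Real.sqrt_le_sqrt ?_) (Real.sqrt_nonneg _)
          (Real.sqrt_nonneg _)
        · simp only [sq_abs]
          exact B.sum_coef_sq_le u s
        · simp only [hw2]
          refine (B.summable_h₁ ht).sum_le_tsum s fun n _ => ?_
          have := B.μ_pos (n + 1)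
          positivity
    _ = _ := by rw [h₁]; ring

/-- The sign `(-1)^{m+1}` is split: one factor goes to `-2`, the other `m` go to the ratios, which
makes the sum over `m` a geometric series in `-R`. -/
theorem koopmanTerm_index (u : L2) (t : ℝ≥0) (x : ℝ) (q₀ : ℕ) {m : ℕ} (q : Fin m → ℕ+) :
    koopmanTerm B.μ B.e t u x (index q₀ q) =
      -2 * (Real.exp (-(B.μ q₀ - B.μ 0) * t) *
        (coeff B.e q₀ (coleHopf u) / coeff B.e 0 (coleHopf u)) *
        (derivWithin (B.e q₀) (Icc 0 1) x / B.e 0 x)) *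
      ∏ i, -B.modeRatio u t x (q i) := by
  have h1 : (∏ i, -B.modeRatio u t x (q i)) = (-1) ^ m *
      (Real.exp (∑ i, -(B.μ (q i) - B.μ 0) * t) *
        (∏ i, coeff B.e (q i) (coleHopf u) / coeff B.e 0 (coleHopf u)) *
        ∏ i, B.e (q i) x / B.e 0 x) := by
    rw [Finset.prod_neg, Finset.card_univ, Fintype.card_fin, Real.exp_sum]
    simp only [modeRatio, Finset.prod_mul_distrib]
  have h2 : Real.exp (-lam B.μ (index q₀ q) * t) = Real.exp (-(B.μ q₀ - B.μ 0) * t) *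
      Real.exp (∑ i, -(B.μ (q i) - B.μ 0) * t) := by
    rw [← Real.exp_add, lam, Fin.sum_univ_succ]
    simp only [index, Fin.cons_zero, Fin.cons_succ]
    rw [← Finset.sum_mul, Finset.sum_neg_distrib]
    ring_nf
  rw [koopmanTerm, h2, h1, eigenfunctional, mode, Fin.prod_univ_succ]
  simp only [index, Fin.cons_zero, Fin.cons_succ, pow_succ]
  ring

theorem hasKoopmanDecomposition (hpos : ∀ x ∈ Icc (0 : ℝ) 1, 0 < B.e 0 x) {C : ℝ}
    (hC : IsSobolevConstant C) (u : L2) (t : ℝ≥0) (ht : 0 < t)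
    (hsmall : SmallnessCondition C B.μ B.e u t) :
    HasKoopmanDecomposition B.μ B.e t u (B.flow t u) := by
  have ht' : (0 : ℝ) < t := ht
  set z := coleHopfH1 P u with hz
  have hS : ∀ x ∈ Icc (0 : ℝ) 1, 0 < B.sol z t x := fun x hx =>
    B.sol_pos z ht' (fn_coleHopfH1_pos u) hx
  refine ⟨fun x => -2 * (B.solx z t x / B.sol z t x), ?_, B.flow_ae t ht u, fun x hx => ?_⟩
  · exact ((ContinuousOn.slice (B.continuousOn_solx z) ht').div
      (ContinuousOn.slice (B.continuousOn_sol z) ht') fun x hx => (hS x hx).ne').const_smul (-2 : ℝ)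
  set c₀ := coeff B.e 0 (coleHopf u) with hc₀
  have hc₀pos : 0 < c₀ := B.coeff_coleHopf_zero_pos hpos u
  have he₀ := hpos x hx
  -- The inverse of the ground mode of the heat solution: `K v = 1 + R` and `K v_x = ∑ A n`, so `-2
  -- v_x/v = -2 (∑ A n)/(1 + R)`.
  set K := Real.exp (B.μ 0 * t) / (c₀ * B.e 0 x) with hK
  have hKpos : 0 < K := by positivity
  have hexp : ∀ n, Real.exp (-(B.μ n - B.μ 0) * t) =
      Real.exp (B.μ 0 * t) * Real.exp (-B.μ n * t) := fun n => by
    rw [← Real.exp_add]; ring_nf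
  have hmr : HasSum (B.modeRatio u t x) (K * B.sol z t x) := by
    refine (((B.tame_coef_e z).hasSum ht' hx).mul_left K).congr_fun fun n => ?_
    rw [modeRatio, hexp, ← hc₀, B.coeff_coleHopf, ← hz, hK]
    field_simp
  have hmr0 : B.modeRatio u t x 0 = 1 := by
    rw [modeRatio, div_self hc₀pos.ne', div_self he₀.ne']; simp
  set R := K * B.sol z t x - 1 with hR
  have hmr1 : HasSum (fun n => B.modeRatio u t x (n + 1)) R := by
    have h1 := (hasSum_nat_add_iff' 1).mpr hmr
    rwa [Finset.sum_range_one, hmr0] at h1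
  have hbound := B.sum_abs_modeRatio_le hpos hC u ht' hx
  have habs : Summable fun n => |B.modeRatio u t x (n + 1)| :=
    summable_of_sum_le (fun _ => abs_nonneg _) hbound
  have hR1 : |R| < 1 := by
    rw [← hmr1.tsum_eq]
    have h1 : |∑' n, B.modeRatio u t x (n + 1)| ≤ ∑' n, |B.modeRatio u t x (n + 1)| :=
      norm_tsum_le_tsum_norm (f := fun n => B.modeRatio u t x (n + 1)) habs
    rw [SmallnessCondition] at hsmall
    exact (h1.trans (habs.tsum_le_of_sum_le hbound)).trans_lt hsmall
  have hp : ∀ n, ((Equiv.pnatEquivNat.symm n : ℕ+) : ℕ) = n + 1 := fun n => Nat.succPNat_coe n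
  have hr : HasSum (fun n : ℕ+ => -B.modeRatio u t x n) (-R) := by
    rw [← Equiv.pnatEquivNat.symm.hasSum_iff]
    refine hmr1.neg.congr_fun fun n => ?_
    rw [Function.comp_apply, hp]
  have hrs : Summable fun n : ℕ+ => |-B.modeRatio u t x n| := by
    rw [← Equiv.pnatEquivNat.symm.summable_iff]
    refine habs.congr fun n => ?_
    rw [Function.comp_apply, hp, abs_neg]
  set A : ℕ → ℝ := fun n => Real.exp (-(B.μ n - B.μ 0) * t) *
    (coeff B.e n (coleHopf u) / c₀) * (derivWithin (B.e n) (Icc 0 1) x / B.e 0 x) with hA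
  have hAs : HasSum A (K * B.solx z t x) := by
    refine (((B.tame_coef_e₁ z).hasSum ht' hx).mul_left K).congr_fun fun n => ?_
    have hd : derivWithin (B.e n) (Icc 0 1) x = B.e₁ n x :=
      ((B.eig n).deriv x hx).derivWithin (uniqueDiffOn_Icc zero_lt_one x hx)
    simp only [hA]
    rw [hexp, hd, B.coeff_coleHopf, ← hz, hK]
    field_simp
  have s1 : ∀ q₀ m, HasSum (fun q : Fin m → ℕ+ => koopmanTerm B.μ B.e t u x (index q₀ q))
      (-2 * A q₀ * (-R) ^ m) := fun q₀ m => by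
    refine ((hasSum_prod_fin hr hrs m).2.mul_left (-2 * A q₀)).congr_fun fun q => ?_
    rw [B.koopmanTerm_index]
  have s2 : ∀ q₀, HasSum (fun m : ℕ => ∑' q : Fin m → ℕ+, koopmanTerm B.μ B.e t u x (index q₀ q))
      (-2 * A q₀ * (1 - -R)⁻¹) := fun q₀ => by
    simp only [(s1 q₀ _).tsum_eq]
    exact (hasSum_geometric_of_abs_lt_one (by rwa [abs_neg])).mul_left _
  refine ⟨fun q₀ m => (s1 q₀ m).summable, fun q₀ => (s2 q₀).summable, ?_⟩
  simp only [(s2 _).tsum_eq]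
  have h3 := (hAs.mul_left (-2)).mul_right (1 - -R)⁻¹
  -- The sum of the geometric series is `1/(1 + R) = 1/(K v)`, and `K` cancels.
  have h4 : -2 * (B.solx z t x / B.sol z t x) =
      -2 * (K * B.solx z t x) * (1 - -R)⁻¹ := by
    have := (hS x hx).ne'
    rw [show 1 - -R = K * B.sol z t x by rw [hR]; ring]
    field_simp
  rw [h4]
  exact h3

end EigenBasis

end BurgersKoopman

end

/-! ### Assembly -/

theorem mainTheorem4 (V : ℝ → ℝ) (hV : ContDiffOn ℝ ∞ V (Icc 0 1))
    (hVpos : ∀ x ∈ Icc (0 : ℝ) 1, 0 < V x) :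
    (∃ (μ : ℕ → ℝ) (e : ℕ → ℝ → ℝ), IsNeumannEigensystem V μ e) ∧
    ∃ Φ : ℝ≥0 → C(L2, L2), IsBurgersFlow V Φ ∧
      ∀ (μ : ℕ → ℝ) (e : ℕ → ℝ → ℝ), IsNeumannEigensystem V μ e →
        (∀ u : L2, 0 < coeff e 0 (coleHopf u)) ∧
        (∀ (m : ℕ) (ν : Fin (m + 1) → ℕ),
          ∃ hφ : Continuous (eigenfunctional e ν), ∀ t : ℝ≥0,
            Module.End.HasEigenvector (koopman (Φ t)) (Real.exp (-lam μ ν * t))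
              ⟨eigenfunctional e ν, hφ⟩) ∧
        (∀ C₁ : ℝ, IsSobolevConstant C₁ → ∀ (u₀ : L2) (t : ℝ≥0), 0 < t →
          SmallnessCondition C₁ μ e u₀ t → HasKoopmanDecomposition μ e t u₀ (Φ t u₀)) := by
  let P : Potential := ⟨ofCont V hV.continuousOn, fun x => hVpos x x.2⟩
  have hPV : ∀ x ∈ Icc (0 : ℝ) 1, ext P.toC01 x = V x := fun x hx =>
    ext_ofCont hV.continuousOn hx
  obtain ⟨B₀, hpos₀⟩ := exists_eigenBasis_pos P
  have hΦ := B₀.isBurgersFlow_flow hpos₀ hV hPV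
  refine ⟨⟨_, _, B₀.isNeumannEigensystem hPV hpos₀⟩, B₀.flow, hΦ, fun μ e h => ?_⟩
  obtain ⟨B, rfl, rfl, -, hpos⟩ := h.exists_eigenBasis hPV
  refine ⟨B.coeff_coleHopf_zero_pos hpos, fun m ν =>
    ⟨B.continuous_eigenfunctional ν hpos, fun t => B.hasEigenvector_koopman ν hpos hV hPV hΦ t⟩,
    fun C₁ hC₁ u₀ t ht hsmall => ?_⟩
  -- The flow was built from `B₀`, the decomposition concerns the flow built from `B`; uniqueness of
  -- solutions identifies the two.
  rw [← (hΦ u₀ _).mp (B.isBurgersSolution_flow hV hPV u₀) t]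
  exact B.hasKoopmanDecomposition hpos hC₁ u₀ t ht hsmall
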